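/- **Setting.** Let $F$ be a totally real number field with ring of integers $\mathcal O$, and $E/F$ a quadratic extension with exactly one complex place $w_0$; let $v_0$ be the place of $F$ below $w_0$. Let $D$ be a quaternion division algebra over $F$ that is ramified at every real place of $F$ except $v_0$, and assume that $B=D\otimes_F E$ is a division algebra. Let $\mathbf G$ be the algebraic group over $F$ of elements of reduced norm $1$ in $B$, so $\mathbf G(F)=B^1$. Fix an identification $B\otimes_E E_{w_0}\simeq M_2(\mathbb C)$ under which $D$ consists of real matrices; it gives $G_0:=\mathbf G(F_{v_0})\simeq \mathrm{SL}(2,\mathbb C)$. Let $\mathcal O_B\subset B$ be a maximal $\mathcal O$-order and $S$ a finite set of places of $F$ containing the infinite places and the places where $D$ ramifies. Let $K=\prod_v K_v$ with $K_0:=K_{v_0}=\mathrm{SU}(2)$, $K_v=\mathbf G(F_v)$ for the other real places, $K_v=B_v^1\cap\mathcal O_{B,v}$ for $v\notin S$, and, for finite $v\in S$, $K_v\subset \mathbf G(F_v)$ any open subgroup stabilizing $\mathcal O_{B,v}$. Put $K_f=\prod_{v<\infty}K_v$, give $\mathbf G(\mathbb A_f)$ the Haar measure with $\mathrm{vol}(K_f)=1$,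 and give $G_0$ the Haar measure extending the hyperbolic volume on $\mathbb H^3=G_0/K_0$ by the measure of mass $1$ on $K_0$. Let $\mathcal H_f$ be the convolution algebra of smooth compactly supported $K_f$-bi-invariant functions on $\mathbf G(\mathbb A_f)$, with $\phi^*(g)=\overline{\phi(g^{-1})}$, acting by $(\phi f)(x)=\int_{\mathbf G(\mathbb A_f)}\phi(g)f(xg)\,dg$; let $\mathcal H^S\subset\mathcal H_f$ be the subalgebra of functions supported on elements whose component at every finite $v\in S$ lies in $K_v$. Let $X=\mathbf G(F)\backslash\mathbf G(\mathbb A)/K$. A Hecke–Maass form on $X$ with real spectral parameter $\lambda$ is a smooth function $\psi$ on $X$ with $\Delta\psi+(1+\lambda^2)\psi=0$ that is an eigenfunction of $\mathcal H^S$ and satisfies $\|\psi\|_{L^2(X)}=1$ for the hyperbolic volume. For $z\in\mathbb C$, $t\in\mathbb R$ put $n(z)=\begin{pmatrix}1&z\\0&1\end{pmatrix}$, $a(t)=\begin{pmatrix}e^{t/2}&0\\0&e^{-t/2}\end{pmatrix}$. For $b\in C_c^\infty(\mathbb R^2)$, $g_0\in G_0$ and a function $f$ on $X$ let $$\langle f,b\rangle=\int_{\mathbb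 R^2}b(x,t)\,f(g_0n(x)a(t))\,e^{-t}\,dx\,dt .$$ Fix $h\in C^\infty(\mathbb R)$ real-valued, nonnegative, with $h(0)=1$, of Paley–Wiener type: it extends to an entire function for which there is $R$ such that $|h(z)|\ll_N(1+|z|)^{-N}e^{R|\operatorname{Im}z|}$ for all $N$. For $\lambda\in\mathbb R$ let $k_\lambda^0$ be the continuous compactly supported $K_0$-bi-invariant function on $G_0$ with spherical transform $$\int_{G_0}k^0_\lambda(g)\varphi_s(g)\,dg=h(s-\lambda)+h(-s-\lambda)\quad(s\in\mathbb R),\qquad \varphi_s(g)=\int_{K_0}e^{(1+is)A(kg)}\,dk,$$ where $A(n(z)a(t)k)=t$ for $k\in K_0$. Put $k_\lambda=k^0_\lambda*k^0_\lambda$ and, for $g\in G_0$, $$I(\lambda,g)=\int_{\mathbb R^4}b(x_1,t_1)\overline{b(x_2,t_2)}\,k_\lambda\big(a(-t_1)n(-x_1)\,g\,n(x_2)a(t_2)\big)e^{-t_1-t_2}\,dx_1dt_1dx_2dt_2 .$$ **Proposition (amplification inequality).** There is a constant $C>0$, depending at most on the fixed data $F,E,D,\mathcal O_B,S,K$, the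 identification at $v_0$ and $h$, such that for every $\lambda\in\mathbb R$, every Hecke–Maass form $\psi$ on $X$ with spectral parameter $\lambda$, every $b\in C_c^\infty(\mathbb R^2)$, every $g_0\in G_0$ and every $\mathcal T\in\mathcal H_f$, the sum below converges and $$\left|\langle\mathcal T\psi,b\rangle\right|^2\le C\sum_{\gamma\in\mathbf G(F)}\left|(\mathcal T*\mathcal T^*)(\gamma)\,I(\lambda,g_0^{-1}\gamma g_0)\right| ,$$ where $\gamma$ is viewed in $\mathbf G(\mathbb A_f)$ and in $G_0$ through the natural embeddings. -/

import Mathlib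

open MeasureTheory NumberField IsDedekindDomain
open scoped Quaternion ComplexConjugate ContDiff MatrixGroups

noncomputable section

/-! ### The real group `SL(2, ℂ)`, hyperbolic space and spherical functions -/

namespace HypThree

/-- `SL(2, ℂ)`, the isometry group (up to `± 1`) of hyperbolic three-space. -/
abbrev G₀ : Type := SL(2, ℂ)

instance : MeasurableSpace G₀ := borel G₀
instance : BorelSpace G₀ := ⟨rfl⟩

/-- The maximal compact subgroup `SU(2)` of `SL(2, ℂ)`. -/
def K₀ : Subgroup G₀ where
  carrier := {g | (g : Matrix (Fin 2) (Fin 2) ℂ) ∈ Matrix.unitaryGroup (Fin 2) ℂ}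
  mul_mem' {g g'} hg hg' := by
    change ((g * g' : G₀) : Matrix (Fin 2) (Fin 2) ℂ) ∈ Matrix.unitaryGroup (Fin 2) ℂ
    rw [Matrix.SpecialLinearGroup.coe_mul]
    exact mul_mem hg hg'
  one_mem' := by simp
  inv_mem' {g} hg := by
    have h : ((g⁻¹ : G₀) : Matrix (Fin 2) (Fin 2) ℂ) = star (g : Matrix (Fin 2) (Fin 2) ℂ) := by
      have h1 : (g : Matrix (Fin 2) (Fin 2) ℂ) * star (g : Matrix (Fin 2) (Fin 2) ℂ) = 1 :=
        (Matrix.mem_unitaryGroup_iff).1 hg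
      have h2 : ((g⁻¹ : G₀) : Matrix (Fin 2) (Fin 2) ℂ) * (g : Matrix (Fin 2) (Fin 2) ℂ) = 1 := by
        rw [← Matrix.SpecialLinearGroup.coe_mul, inv_mul_cancel, Matrix.SpecialLinearGroup.coe_one]
      calc ((g⁻¹ : G₀) : Matrix (Fin 2) (Fin 2) ℂ)
          = ((g⁻¹ : G₀) : Matrix (Fin 2) (Fin 2) ℂ) *
            ((g : Matrix (Fin 2) (Fin 2) ℂ) * star (g : Matrix (Fin 2) (Fin 2) ℂ)) := by
              rw [h1, mul_one]
        _ = star (g : Matrix (Fin 2) (Fin 2) ℂ) := by rw [← mul_assoc, h2, one_mul]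
    change ((g⁻¹ : G₀) : Matrix (Fin 2) (Fin 2) ℂ) ∈ Matrix.unitaryGroup (Fin 2) ℂ
    rw [h]
    exact Unitary.star_mem hg

instance : CompactSpace K₀ := by
  let ι : K₀ → Matrix (Fin 2) (Fin 2) ℂ := fun k => ((k : G₀) : Matrix (Fin 2) (Fin 2) ℂ)
  have hι : Topology.IsEmbedding ι :=
    Topology.IsEmbedding.subtypeVal.comp Topology.IsEmbedding.subtypeVal
  have hr : Set.range ι =
      {A : Matrix (Fin 2) (Fin 2) ℂ | A * star A = 1 ∧ A.det = 1} := by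
    ext A
    constructor
    · rintro ⟨k, rfl⟩
      exact ⟨(Matrix.mem_unitaryGroup_iff).1 k.2, (k : G₀).2⟩
    · rintro ⟨h1, h2⟩
      exact ⟨⟨⟨A, h2⟩, (Matrix.mem_unitaryGroup_iff).2 h1⟩, rfl⟩
  have hc : IsCompact (Set.range ι) := by
    have hclosed : IsClosed (Set.range ι) := by
      rw [hr]
      exact (isClosed_eq (continuous_id.mul continuous_id.star) continuous_const).inter
        (isClosed_eq continuous_id.matrix_det continuous_const)
    have hsub : Set.range ι ⊆
        Set.pi Set.univ (fun _ : Fin 2 =>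
          Set.pi Set.univ (fun _ : Fin 2 => Metric.closedBall (0 : ℂ) 1)) := by
      rintro _ ⟨k, rfl⟩ i _ j _
      rw [mem_closedBall_zero_iff]
      exact entry_norm_bound_of_unitary k.2 i j
    exact (isCompact_univ_pi fun _ => isCompact_univ_pi fun _ =>
      isCompact_closedBall _ _).of_isClosed_subset hclosed hsub
  exact ⟨hι.isCompact_iff.2 (by rwa [Set.image_univ])⟩

/-- The Haar measure of total mass one on `SU(2)`. -/
def haarK₀ : Measure K₀ := Measure.haarMeasure ⊤

/-- The unipotent element `n(z)`. -/
def n (z : ℂ) : G₀ := ⟨!![1, z; 0, 1], by simp [Matrix.det_fin_two]⟩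

/-- The diagonal element `a(t) = diag(e^{t/2}, e^{-t/2})`. -/
def a (t : ℝ) : G₀ :=
  ⟨!![(Real.exp (t / 2) : ℂ), 0; 0, (Real.exp (-t / 2) : ℂ)], by
    rw [Matrix.det_fin_two_of, mul_zero, sub_zero, ← Complex.ofReal_mul, ← Real.exp_add]
    simp [neg_div]⟩

/-- The hyperbolic volume on `ℍ³`, in the global coordinates `(z, t) ↦ n(z) a(t) · (0, 1) =
(z, e^t)` of the upper half-space: `dz dτ / τ ^ 3 = e ^ (-2t) dz dt` with `τ = e ^ t`. -/
def hypVolume : Measure (ℂ × ℝ) :=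
  (volume : Measure (ℂ × ℝ)).withDensity fun p => ENNReal.ofReal (Real.exp (-2 * p.2))

/-- The Haar measure on `SL(2, ℂ)` that extends the hyperbolic volume on `ℍ³ = SL(2, ℂ) / SU(2)`
by the measure of mass one on `SU(2)` (Iwasawa decomposition). -/
def haarG₀ : Measure G₀ :=
  Measure.map (fun p : (ℂ × ℝ) × K₀ => n p.1.1 * a p.1.2 * (p.2 : G₀)) (hypVolume.prod haarK₀)

/-- The Iwasawa height: `iwasawa (n(z) a(t) k) = t` for `k ∈ SU(2)`. -/
def iwasawa (g : G₀) : ℝ := -Real.log (‖g 1 0‖ ^ 2 + ‖g 1 1‖ ^ 2)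

/-- The spherical function `φ_s(g) = ∫_{SU(2)} exp((1 + is) A(kg)) dk`. -/
def sphericalFunction (s : ℝ) (g : G₀) : ℂ :=
  ∫ k : K₀, Complex.exp ((1 + Complex.I * (s : ℂ)) * (iwasawa ((k : G₀) * g) : ℂ)) ∂haarK₀

/-- The spherical (Harish-Chandra) transform of a function on `SL(2, ℂ)`. -/
def sphericalTransform (k : G₀ → ℂ) (s : ℝ) : ℂ :=
  ∫ g : G₀, k g * sphericalFunction s g ∂haarG₀

/-- `k` is a continuous compactly supported `SU(2)`-bi-invariant function on `SL(2, ℂ)` whose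
spherical transform is `H`. -/
def HasSphericalTransform (k : G₀ → ℂ) (H : ℝ → ℂ) : Prop :=
  Continuous k ∧ HasCompactSupport k ∧ (∀ u ∈ K₀, ∀ v ∈ K₀, ∀ g, k (u * g * v) = k g) ∧
    ∀ s : ℝ, sphericalTransform k s = H s

/-- The `SU(2)`-bi-invariant function with spherical transform `H`. -/
def ofSphericalTransform (H : ℝ → ℂ) : G₀ → ℂ :=
  Classical.epsilon fun k => HasSphericalTransform k H

/-- Convolution on `SL(2, ℂ)`. -/
def conv (f₁ f₂ : G₀ → ℂ) (g : G₀) : ℂ := ∫ x : G₀, f₁ x * f₂ (x⁻¹ * g) ∂haarG₀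

/-- A function on the real line of Paley-Wiener type: the restriction of an entire function of
exponential type that decays rapidly on horizontal strips. -/
def IsPaleyWiener (h : ℝ → ℝ) : Prop :=
  ∃ H : ℂ → ℂ, Differentiable ℂ H ∧ (∀ x : ℝ, H x = h x) ∧
    ∃ R : ℝ, ∀ N : ℕ, ∃ C : ℝ, ∀ z : ℂ,
      ‖H z‖ * (1 + ‖z‖) ^ N ≤ C * Real.exp (R * |z.im|)

/-- The function `h_λ⁰(s) = h(s - λ) + h(-s - λ)`. -/
def h0 (h : ℝ → ℝ) (lam s : ℝ) : ℂ := ((h (s - lam) + h (-s - lam) : ℝ) : ℂ)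

/-- The bi-invariant function `k_λ⁰` with spherical transform `h_λ⁰`. -/
def k0 (h : ℝ → ℝ) (lam : ℝ) : G₀ → ℂ := ofSphericalTransform (h0 h lam)

/-- The test function `k_λ = k_λ⁰ * k_λ⁰`. -/
def kTest (h : ℝ → ℝ) (lam : ℝ) : G₀ → ℂ := conv (k0 h lam) (k0 h lam)

/-- The integral `I(λ, g)`. -/
def integralI (h : ℝ → ℝ) (b : ℝ × ℝ → ℂ) (lam : ℝ) (g : G₀) : ℂ :=
  ∫ p : (ℝ × ℝ) × (ℝ × ℝ),
    b p.1 * conj (b p.2) *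
      kTest h lam (a (-p.1.2) * n (-(p.1.1 : ℂ)) * g * n (p.2.1 : ℂ) * a p.2.2) *
      (Real.exp (-p.1.2 - p.2.2) : ℂ)

/-- The pairing `⟨f, b⟩` of a function on `SL(2, ℂ) / SU(2)` with a cutoff function `b` on the
translate by `g₀` of the totally geodesic hyperbolic plane `{n(x) a(t) · (0, 1)}`. -/
def pairing (g₀ : G₀) (f : G₀ → ℂ) (b : ℝ × ℝ → ℂ) : ℂ :=
  ∫ p : ℝ × ℝ, b p * f (g₀ * n (p.1 : ℂ) * a p.2) * (Real.exp (-p.2) : ℂ)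

/-- The function `f` on `ℍ³ = SL(2, ℂ) / SU(2)` in the global coordinates `(x, y, t)`,
which stand for the point `(x + iy, e ^ t)` of the upper half-space. -/
def coord (f : G₀ → ℂ) (x y t : ℝ) : ℂ := f (n ⟨x, y⟩ * a t)

/-- The Laplace operator of `ℍ³`, `τ²(∂_x² + ∂_y² + ∂_τ²) - τ ∂_τ`, in the coordinates
`(x, y, t)`, `τ = e ^ t`. -/
def laplacian (f : G₀ → ℂ) (x y t : ℝ) : ℂ :=
  (Real.exp (2 * t) : ℂ) *
      (iteratedDeriv 2 (fun x' => coord f x' y t) x +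
        iteratedDeriv 2 (fun y' => coord f x y' t) y) +
    iteratedDeriv 2 (fun t' => coord f x y t') t - 2 * deriv (fun t' => coord f x y t') t

end HypThree

/-! ### Quaternion algebras and their groups of elements of reduced norm one -/

namespace Quat

/-- The homomorphism of quaternion algebras induced by a homomorphism of the coefficients. -/
def map {R R' : Type*} [CommRing R] [CommRing R'] (f : R →+* R') {a b : R} {a' b' : R'}
    (ha : f a = a') (hb : f b = b') : ℍ[R,a,b] →+* ℍ[R',a',b'] where
  toFun q := ⟨f q.re, f q.imI, f q.imJ, f q.imK⟩
  map_one' := by ext <;> simp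
  map_zero' := by ext <;> simp
  map_add' p q := by ext <;> simp
  map_mul' p q := by ext <;> simp [ha, hb]

theorem map_star {R R' : Type*} [CommRing R] [CommRing R'] (f : R →+* R') {a b : R} {a' b' : R'}
    (ha : f a = a') (hb : f b = b') (q : ℍ[R,a,b]) :
    map f ha hb (star q) = star (map f ha hb q) := by
  ext <;> simp [map]

/-- The elements `x` of reduced norm `x * star x = 1` of the quaternion algebra `(a, b / R)`. -/
abbrev NormOne (R : Type*) [CommRing R] (a b : R) : Type _ := unitary ℍ[R,a,b]

/-- The homomorphism of norm-one groups induced by a homomorphism of the coefficients. -/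
def mapNormOne {R R' : Type*} [CommRing R] [CommRing R'] (f : R →+* R') {a b : R} {a' b' : R'}
    (ha : f a = a') (hb : f b = b') : NormOne R a b →* NormOne R' a' b' where
  toFun q := ⟨map f ha hb q, by
    rw [Unitary.mem_iff, ← map_star, ← map_mul, ← map_mul, Unitary.star_mul_self_of_mem q.2,
      Unitary.mul_star_self_of_mem q.2, map_one]
    exact ⟨rfl, rfl⟩⟩
  map_one' := Subtype.ext (map_one _)
  map_mul' p q := Subtype.ext (map_mul _ _ _)

/-- A quaternion algebra over a topological ring has the topology of the free module of rank
four. -/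
instance {R : Type*} [TopologicalSpace R] (a b : R) [Zero R] : TopologicalSpace ℍ[R,a,b] :=
  TopologicalSpace.induced (QuaternionAlgebra.equivProd a 0 b) inferInstance

instance {R : Type*} [TopologicalSpace R] [CommRing R] (a b : R) :
    MeasurableSpace (NormOne R a b) := borel _
instance {R : Type*} [TopologicalSpace R] [CommRing R] (a b : R) :
    BorelSpace (NormOne R a b) := ⟨rfl⟩

/-- The quaternion algebra `(a, b / R)` is a division algebra. -/
def IsDivision (R : Type*) [CommRing R] (a b : R) : Prop :=
  ∀ x : ℍ[R,a,b], x ≠ 0 → IsUnit x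

section Splitting

variable {C : Type*} [Field C] {a b : C} (f : C →+* ℂ)
  (θ : Matrix (Fin 2) (Fin 2) ℂ ≃+* ℍ[C,a,b])

theorem symm_star (ha : a ≠ 0) (hb : b ≠ 0)
    (hθ : ∀ c : C, θ.symm (algebraMap C ℍ[C,a,b] c) = Matrix.scalar (Fin 2) (f c))
    (q : ℍ[C,a,b]) : θ.symm (star q) = (θ.symm q).adjugate := by
  set X := θ.symm (⟨0, 1, 0, 0⟩ : ℍ[C,a,b]) with hX
  set Y := θ.symm (⟨0, 0, 1, 0⟩ : ℍ[C,a,b]) with hY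
  have hsc : ∀ (c : C) (q : ℍ[C,a,b]), θ.symm (algebraMap C ℍ[C,a,b] c * q) =
      f c • θ.symm q := by
    intro c q
    rw [map_mul, hθ, Matrix.scalar_apply, ← Matrix.smul_eq_diagonal_mul]
  have hXX : X * X = f a • (1 : Matrix (Fin 2) (Fin 2) ℂ) := by
    rw [hX, ← map_mul, ← map_one θ.symm, ← hsc]
    congr 1
    ext <;> simp
  have hYY : Y * Y = f b • (1 : Matrix (Fin 2) (Fin 2) ℂ) := by
    rw [hY, ← map_mul, ← map_one θ.symm, ← hsc]
    congr 1
    ext <;> simp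
  have hYX : Y * X = -(X * Y) := by
    rw [hX, hY, ← map_mul, ← map_mul, ← map_neg]
    congr 1
    ext <;> simp
  have hfa : f a ≠ 0 := (map_ne_zero f).2 ha
  have hfb : f b ≠ 0 := (map_ne_zero f).2 hb
  have two : ∀ z : ℂ, z = -z → z = 0 := fun z h => by
    have : (2 : ℂ) * z = 0 := by linear_combination h
    simpa using this
  have tXY : (X * Y).trace = 0 := two _ (by
    rw [← Matrix.trace_neg, ← hYX, Matrix.trace_mul_comm])
  have tX : X.trace = 0 := by
    have h : (X * (Y * Y)).trace = -(X * (Y * Y)).trace := by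
      conv_rhs => rw [← mul_assoc, Matrix.trace_mul_comm, ← mul_assoc, hYX, neg_mul,
        Matrix.trace_neg, neg_neg, mul_assoc]
    have h' := two _ h
    rw [hYY, mul_smul_comm, mul_one, Matrix.trace_smul, smul_eq_mul] at h'
    exact (mul_eq_zero.1 h').resolve_left hfb
  have tY : Y.trace = 0 := by
    have h : (Y * (X * X)).trace = -(Y * (X * X)).trace := by
      conv_rhs => rw [← mul_assoc, hYX, neg_mul, Matrix.trace_neg, neg_neg,
        Matrix.trace_mul_comm, ← mul_assoc, Matrix.trace_mul_comm]
    have h' := two _ h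
    rw [hXX, mul_smul_comm, mul_one, Matrix.trace_smul, smul_eq_mul] at h'
    exact (mul_eq_zero.1 h').resolve_left hfa
  have hq : ∀ q : ℍ[C,a,b], θ.symm q =
      f q.re • (1 : Matrix (Fin 2) (Fin 2) ℂ) + f q.imI • X + f q.imJ • Y + f q.imK • (X * Y) := by
    intro q
    rw [hX, hY, ← map_mul, ← map_one θ.symm, ← hsc, ← hsc, ← hsc, ← hsc, ← map_add, ← map_add,
      ← map_add]
    congr 1
    ext <;> simp
  have hadj : ∀ M : Matrix (Fin 2) (Fin 2) ℂ,
      M.adjugate = M.trace • (1 : Matrix (Fin 2) (Fin 2) ℂ) - M := by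
    intro M
    ext i j
    fin_cases i <;> fin_cases j <;> simp [Matrix.adjugate_fin_two, Matrix.trace_fin_two]
  have htr : (θ.symm q).trace = 2 * f q.re := by
    rw [hq q]
    simp only [Matrix.trace_add, Matrix.trace_smul, tX, tY, tXY, Matrix.trace_one, smul_eq_mul]
    simp [mul_comm]
  rw [hadj, htr, hq (star q), hq q]
  simp only [QuaternionAlgebra.re_star, QuaternionAlgebra.imI_star, QuaternionAlgebra.imJ_star,
    QuaternionAlgebra.imK_star, map_neg, neg_smul, zero_mul, add_zero]
  module

/-- The isomorphism `SL(2, ℂ) ≃ B¹` induced by an isomorphism `M₂(ℂ) ≃ B` that is compatible with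
the centres. -/
def normOneEquiv (ha : a ≠ 0) (hb : b ≠ 0)
    (hθ : ∀ c : C, θ.symm (algebraMap C ℍ[C,a,b] c) = Matrix.scalar (Fin 2) (f c)) :
    SL(2, ℂ) ≃* NormOne C a b where
  toFun g := ⟨θ (g : Matrix (Fin 2) (Fin 2) ℂ), by
    have h : star (θ (g : Matrix (Fin 2) (Fin 2) ℂ)) =
        θ ((g : Matrix (Fin 2) (Fin 2) ℂ).adjugate) := by
      rw [← θ.symm_apply_eq, symm_star f θ ha hb hθ, θ.symm_apply_apply]
    rw [Unitary.mem_iff, h, ← map_mul, ← map_mul, Matrix.adjugate_mul, Matrix.mul_adjugate,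
      g.det_coe, one_smul, map_one]
    exact ⟨rfl, rfl⟩⟩
  invFun q := ⟨θ.symm (q : ℍ[C,a,b]), by
    have h := Matrix.mul_adjugate (θ.symm (q : ℍ[C,a,b]))
    rw [← symm_star f θ ha hb hθ, ← map_mul, Unitary.mul_star_self_of_mem q.2, map_one] at h
    have h00 := congrFun (congrFun h 0) 0
    simpa using h00.symm⟩
  left_inv g := by ext i j; simp
  right_inv q := by ext1; simp
  map_mul' g g' := by ext1; simp

end Splitting

end Quat

/-! ### The arithmetic data -/

section Arithmetic

open Quat HypThree

/-- An `𝓞 F`-order in the quaternion algebra `(a, b / E)`, `E / F` an extension of number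
fields. -/
def IsQuatOrder {F E : Type*} [Field F] [Field E] [Algebra F E] {a b : E}
    (O : Subalgebra (𝓞 F) ℍ[E,a,b]) : Prop :=
  (Subalgebra.toSubmodule O).FG ∧ Submodule.span F (O : Set ℍ[E,a,b]) = ⊤

/-- A maximal `𝓞 F`-order in the quaternion algebra `(a, b / E)`. -/
def IsMaximalQuatOrder {F E : Type*} [Field F] [Field E] [Algebra F E] {a b : E}
    (O : Subalgebra (𝓞 F) ℍ[E,a,b]) : Prop :=
  IsQuatOrder O ∧ ∀ O' : Subalgebra (𝓞 F) ℍ[E,a,b], IsQuatOrder O' → O ≤ O' → O' = O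

section Local

variable {F E : Type*} [Field F] [NumberField F] [Field E] [NumberField E] [Algebra F E]

/-- The finite places of `E` above a finite place `v` of `F`. -/
abbrev PlacesAbove (E : Type*) [Field E] [NumberField E] [Algebra F E]
    (v : HeightOneSpectrum (𝓞 F)) : Type _ :=
  {w : HeightOneSpectrum (𝓞 E) // w.asIdeal.under (𝓞 F) = v.asIdeal}

/-- `B_v = B ⊗_F F_v = ∏_{w ∣ v} B ⊗_E E_w` for `B = (a, b / E)`. -/
abbrev LocalAlgebra (a b : E) (v : HeightOneSpectrum (𝓞 F)) : Type _ :=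
  (w : PlacesAbove E v) → ℍ[w.1.adicCompletion E, algebraMap E (w.1.adicCompletion E) a,
    algebraMap E (w.1.adicCompletion E) b]

/-- The group `G_v` of elements of reduced norm one in `B_v`. -/
abbrev LocalGroup (a b : E) (v : HeightOneSpectrum (𝓞 F)) : Type _ :=
  (w : PlacesAbove E v) → NormOne (w.1.adicCompletion E) (algebraMap E (w.1.adicCompletion E) a)
    (algebraMap E (w.1.adicCompletion E) b)

/-- The underlying element of `B_v` of an element of `G_v`. -/
def LocalGroup.val {a b : E} {v : HeightOneSpectrum (𝓞 F)} (g : LocalGroup a b v) :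
    LocalAlgebra a b v := fun w => (g w : ℍ[w.1.adicCompletion E,
      algebraMap E (w.1.adicCompletion E) a, algebraMap E (w.1.adicCompletion E) b])

/-- The completion `O_{B,v} = O_B ⊗ O_v` of an order `O_B`, as the closure of `O_B` in `B_v`. -/
def localOrder {a b : E} (O : Subalgebra (𝓞 F) ℍ[E,a,b]) (v : HeightOneSpectrum (𝓞 F)) :
    Set (LocalAlgebra a b v) :=
  closure ((fun (x : ℍ[E,a,b]) (w : PlacesAbove E v) =>
    Quat.map (algebraMap E (w.1.adicCompletion E)) rfl rfl x) '' (O : Set ℍ[E,a,b]))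

end Local

/-- The data that define a congruence arithmetic hyperbolic three-manifold which contains
hyperbolic surfaces: a totally real field `F`, a quadratic extension `E` with exactly one complex
place `w₀`, a quaternion division algebra `D = (a, b / F)` that is ramified at every real place
except the place `v₀` below `w₀`, such that `B = D ⊗_F E = (a, b / E)` is a division algebra, a
maximal order of `B`, a level structure, and an identification of `B ⊗ E_{w₀}` with `M₂(ℂ)`. -/
structure ArithmeticDatum (F E : Type*) [Field F] [NumberField F] [Field E] [NumberField E]
    [Algebra F E] where
  finrank_eq : Module.finrank F E = 2
  /-- The complex place of `E`. -/
  w₀ : InfinitePlace E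
  isComplex_w₀ : w₀.IsComplex
  eq_w₀ : ∀ w : InfinitePlace E, w.IsComplex → w = w₀
  /-- The structure constants of `D = (a, b / F)`. -/
  a : F
  b : F
  division_D : IsDivision F a b
  division_B : IsDivision E (algebraMap F E a) (algebraMap F E b)
  ramified_iff : ∀ v : InfinitePlace F,
    IsDivision v.Completion (algebraMap F v.Completion a) (algebraMap F v.Completion b) ↔
      v ≠ w₀.comap (algebraMap F E)
  /-- The maximal order `O_B`. -/
  order : Subalgebra (𝓞 F) ℍ[E, algebraMap F E a, algebraMap F E b]
  isMaximal : IsMaximalQuatOrder order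
  /-- The finite places in the set `S`. -/
  S : Finset (HeightOneSpectrum (𝓞 F))
  ramified_mem_S : ∀ v : HeightOneSpectrum (𝓞 F),
    IsDivision (v.adicCompletion F) (algebraMap F (v.adicCompletion F) a)
      (algebraMap F (v.adicCompletion F) b) → v ∈ S
  /-- The groups `K_v` at the finite places. -/
  level : (v : HeightOneSpectrum (𝓞 F)) →
    Subgroup (LocalGroup (algebraMap F E a) (algebraMap F E b) v)
  isOpen_level : ∀ v, IsOpen (level v : Set (LocalGroup (algebraMap F E a) (algebraMap F E b) v))
  level_stabilizes : ∀ v ∈ S, ∀ k ∈ level v, ∀ x ∈ localOrder order v,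
    k.val * x ∈ localOrder order v
  level_eq : ∀ v ∉ S, ∀ k, k ∈ level v ↔ k.val ∈ localOrder order v
  /-- The identification of `M₂(ℂ)` with `B ⊗_E E_{w₀}`. -/
  splitting : Matrix (Fin 2) (Fin 2) ℂ ≃+*
    ℍ[w₀.Completion, algebraMap E w₀.Completion (algebraMap F E a),
      algebraMap E w₀.Completion (algebraMap F E b)]
  splitting_scalar : ∀ c : w₀.Completion, splitting.symm (algebraMap w₀.Completion _ c) =
    Matrix.scalar (Fin 2) (InfinitePlace.Completion.extensionEmbedding w₀ c)
  /-- Under this identification `D` consists of real matrices. -/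
  splitting_real : ∀ (x : ℍ[F,a,b]) (i j : Fin 2),
    (splitting.symm (Quat.map (algebraMap E w₀.Completion) rfl rfl
      (Quat.map (algebraMap F E) rfl rfl x)) i j).im = 0

namespace ArithmeticDatum

variable {F E : Type*} [Field F] [NumberField F] [Field E] [NumberField E] [Algebra F E]
  (𝒟 : ArithmeticDatum F E)

/-- `B = (aE, bE / E)`. -/
abbrev aE : E := algebraMap F E 𝒟.a
/-- `B = (aE, bE / E)`. -/
abbrev bE : E := algebraMap F E 𝒟.b

theorem a_ne_zero : 𝒟.a ≠ 0 := by
  intro h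
  have hi : IsUnit (⟨0, 1, 0, 0⟩ : ℍ[F,𝒟.a,𝒟.b]) :=
    𝒟.division_D _ fun h0 => one_ne_zero (congrArg QuaternionAlgebra.imI h0)
  have h2 : (⟨0, 1, 0, 0⟩ : ℍ[F,𝒟.a,𝒟.b]) * ⟨0, 1, 0, 0⟩ = 0 := by ext <;> simp [h]
  exact not_isUnit_zero (h2 ▸ hi.mul hi)

theorem b_ne_zero : 𝒟.b ≠ 0 := by
  intro h
  have hi : IsUnit (⟨0, 0, 1, 0⟩ : ℍ[F,𝒟.a,𝒟.b]) :=
    𝒟.division_D _ fun h0 => one_ne_zero (congrArg QuaternionAlgebra.imJ h0)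
  have h2 : (⟨0, 0, 1, 0⟩ : ℍ[F,𝒟.a,𝒟.b]) * ⟨0, 0, 1, 0⟩ = 0 := by ext <;> simp [h]
  exact not_isUnit_zero (h2 ▸ hi.mul hi)

/-- The group of rational points `𝐆(F) = B¹`. -/
abbrev GF : Type _ := NormOne E 𝒟.aE 𝒟.bE

/-- The local group at an infinite place of `E`. -/
abbrev Ginf (w : InfinitePlace E) : Type _ :=
  NormOne w.Completion (algebraMap E w.Completion 𝒟.aE) (algebraMap E w.Completion 𝒟.bE)

/-- The group of finite adelic points: `𝐆(𝔸_f)` is the group of elements of reduced norm one of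
`B ⊗_F 𝔸_f = B ⊗_E 𝔸_{E,f}`. -/
abbrev Gfin : Type _ :=
  NormOne (FiniteAdeleRing (𝓞 E) E) (algebraMap E (FiniteAdeleRing (𝓞 E) E) 𝒟.aE)
    (algebraMap E (FiniteAdeleRing (𝓞 E) E) 𝒟.bE)

/-- The group of adelic points `𝐆(𝔸)`. -/
abbrev GA : Type _ := ((w : InfinitePlace E) → 𝒟.Ginf w) × 𝒟.Gfin

/-- The identification of `SL(2, ℂ)` with `G_{v₀}`. -/
def ι : G₀ ≃* 𝒟.Ginf 𝒟.w₀ :=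
  normOneEquiv (InfinitePlace.Completion.extensionEmbedding 𝒟.w₀) 𝒟.splitting
    ((map_ne_zero _).2 ((map_ne_zero _).2 𝒟.a_ne_zero))
    ((map_ne_zero _).2 ((map_ne_zero _).2 𝒟.b_ne_zero)) 𝒟.splitting_scalar

/-- The embedding `𝐆(F) → 𝐆(𝔸_f)`. -/
def toFin : 𝒟.GF →* 𝒟.Gfin := mapNormOne (algebraMap E (FiniteAdeleRing (𝓞 E) E)) rfl rfl

/-- The embedding of `𝐆(F)` into the group at an infinite place. -/
def toInf (w : InfinitePlace E) : 𝒟.GF →* 𝒟.Ginf w :=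
  mapNormOne (algebraMap E w.Completion) rfl rfl

/-- The diagonal embedding `𝐆(F) → 𝐆(𝔸)`. -/
def diag (γ : 𝒟.GF) : 𝒟.GA := (fun w => 𝒟.toInf w γ, 𝒟.toFin γ)

/-- The image in `SL(2, ℂ) = G_{v₀}` of an element of `𝐆(F)`. -/
def toG₀ (γ : 𝒟.GF) : G₀ := 𝒟.ι.symm (𝒟.toInf 𝒟.w₀ γ)

open Classical in
/-- The element of `𝐆(𝔸)` with component `g` at `v₀`, finite component `u`, and component one at
the other infinite places. -/
def atV₀ (g : G₀) (u : 𝒟.Gfin) : 𝒟.GA := (Pi.mulSingle 𝒟.w₀ (𝒟.ι g), u)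

/-- The component at `v` of an element of `𝐆(𝔸_f)`. -/
def component (v : HeightOneSpectrum (𝓞 F)) (u : 𝒟.Gfin) : LocalGroup 𝒟.aE 𝒟.bE v := fun w =>
  mapNormOne (⟨⟨⟨fun x => x w.1, rfl⟩, fun _ _ => rfl⟩, rfl, fun _ _ => rfl⟩ :
    FiniteAdeleRing (𝓞 E) E →+* w.1.adicCompletion E) rfl rfl u

/-- The group `K_f = ∏_{v < ∞} K_v`. -/
def Kf : Subgroup 𝒟.Gfin where
  carrier := {u | ∀ v, 𝒟.component v u ∈ 𝒟.level v}
  mul_mem' {u u'} hu hu' v := by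
    have h : 𝒟.component v (u * u') = 𝒟.component v u * 𝒟.component v u' :=
      funext fun w => map_mul _ _ _
    rw [h]; exact mul_mem (hu v) (hu' v)
  one_mem' v := by
    have h : 𝒟.component v 1 = 1 := funext fun w => map_one _
    rw [h]; exact one_mem _
  inv_mem' {u} hu v := by
    have h : 𝒟.component v u⁻¹ = (𝒟.component v u)⁻¹ := funext fun w => map_inv _ _
    rw [h]; exact inv_mem (hu v)

/-- The compact subgroup `K = ∏_v K_v` of `𝐆(𝔸)`: `SU(2)` at `v₀`, the whole group at the other
infinite places, and `K_f` at the finite places. -/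
def K : Set 𝒟.GA := {k | 𝒟.ι.symm (k.1 𝒟.w₀) ∈ K₀ ∧ k.2 ∈ 𝒟.Kf}

/-- The finite Hecke algebra `ℋ_f` of smooth (locally constant) compactly supported
`K_f`-bi-invariant functions on `𝐆(𝔸_f)`. -/
def heckeAlgebra : Set (𝒟.Gfin → ℂ) :=
  {φ | IsLocallyConstant φ ∧ HasCompactSupport φ ∧
    ∀ k ∈ 𝒟.Kf, ∀ k' ∈ 𝒟.Kf, ∀ u, φ (k * u * k') = φ u}

/-- The Hecke algebra `ℋ^S` away from `S`: the functions of the form `φ^S ⊗ ∏_{v ∈ S} 1_{K_v}`. -/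
def heckeAlgebraAway : Set (𝒟.Gfin → ℂ) :=
  {φ | φ ∈ 𝒟.heckeAlgebra ∧ ∀ u, φ u ≠ 0 → ∀ v ∈ 𝒟.S, 𝒟.component v u ∈ 𝒟.level v}

/-- Convolution on `𝐆(𝔸_f)`. -/
def hconv (μ : Measure 𝒟.Gfin) (φ₁ φ₂ : 𝒟.Gfin → ℂ) (u : 𝒟.Gfin) : ℂ :=
  ∫ x, φ₁ x * φ₂ (x⁻¹ * u) ∂μ

/-- The adjoint `φ^*(u) = conj (φ (u⁻¹))`. -/
def adjoint (φ : 𝒟.Gfin → ℂ) (u : 𝒟.Gfin) : ℂ := conj (φ u⁻¹)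

/-- The action of `ℋ_f` on functions on `𝐆(𝔸)` by right translation. -/
def act (μ : Measure 𝒟.Gfin) (φ : 𝒟.Gfin → ℂ) (ψ : 𝒟.GA → ℂ) (x : 𝒟.GA) : ℂ :=
  ∫ u, φ u * ψ (x * (1, u)) ∂μ

/-- `γ ∈ 𝐆(F)` acts trivially on `𝐆(𝔸) / K = ℍ³ × 𝐆(𝔸_f) / K_f`. -/
def ActsTrivially (γ : 𝒟.GF) : Prop :=
  ∀ (g : G₀) (u : 𝒟.Gfin), (𝒟.toG₀ γ * g)⁻¹ * g ∈ K₀ ∧ (𝒟.toFin γ * u)⁻¹ * u ∈ 𝒟.Kf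

/-- A fundamental domain, as a right `SU(2) × K_f`-invariant subset of `SL(2, ℂ) × 𝐆(𝔸_f)`, for
the action of `𝐆(F)` on `ℍ³ × 𝐆(𝔸_f) / K_f = 𝐆(𝔸) / K`, whose quotient is `X`. -/
structure IsFundDomain (μ : Measure 𝒟.Gfin) (s : Set (G₀ × 𝒟.Gfin)) : Prop where
  measurableSet : MeasurableSet s
  right_invariant : ∀ p ∈ s, ∀ k ∈ K₀, ∀ u ∈ 𝒟.Kf, (p.1 * k, p.2 * u) ∈ s
  covers : ∀ᵐ p ∂(haarG₀.prod μ), ∃ γ : 𝒟.GF, (𝒟.toG₀ γ * p.1, 𝒟.toFin γ * p.2) ∈ s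
  disjoint : ∀ γ : 𝒟.GF, ¬ 𝒟.ActsTrivially γ →
    (haarG₀.prod μ) {p | p ∈ s ∧ (𝒟.toG₀ γ * p.1, 𝒟.toFin γ * p.2) ∈ s} = 0

/-- `∫_X |ψ|² = 1` for the hyperbolic volume on `X = 𝐆(F) \ 𝐆(𝔸) / K`. The measure `μ` on
`𝐆(𝔸_f)` is the Haar measure with `μ K_f = 1`, so that the integral over a fundamental domain is
the integral for the hyperbolic volume on `ℍ³` and the counting measure on `𝐆(𝔸_f) / K_f`. -/
def IsL2Normalized (μ : Measure 𝒟.Gfin) (ψ : 𝒟.GA → ℂ) : Prop :=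
  ∃ s, 𝒟.IsFundDomain μ s ∧
    ∫⁻ p in s, ‖ψ (𝒟.atV₀ p.1 p.2)‖ₑ ^ 2 ∂(haarG₀.prod μ) = 1

/-- `ψ` is an `L²`-normalized Hecke-Maass form on `X = 𝐆(F) \ 𝐆(𝔸) / K` with spectral parameter
`lam`: a smooth function with `Δψ + (1 + lam²)ψ = 0` that is an eigenfunction of `ℋ^S`. -/
structure IsHeckeMaassForm (μ : Measure 𝒟.Gfin) (ψ : 𝒟.GA → ℂ) (lam : ℝ) : Prop where
  left_invariant : ∀ (γ : 𝒟.GF) (x : 𝒟.GA), ψ (𝒟.diag γ * x) = ψ x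
  right_invariant : ∀ (x : 𝒟.GA), ∀ k ∈ 𝒟.K, ψ (x * k) = ψ x
  continuous : Continuous fun p : G₀ × 𝒟.Gfin => ψ (𝒟.atV₀ p.1 p.2)
  smooth : ∀ u : 𝒟.Gfin,
    ContDiff ℝ ∞ fun p : ℝ × ℝ × ℝ => coord (fun g => ψ (𝒟.atV₀ g u)) p.1 p.2.1 p.2.2
  eigen_laplacian : ∀ (u : 𝒟.Gfin) (x y t : ℝ),
    laplacian (fun g => ψ (𝒟.atV₀ g u)) x y t +
      (1 + (lam : ℂ) ^ 2) * coord (fun g => ψ (𝒟.atV₀ g u)) x y t = 0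
  eigen_hecke : ∀ φ ∈ 𝒟.heckeAlgebraAway, ∃ c : ℂ, ∀ x : 𝒟.GA, 𝒟.act μ φ ψ x = c * ψ x
  normalized : 𝒟.IsL2Normalized μ ψ

end ArithmeticDatum

end Arithmetic

end

noncomputable section

namespace HypThree

/-! ### The groups `N`, `A`, `K` and the Iwasawa decomposition -/

/-! The inequality is a pretrace inequality, and it holds with constant one. Write q(x,t) = g₀ n(x)
a(t) and attach to b, g₀ and 𝒯 the function g(y,u) = 𝒯(u) ∫ b(x,t) e^{-t} k_λ⁰(q(x,t)⁻¹ y) dx dt on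
G₀ × 𝐆(𝔸_f); its archimedean factor is `planeTest`. A bi-invariant kernel acts on a Laplace
eigenfunction through its spherical transform (`integral_mul_translate_eq`), so ∫ g ψ = h_λ⁰(λ) ⟨𝒯ψ,
b⟩, and h_λ⁰(λ) = h(0) + h(-2λ) ≥ 1. On the other side put Φ(p) = Σ_γ g(γp). Unfolding over 𝐆(F)
turns ∫ g ψ into the pairing of Φ with ψ on a fundamental domain, up to the number of γ that act
trivially. Cauchy-Schwarz with ‖ψ‖ = 1 leaves ‖Φ‖², and unfolding once more gives Σ_γ ∫ g(γp)
conj(g(p)) dp (`IsDomain.norm_integral_sq_le`). Since k_λ⁰ is real and k_λ⁰(g⁻¹) = k_λ⁰(g), each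
correlation factors as (𝒯*𝒯^*)(γ) I(λ, g₀⁻¹γg₀). No spectral expansion on X is needed.

Three facts support this. (1) k_λ⁰ exists; being defined by choice, it has its properties only
because of that (`hasSphericalTransform_k0`). Integration over horospheres turns the spherical
transform into the Fourier transform of t ↦ 2π ∫_{cosh t}^∞ F, with F the radial profile. In
dimension three one differentiation inverts this, and a contour shift supplies the Paley-Wiener
support.

(2) The eigenvalue principle. After subtraction of a multiple of e^{(1+iλ)t} it says that an
eigenfunction vanishing at the base point is orthogonal to every radial F. To see this, solve (Δ + 1
+ λ²)χ = F radially away from the base point, cut χ off at distance ε and apply Green's formula. The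
error is O(ε⁻³) on a ball of volume O(ε³), against a function that tends to zero there.

(3) 𝐆(F) is discrete in G₀ × 𝐆(𝔸_f) (`finite_setOf_mem`): the norm form of D is definite at the
other real places, so the coordinates of γ have bounded denominators and bounded conjugates. Hence
only finitely many γ contribute. -/

theorem coe_n (z : ℂ) : (n z : Matrix (Fin 2) (Fin 2) ℂ) = !![1, z; 0, 1] := rfl

theorem coe_a (t : ℝ) : (a t : Matrix (Fin 2) (Fin 2) ℂ) =
    !![(Real.exp (t / 2) : ℂ), 0; 0, (Real.exp (-t / 2) : ℂ)] := rfl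

theorem n_mul_n (z z' : ℂ) : n z * n z' = n (z + z') := by
  ext i j
  rw [Matrix.SpecialLinearGroup.coe_mul, coe_n, coe_n, coe_n]
  fin_cases i <;> fin_cases j <;> simp [add_comm]

theorem n_zero : n 0 = 1 := by
  ext i j
  rw [coe_n]
  fin_cases i <;> fin_cases j <;> simp

theorem n_inv (z : ℂ) : (n z)⁻¹ = n (-z) := by
  rw [inv_eq_iff_mul_eq_one, n_mul_n, add_neg_cancel, n_zero]

theorem a_mul_a (t t' : ℝ) : a t * a t' = a (t + t') := by
  ext i j
  rw [Matrix.SpecialLinearGroup.coe_mul, coe_a, coe_a, coe_a]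
  fin_cases i <;> fin_cases j <;> simp [← Complex.exp_add] <;> congr 1 <;> ring

theorem a_zero : a 0 = 1 := by
  ext i j
  rw [coe_a]
  fin_cases i <;> fin_cases j <;> simp

theorem a_inv (t : ℝ) : (a t)⁻¹ = a (-t) := by
  rw [inv_eq_iff_mul_eq_one, a_mul_a, add_neg_cancel, a_zero]

theorem a_mul_n (t : ℝ) (z : ℂ) : a t * n z = n (Real.exp t * z) * a t := by
  ext i j
  rw [Matrix.SpecialLinearGroup.coe_mul, Matrix.SpecialLinearGroup.coe_mul, coe_a, coe_n, coe_n]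
  fin_cases i <;> fin_cases j <;> simp
  rw [mul_right_comm, ← Complex.exp_add]
  congr 2; ring

theorem continuous_n : Continuous n := by
  refine continuous_induced_rng.2 (continuous_matrix fun i j => ?_)
  fin_cases i <;> fin_cases j <;> simp <;> fun_prop

theorem continuous_a : Continuous a := by
  refine continuous_induced_rng.2 (continuous_matrix fun i j => ?_)
  fin_cases i <;> fin_cases j <;> simp <;> fun_prop

theorem continuous_entry (i j : Fin 2) : Continuous fun g : G₀ => g i j :=
  (continuous_id.matrix_elem i j).comp continuous_induced_dom

theorem det_entries (g : G₀) : g 0 0 * g 1 1 - g 0 1 * g 1 0 = 1 := by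
  rw [← Matrix.det_fin_two]; exact g.2

/-- Unitarity says g⁻¹ = g^*, and in determinant one the inverse is the adjugate, so the condition
becomes linear in the entries and their conjugates. -/
theorem mem_K₀_iff (g : G₀) :
    g ∈ K₀ ↔ g 1 1 = conj (g 0 0) ∧ g 1 0 = -conj (g 0 1) := by
  constructor
  · intro h
    have h1 : (g : Matrix (Fin 2) (Fin 2) ℂ) * star (g : Matrix (Fin 2) (Fin 2) ℂ) = 1 :=
      (Matrix.mem_unitaryGroup_iff).1 h
    have h2 : ((g⁻¹ : G₀) : Matrix (Fin 2) (Fin 2) ℂ) = star (g : Matrix (Fin 2) (Fin 2) ℂ) := by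
      have h3 : ((g⁻¹ : G₀) : Matrix (Fin 2) (Fin 2) ℂ) * (g : Matrix (Fin 2) (Fin 2) ℂ) = 1 := by
        rw [← Matrix.SpecialLinearGroup.coe_mul, inv_mul_cancel, Matrix.SpecialLinearGroup.coe_one]
      calc _ = ((g⁻¹ : G₀) : Matrix (Fin 2) (Fin 2) ℂ) * ((g : Matrix (Fin 2) (Fin 2) ℂ) *
            star (g : Matrix (Fin 2) (Fin 2) ℂ)) := by rw [h1, mul_one]
        _ = _ := by rw [← mul_assoc, h3, one_mul]
    rw [Matrix.SpecialLinearGroup.coe_inv, Matrix.adjugate_fin_two] at h2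
    have h00 := congrFun (congrFun h2 0) 0
    have h10 := congrFun (congrFun h2 1) 0
    simp [Matrix.star_apply] at h00 h10
    exact ⟨h00, by rw [← h10, neg_neg]⟩
  · rintro ⟨h11, h10⟩
    have hd := det_entries g
    refine (Matrix.mem_unitaryGroup_iff).2 ?_
    rw [h11, h10] at hd
    ext i j
    fin_cases i <;> fin_cases j <;>
      simp [Matrix.mul_apply, Fin.sum_univ_two, Matrix.star_apply, h11, h10] <;>
      first | linear_combination hd | ring

/-- The height `|c|² + |d|²` of the bottom row of an element of `SL(2, ℂ)`. -/
def bottomNorm (g : G₀) : ℝ := ‖g 1 0‖ ^ 2 + ‖g 1 1‖ ^ 2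

theorem bottomNorm_pos (g : G₀) : 0 < bottomNorm g := by
  unfold bottomNorm
  by_contra h
  have h0 : g 1 0 = 0 := by
    rw [← norm_eq_zero, ← sq_eq_zero_iff]
    nlinarith [sq_nonneg ‖g 1 0‖, sq_nonneg ‖g 1 1‖]
  have h1 : g 1 1 = 0 := by
    rw [← norm_eq_zero, ← sq_eq_zero_iff]
    nlinarith [sq_nonneg ‖g 1 0‖, sq_nonneg ‖g 1 1‖]
  have := det_entries g
  simp [h0, h1] at this

theorem bottomNorm_cast (g : G₀) :
    (bottomNorm g : ℂ) = g 1 0 * conj (g 1 0) + g 1 1 * conj (g 1 1) := by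
  simp only [bottomNorm, Complex.mul_conj, Complex.normSq_eq_norm_sq]; push_cast; ring

/-- The horizontal Iwasawa coordinate: `iwasawaN (n(z) a(t) k) = z` for `k ∈ SU(2)`. -/
def iwasawaN (g : G₀) : ℂ := (g 0 0 * conj (g 1 0) + g 0 1 * conj (g 1 1)) / bottomNorm g

theorem exp_iwasawa (g : G₀) : Real.exp (iwasawa g) = (bottomNorm g)⁻¹ := by
  change Real.exp (-Real.log (bottomNorm g)) = _
  rw [Real.exp_neg, Real.exp_log (bottomNorm_pos g)]

theorem continuous_bottomNorm : Continuous bottomNorm :=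
  (((continuous_entry 1 0).norm.pow 2).add ((continuous_entry 1 1).norm.pow 2))

theorem continuous_iwasawa : Continuous iwasawa :=
  (continuous_bottomNorm.log fun g => (bottomNorm_pos g).ne').neg

theorem continuous_iwasawaN : Continuous iwasawaN := by
  refine Continuous.div ?_ (Complex.continuous_ofReal.comp continuous_bottomNorm)
    fun g => Complex.ofReal_ne_zero.2 (bottomNorm_pos g).ne'
  exact ((continuous_entry 0 0).mul (Complex.continuous_conj.comp (continuous_entry 1 0))).add
    ((continuous_entry 0 1).mul (Complex.continuous_conj.comp (continuous_entry 1 1)))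

theorem na_entries (z : ℂ) (t : ℝ) (g : G₀) :
    (n z * a t * g) 0 0 = Real.exp (t / 2) * g 0 0 + z * Real.exp (-t / 2) * g 1 0 ∧
    (n z * a t * g) 0 1 = Real.exp (t / 2) * g 0 1 + z * Real.exp (-t / 2) * g 1 1 ∧
    (n z * a t * g) 1 0 = Real.exp (-t / 2) * g 1 0 ∧
    (n z * a t * g) 1 1 = Real.exp (-t / 2) * g 1 1 := by
  rw [Matrix.SpecialLinearGroup.coe_mul, Matrix.SpecialLinearGroup.coe_mul, coe_a, coe_n]
  refine ⟨?_, ?_, ?_, ?_⟩ <;>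
    simp [Matrix.mul_apply, Fin.sum_univ_two]

theorem bottomNorm_na_mul (z : ℂ) (t : ℝ) (g : G₀) :
    bottomNorm (n z * a t * g) = Real.exp (-t) * bottomNorm g := by
  obtain ⟨-, -, h10, h11⟩ := na_entries z t g
  rw [bottomNorm, h10, h11, bottomNorm, norm_mul, norm_mul, Complex.norm_real, Real.norm_eq_abs,
    abs_of_pos (Real.exp_pos _), mul_pow, mul_pow, ← mul_add, ← Real.exp_nat_mul]
  congr 2; push_cast; ring

theorem bottomNorm_of_mem {k : G₀} (hk : k ∈ K₀) : bottomNorm k = 1 := by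
  obtain ⟨h11, h10⟩ := (mem_K₀_iff k).1 hk
  apply Complex.ofReal_injective
  have hd := det_entries k
  rw [h11, h10] at hd
  rw [bottomNorm_cast, h11, h10]
  simp only [map_neg, Complex.conj_conj, Complex.ofReal_one]
  linear_combination hd

theorem iwasawa_na_mul (z : ℂ) (t : ℝ) (g : G₀) :
    iwasawa (n z * a t * g) = t + iwasawa g := by
  change -Real.log (bottomNorm _) = t + -Real.log (bottomNorm _)
  rw [bottomNorm_na_mul, Real.log_mul (Real.exp_pos _).ne' (bottomNorm_pos g).ne', Real.log_exp]
  ring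

theorem iwasawa_of_mem {k : G₀} (hk : k ∈ K₀) : iwasawa k = 0 := by
  change -Real.log (bottomNorm _) = 0
  rw [bottomNorm_of_mem hk, Real.log_one, neg_zero]

theorem iwasawa_nak (z : ℂ) (t : ℝ) {k : G₀} (hk : k ∈ K₀) : iwasawa (n z * a t * k) = t := by
  rw [iwasawa_na_mul, iwasawa_of_mem hk, add_zero]

theorem exp_half_mul_exp_neg_half (t : ℝ) :
    (Real.exp (t / 2) : ℂ) * (Real.exp (-t / 2) : ℂ) = 1 := by
  rw [← Complex.ofReal_mul, ← Real.exp_add, neg_div, add_neg_cancel, Real.exp_zero,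
    Complex.ofReal_one]

theorem exp_neg_half_sq (t : ℝ) :
    (Real.exp (-t / 2) : ℂ) * (Real.exp (-t / 2) : ℂ) = (Real.exp (-t) : ℂ) := by
  rw [← Complex.ofReal_mul, ← Real.exp_add]; congr 2; ring

theorem iwasawaN_nak (z : ℂ) (t : ℝ) {k : G₀} (hk : k ∈ K₀) : iwasawaN (n z * a t * k) = z := by
  obtain ⟨h00, h01, h10, h11⟩ := na_entries z t k
  obtain ⟨k11, k10⟩ := (mem_K₀_iff k).1 hk
  have hd := det_entries k
  rw [k11, k10] at hd
  have he : (Real.exp (-t) : ℂ) ≠ 0 := Complex.ofReal_ne_zero.2 (Real.exp_pos _).ne'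
  rw [iwasawaN, bottomNorm_na_mul, bottomNorm_of_mem hk, mul_one, div_eq_iff he, h00, h01, h10,
    h11, k11, k10]
  simp only [map_mul, map_neg, Complex.conj_conj, Complex.conj_ofReal]
  rw [← exp_neg_half_sq]
  linear_combination (z * Real.exp (-t / 2) * Real.exp (-t / 2)) * hd

theorem iwasawa_K_mem (g : G₀) : (n (iwasawaN g) * a (iwasawa g))⁻¹ * g ∈ K₀ := by
  set z := iwasawaN g with hz
  set t := iwasawa g with ht
  set k := (n z * a t)⁻¹ * g with hk
  have hg : g = n z * a t * k := by rw [hk, mul_inv_cancel_left]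
  obtain ⟨h00, h01, h10, h11⟩ := na_entries z t k
  rw [← hg] at h00 h01 h10 h11
  have hN : bottomNorm k = 1 := by
    have h1 := bottomNorm_na_mul z t k
    rw [← hg, Real.exp_neg, ht, exp_iwasawa, inv_inv] at h1
    exact (mul_eq_left₀ (bottomNorm_pos g).ne').1 h1.symm
  have hN' := bottomNorm_cast k
  rw [hN, Complex.ofReal_one] at hN'
  have hzz : z * Real.exp (-t) = g 0 0 * conj (g 1 0) + g 0 1 * conj (g 1 1) := by
    have h1 : (bottomNorm g : ℂ) ≠ 0 := Complex.ofReal_ne_zero.2 (bottomNorm_pos g).ne'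
    rw [Real.exp_neg, ht, exp_iwasawa, inv_inv, hz, iwasawaN, div_mul_cancel₀ _ h1]
  rw [h00, h01, h10, h11] at hzz
  simp only [map_mul, Complex.conj_ofReal] at hzz
  rw [← exp_neg_half_sq] at hzz
  -- The value of `iwasawaN g` is exactly the one that makes the rows of k orthogonal. With a bottom
  -- row of length one and determinant one, this fixes the top row.
  have ho : k 0 0 * conj (k 1 0) + k 0 1 * conj (k 1 1) = 0 := by
    linear_combination -hzz + (z * Real.exp (-t / 2) * Real.exp (-t / 2)) * hN' -
      (k 0 0 * conj (k 1 0) + k 0 1 * conj (k 1 1)) * exp_half_mul_exp_neg_half t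
  have hd := det_entries k
  have e1 : k 0 0 = conj (k 1 1) := by
    linear_combination k 0 0 * hN' + k 1 0 * ho + conj (k 1 1) * hd
  have e2 : k 0 1 = -conj (k 1 0) := by
    linear_combination k 0 1 * hN' + k 1 1 * ho - conj (k 1 0) * hd
  rw [mem_K₀_iff, e1, e2]
  simp

/-! ### Topology of SL(2, ℂ) and the invariant probability measure of SU(2). -/

instance : SecondCountableTopology (Matrix (Fin 2) (Fin 2) ℂ) :=
  inferInstanceAs (SecondCountableTopology (Fin 2 → Fin 2 → ℂ))

instance : LocallyCompactSpace (Matrix (Fin 2) (Fin 2) ℂ) :=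
  inferInstanceAs (LocallyCompactSpace (Fin 2 → Fin 2 → ℂ))

instance : SecondCountableTopology G₀ :=
  Matrix.SpecialLinearGroup.isClosedEmbedding_val.isEmbedding.secondCountableTopology

instance : LocallyCompactSpace G₀ :=
  (Matrix.SpecialLinearGroup.isClosedEmbedding_val (n := Fin 2) (R := ℂ)).locallyCompactSpace

instance : T2Space G₀ :=
  (Matrix.SpecialLinearGroup.isClosedEmbedding_val (n := Fin 2) (R := ℂ)).isEmbedding.t2Space

theorem isCompact_K₀ : IsCompact (K₀ : Set G₀) := isCompact_iff_compactSpace.2 (inferInstanceAs (CompactSpace K₀))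

instance : IsProbabilityMeasure haarK₀ := ⟨by
  have h := Measure.haarMeasure_self (K₀ := (⊤ : TopologicalSpace.PositiveCompacts K₀))
  simpa [haarK₀] using h⟩

instance : Measure.IsHaarMeasure haarK₀ := by unfold haarK₀; infer_instance

/-- Right translates of a Haar probability measure on a compact group are again Haar probability
measures, and there is only one. The same argument gives invariance under inversion. -/
instance : Measure.IsMulRightInvariant haarK₀ := ⟨fun k => by
  have h : Measure.IsHaarMeasure (haarK₀.map (· * k)) :=
    Measure.isHaarMeasure_map_mul_right haarK₀ k
  have h' : IsProbabilityMeasure (haarK₀.map (· * k)) :=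
    Measure.isProbabilityMeasure_map (by fun_prop)
  exact Measure.isHaarMeasure_eq_of_isProbabilityMeasure _ _⟩

instance : Measure.IsInvInvariant haarK₀ := ⟨by
  have h' : IsProbabilityMeasure haarK₀.inv :=
    Measure.isProbabilityMeasure_map (by fun_prop)
  have h : Measure.IsHaarMeasure haarK₀.inv := by
    have hreg : IsFiniteMeasureOnCompacts haarK₀.inv := inferInstance
    exact { lt_top_of_isCompact := fun _ h => h.measure_lt_top }
  exact Measure.isHaarMeasure_eq_of_isProbabilityMeasure _ _⟩

end HypThree

namespace HypThree

/-! ### The Haar measure of `SL(2, ℂ)` -/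

/-- The group `NA`, in the coordinates `(z, t) ↦ n(z) a(t)`. -/
def NA : Type := ℂ × ℝ

namespace NA

instance : TopologicalSpace NA := inferInstanceAs (TopologicalSpace (ℂ × ℝ))
instance : LocallyCompactSpace NA := inferInstanceAs (LocallyCompactSpace (ℂ × ℝ))
instance : SecondCountableTopology NA := inferInstanceAs (SecondCountableTopology (ℂ × ℝ))
instance : MeasurableSpace NA := inferInstanceAs (MeasurableSpace (ℂ × ℝ))
instance : BorelSpace NA := inferInstanceAs (BorelSpace (ℂ × ℝ))

/-- The semidirect product law comes from a(t) n(z) = n(e^t z) a(t). -/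
instance : Group NA where
  mul p q := (p.1 + (Real.exp p.2 : ℂ) * q.1, p.2 + q.2)
  one := (0, 0)
  inv p := (-((Real.exp (-p.2) : ℂ) * p.1), -p.2)
  mul_assoc p q r := by
    refine Prod.ext ?_ (add_assoc _ _ _)
    change p.1 + (Real.exp p.2 : ℂ) * q.1 + (Real.exp (p.2 + q.2) : ℂ) * r.1 =
      p.1 + (Real.exp p.2 : ℂ) * (q.1 + (Real.exp q.2 : ℂ) * r.1)
    rw [Real.exp_add]; push_cast; ring
  one_mul p := by
    refine Prod.ext ?_ (zero_add _)
    change 0 + (Real.exp 0 : ℂ) * p.1 = p.1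
    simp
  mul_one p := by
    refine Prod.ext ?_ (add_zero _)
    change p.1 + (Real.exp p.2 : ℂ) * 0 = p.1
    simp
  inv_mul_cancel p := by
    refine Prod.ext ?_ (neg_add_cancel _)
    change -((Real.exp (-p.2) : ℂ) * p.1) + (Real.exp (-p.2) : ℂ) * p.1 = 0
    ring

instance : IsTopologicalGroup NA where
  continuous_mul := by
    change Continuous fun x : (ℂ × ℝ) × (ℂ × ℝ) =>
      (x.1.1 + (Real.exp x.1.2 : ℂ) * x.2.1, x.1.2 + x.2.2)
    fun_prop
  continuous_inv := by
    change Continuous fun x : ℂ × ℝ => (-((Real.exp (-x.2) : ℂ) * x.1), -x.2)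
    fun_prop

/-- The embedding of `NA` in `SL(2, ℂ)`. -/
def toG (p : NA) : G₀ := n p.1 * a p.2

theorem toG_mul (p q : NA) : toG (p * q) = toG p * toG q := by
  change n (p.1 + (Real.exp p.2 : ℂ) * q.1) * a (p.2 + q.2) = n p.1 * a p.2 * (n q.1 * a q.2)
  rw [← n_mul_n, ← a_mul_a, mul_assoc (n p.1) (a p.2), ← mul_assoc (a p.2), a_mul_n]
  simp only [mul_assoc]

theorem continuous_toG : Continuous toG := by
  change Continuous fun p : ℂ × ℝ => n p.1 * a p.2
  exact (continuous_n.comp continuous_fst).mul (continuous_a.comp continuous_snd)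

/-- The hyperbolic volume as a measure on `NA`. -/
def vol : Measure NA := hypVolume

theorem lintegral_hypVolume {f : ℂ × ℝ → ENNReal} (hf : Measurable f) :
    ∫⁻ p, f p ∂hypVolume =
      ∫⁻ t : ℝ, ENNReal.ofReal (Real.exp (-2 * t)) * ∫⁻ z : ℂ, f (z, t) := by
  rw [hypVolume, lintegral_withDensity_eq_lintegral_mul _ (by fun_prop) hf, Measure.volume_eq_prod,
    lintegral_prod_symm _ (by fun_prop)]
  refine lintegral_congr fun t => ?_
  simp only [Pi.mul_apply]
  rw [lintegral_const_mul _ (by fun_prop)]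

theorem lintegral_affine (r : ℝ) (hr : 0 < r) (w : ℂ) (f : ℂ → ENNReal) (hf : Measurable f) :
    ∫⁻ z : ℂ, f (w + (r : ℂ) * z) = ENNReal.ofReal (r ^ 2)⁻¹ * ∫⁻ z : ℂ, f z := by
  have h1 : ∫⁻ z : ℂ, f (w + (r : ℂ) * z) = ∫⁻ z : ℂ, f (w + z) ∂(volume.map (r • ·)) := by
    rw [lintegral_map (by fun_prop) (by fun_prop)]
    simp only [Complex.real_smul]
  rw [h1, Measure.map_addHaar_smul _ hr.ne', lintegral_smul_measure, lintegral_add_left_eq_self,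
    Complex.finrank_real_complex, abs_of_pos (by positivity), smul_eq_mul]

/-- The dilation z ↦ e^s z scales area by e^{2s}, which the weight e^{-2t} compensates after t ↦ s +
t. So dz e^{-2t} dt is the left Haar measure of NA. -/
theorem lintegral_hypVolume_translate (w : ℂ) (s : ℝ) {f : ℂ × ℝ → ENNReal} (hf : Measurable f) :
    ∫⁻ q, f (w + (Real.exp s : ℂ) * q.1, s + q.2) ∂hypVolume = ∫⁻ q, f q ∂hypVolume := by
  rw [lintegral_hypVolume hf,
    lintegral_hypVolume (f := fun q => f (w + (Real.exp s : ℂ) * q.1, s + q.2)) (by fun_prop)]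
  have h1 : ∀ t : ℝ, ENNReal.ofReal (Real.exp (-2 * t)) *
      ∫⁻ z : ℂ, f (w + (Real.exp s : ℂ) * z, s + t) =
      ENNReal.ofReal (Real.exp (-2 * (s + t))) * ∫⁻ z : ℂ, f (z, s + t) := fun t => by
    rw [lintegral_affine _ (Real.exp_pos _) _ (fun z => f (z, s + t)) (by fun_prop), ← mul_assoc,
      ← ENNReal.ofReal_mul (Real.exp_pos _).le, ← Real.exp_nat_mul, ← Real.exp_neg,
      ← Real.exp_add]
    congr 3; push_cast; ring
  simp only [h1]
  exact lintegral_add_left_eq_self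
    (fun t => ENNReal.ofReal (Real.exp (-2 * t)) * ∫⁻ z : ℂ, f (z, t)) s

instance : Measure.IsMulLeftInvariant vol := ⟨fun p => by
  refine Measure.ext_of_lintegral _ fun f hf => ?_
  rw [lintegral_map hf (continuous_const_mul p).measurable]
  exact lintegral_hypVolume_translate p.1 p.2 (f := f) hf⟩

instance : IsLocallyFiniteMeasure hypVolume :=
  IsLocallyFiniteMeasure.withDensity_ofReal (by fun_prop)

instance : SFinite hypVolume := by unfold hypVolume; infer_instance

instance : Measure.IsHaarMeasure vol where
  lt_top_of_isCompact K hK :=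
    IsCompact.measure_lt_top (μ := hypVolume) (α := ℂ × ℝ) hK
  open_pos := by
    have h : Measure.IsOpenPosMeasure hypVolume := by
      have h1 : (volume : Measure (ℂ × ℝ)) ≪ hypVolume :=
        withDensity_absolutelyContinuous' (by fun_prop)
          (ae_of_all _ fun p => by simp [Real.exp_pos])
      exact h1.isOpenPosMeasure
    exact h.open_pos

end NA

instance : SecondCountableTopology K₀ :=
  Topology.IsEmbedding.subtypeVal.secondCountableTopology

theorem haarG₀_eq : haarG₀ = (NA.vol.prod haarK₀).map fun p => NA.toG p.1 * (p.2 : G₀) := rfl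

/-- The homeomorphism `NA × K → SL(2, ℂ)`, `(p, k) ↦ p k⁻¹`. -/
def iwasawaHomeo : NA × K₀ ≃ₜ G₀ where
  toFun p := NA.toG p.1 * ((p.2⁻¹ : K₀) : G₀)
  invFun g := ((iwasawaN g, iwasawa g),
    (⟨(n (iwasawaN g) * a (iwasawa g))⁻¹ * g, iwasawa_K_mem g⟩ : K₀)⁻¹)
  left_inv p := by
    have h1 := iwasawaN_nak p.1.1 p.1.2 (p.2⁻¹).2
    have h2 := iwasawa_nak p.1.1 p.1.2 (p.2⁻¹).2
    refine Prod.ext (Prod.ext h1 h2) ?_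
    rw [inv_eq_iff_eq_inv]
    apply Subtype.ext
    change (n (iwasawaN (n p.1.1 * a p.1.2 * _)) * a (iwasawa (n p.1.1 * a p.1.2 * _)))⁻¹ * _ = _
    rw [h1, h2]
    exact inv_mul_cancel_left _ _
  right_inv g := by
    simp only [inv_inv]
    exact mul_inv_cancel_left _ _
  continuous_toFun := (NA.continuous_toG.comp continuous_fst).mul
    (continuous_subtype_val.comp continuous_snd.inv)
  continuous_invFun := by
    refine (Continuous.prodMk continuous_iwasawaN continuous_iwasawa).prodMk (Continuous.inv ?_)
    exact Continuous.subtype_mk (((continuous_n.comp continuous_iwasawaN).mul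
      (continuous_a.comp continuous_iwasawa)).inv.mul continuous_id) _

open scoped Pointwise in
/-- A left Haar measure on a locally compact group is invariant under right translation by the
elements of a compact subgroup. -/
theorem map_mul_right_eq_of_mem_compact {G : Type*} [Group G] [TopologicalSpace G]
    [IsTopologicalGroup G] [LocallyCompactSpace G] [SecondCountableTopology G]
    [MeasurableSpace G] [BorelSpace G] (ν : Measure G) [ν.IsHaarMeasure] (K : Subgroup G)
    (hK : IsCompact (K : Set G)) {k : G} (hk : k ∈ K) : ν.map (· * k) = ν := by
  have h := Measure.isMulLeftInvariant_eq_smul (ν.map (· * k)) ν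
  -- For a compact neighbourhood V of 1, the set V K has positive finite measure and is stable under
  -- right translation by k, so the scalar by which that translation changes ν must be one.
  obtain ⟨V, hV, hV1⟩ := exists_compact_mem_nhds (1 : G)
  have hU : IsCompact (V * (K : Set G)) := hV.mul hK
  have hpos : ν (V * (K : Set G)) ≠ 0 := by
    refine (lt_of_lt_of_le (Measure.measure_pos_of_mem_nhds ν hV1) (measure_mono fun v hv => ?_)).ne'
    exact ⟨v, hv, 1, K.one_mem, mul_one v⟩
  have hpre : (fun g => g * k) ⁻¹' (V * (K : Set G)) = V * (K : Set G) := by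
    ext g
    constructor
    · rintro ⟨v, hv, k', hk', he⟩
      refine ⟨v, hv, k' * k⁻¹, K.mul_mem hk' (K.inv_mem hk), ?_⟩
      simp only at he ⊢
      rw [← mul_assoc, he, mul_inv_cancel_right]
    · rintro ⟨v, hv, k', hk', he⟩
      refine ⟨v, hv, k' * k, K.mul_mem hk' hk, ?_⟩
      simp only at he ⊢
      rw [← mul_assoc, he]
  have h2 : ν.map (· * k) (V * (K : Set G)) = ν (V * (K : Set G)) := by
    have := (Homeomorph.mulRight k).toMeasurableEquiv.map_apply (μ := ν) (V * (K : Set G))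
    change ν.map (· * k) (V * (K : Set G)) = ν ((fun g => g * k) ⁻¹' (V * (K : Set G))) at this
    rw [this, hpre]
  rw [h, Measure.smul_apply, ENNReal.smul_def, smul_eq_mul] at h2
  have h3 : ((Measure.haarScalarFactor (ν.map (· * k)) ν : NNReal) : ENNReal) = 1 := by
    rw [← ENNReal.mul_left_inj hpos hU.measure_ne_top, h2, one_mul]
  rw [h, ENNReal.coe_eq_one.1 h3, one_smul]

/-- Left translations of the product group NA × K correspond under (p, k) ↦ p k⁻¹ to the maps g ↦ p
g k⁻¹, which preserve the Haar measure of SL(2, ℂ) because K is compact. The pullback is therefore a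
Haar measure of NA × K, proportional to the product measure. This gives the measure defined by
Iwasawa coordinates its left invariance; the value of the constant plays no role. -/
theorem exists_haarG₀_eq_smul : ∃ c : NNReal, haarG₀ = c • (Measure.haar : Measure G₀) := by
  set ν : Measure G₀ := Measure.haar
  set m : Measure (NA × K₀) := ν.map iwasawaHomeo.symm with hm
  have hmm : ∀ p : NA × K₀, ∀ q, iwasawaHomeo (p * q) =
      NA.toG p.1 * iwasawaHomeo q * ((p.2⁻¹ : K₀) : G₀) := by
    intro p q
    change NA.toG (p.1 * q.1) * (((p.2 * q.2)⁻¹ : K₀) : G₀) = NA.toG p.1 * (NA.toG q.1 *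
      ((q.2⁻¹ : K₀) : G₀)) * ((p.2⁻¹ : K₀) : G₀)
    rw [NA.toG_mul, mul_inv_rev, Subgroup.coe_mul]
    simp only [mul_assoc]
  have hinv : m.IsMulLeftInvariant := ⟨fun p => by
    rw [hm, Measure.map_map (by fun_prop) iwasawaHomeo.symm.continuous.measurable]
    have h1 : (fun q => p * q) ∘ iwasawaHomeo.symm =
        iwasawaHomeo.symm ∘ ((· * ((p.2⁻¹ : K₀) : G₀)) ∘ (NA.toG p.1 * ·)) := by
      funext g
      apply iwasawaHomeo.injective
      simp [hmm]
    rw [h1, ← Measure.map_map iwasawaHomeo.symm.continuous.measurable (by fun_prop),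
      ← Measure.map_map (by fun_prop) (by fun_prop), map_mul_left_eq_self,
      map_mul_right_eq_of_mem_compact ν K₀ isCompact_K₀ (p.2⁻¹).2]⟩
  have hH : m.IsHaarMeasure :=
    { lt_top_of_isCompact := fun C hC => by
        have := iwasawaHomeo.symm.toMeasurableEquiv.map_apply (μ := ν) C
        change m C = ν (iwasawaHomeo.symm ⁻¹' C) at this
        rw [this, ← Homeomorph.image_eq_preimage_symm]
        exact (hC.image iwasawaHomeo.continuous).measure_lt_top
      open_pos := (iwasawaHomeo.symm.continuous.isOpenPosMeasure_map
        iwasawaHomeo.symm.surjective).open_pos }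
  have h := Measure.isMulLeftInvariant_eq_smul (NA.vol.prod haarK₀) m
  refine ⟨Measure.haarScalarFactor (NA.vol.prod haarK₀) m, ?_⟩
  -- The measure on K is invariant under inversion, so p k may be replaced by p k⁻¹.
  have h2 : haarG₀ = (NA.vol.prod haarK₀).map iwasawaHomeo := by
    have h3 : haarK₀ = haarK₀.map (fun k => k⁻¹) := (Measure.inv_eq_self haarK₀).symm
    have h4 : NA.vol.prod haarK₀ = (NA.vol.prod haarK₀).map (Prod.map id fun k => k⁻¹) := by
      conv_lhs => rw [h3]
      have := Measure.map_prod_map NA.vol haarK₀ (measurable_id) (measurable_inv (G := K₀))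
      rw [Measure.map_id] at this
      exact this
    rw [h4, Measure.map_map iwasawaHomeo.continuous.measurable (by fun_prop), haarG₀_eq]
    congr 1
    funext p
    simp [iwasawaHomeo]
  generalize Measure.haarScalarFactor (NA.vol.prod haarK₀) m = c at h ⊢
  rw [h2, h, Measure.map_smul, hm,
    Measure.map_map iwasawaHomeo.continuous.measurable iwasawaHomeo.symm.continuous.measurable]
  simp

instance : Measure.IsMulLeftInvariant haarG₀ := by
  obtain ⟨c, hc⟩ := exists_haarG₀_eq_smul
  rw [hc]; infer_instance

instance : IsFiniteMeasureOnCompacts haarG₀ := by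
  obtain ⟨c, hc⟩ := exists_haarG₀_eq_smul
  rw [hc]; infer_instance

end HypThree

namespace HypThree

/-! ### The Cartan decomposition and bi-invariant functions -/

/-- The hyperbolic cosine of the distance from the base point `o` to `g · o`. -/
def coshDist (g : G₀) : ℝ :=
  (‖g 0 0‖ ^ 2 + ‖g 0 1‖ ^ 2 + ‖g 1 0‖ ^ 2 + ‖g 1 1‖ ^ 2) / 2

theorem continuous_coshDist : Continuous coshDist :=
  (((((continuous_entry 0 0).norm.pow 2).add ((continuous_entry 0 1).norm.pow 2)).add
    ((continuous_entry 1 0).norm.pow 2)).add ((continuous_entry 1 1).norm.pow 2)).div_const 2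

/-- In the form tr(g g^*), invariance under SU(2) on either side is evident. -/
theorem coshDist_cast (g : G₀) : ((2 * coshDist g : ℝ) : ℂ) =
    ((g : Matrix (Fin 2) (Fin 2) ℂ) * star (g : Matrix (Fin 2) (Fin 2) ℂ)).trace := by
  simp only [coshDist, Matrix.trace_fin_two, Matrix.mul_apply, Fin.sum_univ_two, Matrix.star_apply,
    RCLike.star_def, Complex.mul_conj, Complex.normSq_eq_norm_sq]
  push_cast; ring

theorem coshDist_mul_right (g : G₀) {k : G₀} (hk : k ∈ K₀) : coshDist (g * k) = coshDist g := by
  have h : ((2 * coshDist (g * k) : ℝ) : ℂ) = (2 * coshDist g : ℝ) := by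
    rw [coshDist_cast, coshDist_cast, Matrix.SpecialLinearGroup.coe_mul, star_mul, mul_assoc,
      ← mul_assoc (k : Matrix (Fin 2) (Fin 2) ℂ), (Matrix.mem_unitaryGroup_iff).1 hk, one_mul]
  have := Complex.ofReal_injective h
  linarith

theorem coshDist_mul_left (g : G₀) {k : G₀} (hk : k ∈ K₀) : coshDist (k * g) = coshDist g := by
  have h : ((2 * coshDist (k * g) : ℝ) : ℂ) = (2 * coshDist g : ℝ) := by
    rw [coshDist_cast, coshDist_cast, Matrix.SpecialLinearGroup.coe_mul, star_mul,
      Matrix.trace_mul_comm, mul_assoc, ← mul_assoc (star (k : Matrix (Fin 2) (Fin 2) ℂ)),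
      (Matrix.mem_unitaryGroup_iff').1 hk, one_mul, Matrix.trace_mul_comm]
  have := Complex.ofReal_injective h
  linarith

theorem coshDist_inv (g : G₀) : coshDist g⁻¹ = coshDist g := by
  simp only [coshDist, Matrix.SpecialLinearGroup.coe_inv, Matrix.adjugate_fin_two]
  simp
  ring

theorem one_le_coshDist (g : G₀) : 1 ≤ coshDist g := by
  have h1 : ‖g 0 0 * g 1 1 - g 0 1 * g 1 0‖ = 1 := by rw [det_entries, norm_one]
  have h2 : (1 : ℝ) ≤ ‖g 0 0‖ * ‖g 1 1‖ + ‖g 0 1‖ * ‖g 1 0‖ := by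
    rw [← h1, ← norm_mul, ← norm_mul]; exact norm_sub_le _ _
  unfold coshDist
  nlinarith [sq_nonneg (‖g 0 0‖ - ‖g 1 1‖), sq_nonneg (‖g 0 1‖ - ‖g 1 0‖)]

theorem coshDist_na (z : ℂ) (t : ℝ) :
    coshDist (n z * a t) = Real.cosh t + ‖z‖ ^ 2 * Real.exp (-t) / 2 := by
  obtain ⟨h00, h01, h10, h11⟩ := na_entries z t 1
  rw [mul_one] at h00 h01 h10 h11
  rw [coshDist, h00, h01, h10, h11, Real.cosh_eq]
  have e1 : Real.exp (t / 2) ^ 2 = Real.exp t := by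
    rw [← Real.exp_nat_mul]; congr 1; push_cast; ring
  have e2 : Real.exp (-t / 2) ^ 2 = Real.exp (-t) := by
    rw [← Real.exp_nat_mul]; congr 1; push_cast; ring
  simp only [Matrix.SpecialLinearGroup.coe_one, Matrix.one_apply_eq, mul_one, ne_eq, one_ne_zero,
    not_false_eq_true, Matrix.one_apply_ne, mul_zero, add_zero, zero_add, norm_mul,
    Complex.norm_real, Real.norm_eq_abs, abs_of_pos (Real.exp_pos _), zero_ne_one, norm_zero,
    mul_pow, e1, e2]
  ring

theorem coshDist_a (t : ℝ) : coshDist (a t) = Real.cosh t := by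
  have := coshDist_na 0 t
  rw [n_zero, one_mul] at this
  simpa using this

/-- The hypothesis is the characteristic equation of the Hermitian matrix with rows (p, h) and (h̄,
q); a null vector of the singular matrix is normalised. -/
theorem exists_unit_eigenvector (p q : ℝ) (h : ℂ) (m : ℝ)
    (hdet : ((p : ℂ) - m) * (q - m) - h * conj h = 0) :
    ∃ v w : ℂ, v * conj v + w * conj w = 1 ∧ p * v + h * w = m * v ∧
      conj h * v + q * w = m * w := by
  obtain ⟨x, hx0, hx⟩ := (Matrix.exists_mulVec_eq_zero_iff
    (M := !![(p : ℂ) - m, h; conj h, (q : ℂ) - m])).2 (by rw [Matrix.det_fin_two_of, hdet])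
  have e0 := congrFun hx 0
  have e1 := congrFun hx 1
  simp [Matrix.mulVec, dotProduct, Fin.sum_univ_two] at e0 e1
  have hpos : 0 < ‖x 0‖ ^ 2 + ‖x 1‖ ^ 2 := by
    by_contra hn
    apply hx0
    have h0 : x 0 = 0 := by
      rw [← norm_eq_zero, ← sq_eq_zero_iff]
      nlinarith [sq_nonneg ‖x 0‖, sq_nonneg ‖x 1‖]
    have h1 : x 1 = 0 := by
      rw [← norm_eq_zero, ← sq_eq_zero_iff]
      nlinarith [sq_nonneg ‖x 0‖, sq_nonneg ‖x 1‖]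
    ext i; fin_cases i <;> simp [h0, h1]
  set c : ℝ := (√(‖x 0‖ ^ 2 + ‖x 1‖ ^ 2))⁻¹ with hc
  have hcc : c * c * (‖x 0‖ ^ 2 + ‖x 1‖ ^ 2) = 1 := by
    rw [hc, ← mul_inv, Real.mul_self_sqrt hpos.le, inv_mul_cancel₀ hpos.ne']
  refine ⟨c * x 0, c * x 1, ?_, ?_, ?_⟩
  · have : ((c * c * (‖x 0‖ ^ 2 + ‖x 1‖ ^ 2) : ℝ) : ℂ) = 1 := by rw [hcc]; rfl
    push_cast at this
    simp only [map_mul, Complex.conj_ofReal]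
    rw [← this, ← Complex.mul_conj', ← Complex.mul_conj']
    ring
  · linear_combination c * e0
  · linear_combination c * e1

/-- Diagonalise g g^*. It has determinant one and trace 2 cosh r, so its eigenvalues are e^{±r} and
g g^* = U a(r)² U⁻¹ with U in SU(2). Then k₁ = U, and a(-r) U⁻¹ g is unitary. -/
theorem exists_cartan (g : G₀) : ∃ k₁ ∈ K₀, ∃ k₂ ∈ K₀,
    g = k₁ * a (Real.arcosh (coshDist g)) * k₂ := by
  set r := Real.arcosh (coshDist g) with hr
  have hcosh : Real.cosh r = coshDist g := Real.cosh_arcosh (one_le_coshDist g)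
  set p : ℝ := ‖g 0 0‖ ^ 2 + ‖g 0 1‖ ^ 2 with hp
  set q : ℝ := ‖g 1 0‖ ^ 2 + ‖g 1 1‖ ^ 2 with hq
  set h : ℂ := g 0 0 * conj (g 1 0) + g 0 1 * conj (g 1 1) with hh
  have hpc : (p : ℂ) = g 0 0 * conj (g 0 0) + g 0 1 * conj (g 0 1) := by
    simp only [hp, Complex.mul_conj, Complex.normSq_eq_norm_sq]; push_cast; ring
  have hqc : (q : ℂ) = g 1 0 * conj (g 1 0) + g 1 1 * conj (g 1 1) := bottomNorm_cast g
  have hd := det_entries g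
  have hd' : conj (g 0 0) * conj (g 1 1) - conj (g 0 1) * conj (g 1 0) = 1 := by
    rw [← map_mul, ← map_mul, ← map_sub, hd, map_one]
  have hpq : (p : ℂ) * q - h * conj h = 1 := by
    rw [hpc, hqc, hh]
    simp only [map_add, map_mul, Complex.conj_conj]
    linear_combination hd * (conj (g 0 0) * conj (g 1 1) - conj (g 0 1) * conj (g 1 0)) + hd'
  have hsum : (p : ℂ) + q = Real.exp r + Real.exp (-r) := by
    have : p + q = Real.exp r + Real.exp (-r) := by
      rw [Real.cosh_eq, coshDist] at hcosh
      rw [hp, hq]; linarith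
    rw [← Complex.ofReal_add, this, Complex.ofReal_add]
  have hee : (Real.exp r : ℂ) * Real.exp (-r) = 1 := by
    rw [← Complex.ofReal_mul, ← Real.exp_add, add_neg_cancel, Real.exp_zero, Complex.ofReal_one]
  -- One eigenvector (v, w) suffices: (-w̄, v̄) is orthogonal to it and belongs to the eigenvalue
  -- e^{-r}.
  obtain ⟨v, w, hvw, e1, e2⟩ := exists_unit_eigenvector p q h (Real.exp r) (by
    linear_combination hpq - (Real.exp r : ℂ) * hsum - hee)
  have e1' : (p : ℂ) * conj v + conj h * conj w = Real.exp r * conj v := by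
    have := congrArg conj e1
    simpa only [map_add, map_mul, Complex.conj_ofReal] using this
  have e2' : h * conj v + q * conj w = Real.exp r * conj w := by
    have := congrArg conj e2
    simpa only [map_add, map_mul, Complex.conj_ofReal, Complex.conj_conj] using this
  let U : G₀ := ⟨!![v, -conj w; w, conj v], by
    rw [Matrix.det_fin_two_of]; linear_combination hvw⟩
  have hUc : (U : Matrix (Fin 2) (Fin 2) ℂ) = !![v, -conj w; w, conj v] := rfl
  have hU : U ∈ K₀ := by
    rw [mem_K₀_iff, hUc]; simp
  have hH : (g : Matrix (Fin 2) (Fin 2) ℂ) * star (g : Matrix (Fin 2) (Fin 2) ℂ) =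
      !![(p : ℂ), h; conj h, (q : ℂ)] := by
    ext i j
    fin_cases i <;> fin_cases j <;>
      simp [Matrix.mul_apply, Fin.sum_univ_two, Matrix.star_apply, hpc, hqc, hh] <;> ring
  have hHU : (g : Matrix (Fin 2) (Fin 2) ℂ) * star (g : Matrix (Fin 2) (Fin 2) ℂ) *
      (U : Matrix (Fin 2) (Fin 2) ℂ) = (U : Matrix (Fin 2) (Fin 2) ℂ) *
      !![(Real.exp r : ℂ), 0; 0, (Real.exp (-r) : ℂ)] := by
    rw [hH, hUc]
    ext i j
    fin_cases i <;> fin_cases j <;> simp [-Complex.ofReal_exp]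
    · linear_combination e1
    · linear_combination e2' - conj w * hsum
    · linear_combination e2
    · linear_combination -e1' + conj v * hsum
  refine ⟨U, hU, a (-r) * U⁻¹ * g, ?_, by rw [← a_inv]; group⟩
  have hUi : ((U⁻¹ : G₀) : Matrix (Fin 2) (Fin 2) ℂ) = star (U : Matrix (Fin 2) (Fin 2) ℂ) := by
    rw [Matrix.SpecialLinearGroup.coe_inv, hUc, Matrix.adjugate_fin_two]
    ext i j
    fin_cases i <;> fin_cases j <;> simp [Matrix.star_apply]
  have hAs : star (a (-r) : Matrix (Fin 2) (Fin 2) ℂ) = a (-r) := by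
    rw [coe_a]
    ext i j
    fin_cases i <;> fin_cases j <;> simp [Matrix.star_apply, -Complex.ofReal_exp, Complex.conj_ofReal]
  refine (Matrix.mem_unitaryGroup_iff).2 ?_
  rw [Matrix.SpecialLinearGroup.coe_mul, Matrix.SpecialLinearGroup.coe_mul, hUi, star_mul,
    star_mul, star_star, hAs]
  calc _ = (a (-r) : Matrix (Fin 2) (Fin 2) ℂ) * star (U : Matrix (Fin 2) (Fin 2) ℂ) *
        ((g : Matrix (Fin 2) (Fin 2) ℂ) * star (g : Matrix (Fin 2) (Fin 2) ℂ) *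
          (U : Matrix (Fin 2) (Fin 2) ℂ)) * a (-r) := by simp only [mul_assoc]
    _ = (a (-r) : Matrix (Fin 2) (Fin 2) ℂ) * (star (U : Matrix (Fin 2) (Fin 2) ℂ) *
        (U : Matrix (Fin 2) (Fin 2) ℂ)) * !![(Real.exp r : ℂ), 0; 0, (Real.exp (-r) : ℂ)] *
          a (-r) := by rw [hHU]; simp only [mul_assoc]
    _ = 1 := by
      rw [(Matrix.mem_unitaryGroup_iff').1 hU, mul_one, coe_a]
      ext i j
      fin_cases i <;> fin_cases j <;> simp [← Complex.exp_add] <;> ring_nf <;> simp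

/-- Bi-invariance under `SU(2)`. -/
def IsBiinvariant (k : G₀ → ℂ) : Prop := ∀ u ∈ K₀, ∀ v ∈ K₀, ∀ g, k (u * g * v) = k g

theorem IsBiinvariant.eq_radial {k : G₀ → ℂ} (hk : IsBiinvariant k) (g : G₀) :
    k g = k (a (Real.arcosh (coshDist g))) := by
  obtain ⟨k₁, h₁, k₂, h₂, he⟩ := exists_cartan g
  conv_lhs => rw [he]
  exact hk _ h₁ _ h₂ _

/-- An isometry and its inverse move the base point by the same distance, so they lie in one double
coset. -/
theorem IsBiinvariant.apply_inv {k : G₀ → ℂ} (hk : IsBiinvariant k) (g : G₀) : k g⁻¹ = k g := by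
  rw [hk.eq_radial, coshDist_inv, ← hk.eq_radial]

theorem IsBiinvariant.mul_right {k : G₀ → ℂ} (hk : IsBiinvariant k) (g : G₀) {v : G₀}
    (hv : v ∈ K₀) : k (g * v) = k g := by
  simpa using hk 1 K₀.one_mem v hv g

theorem IsBiinvariant.mul_left {k : G₀ → ℂ} (hk : IsBiinvariant k) (g : G₀) {u : G₀}
    (hu : u ∈ K₀) : k (u * g) = k g := by
  simpa using hk u hu 1 K₀.one_mem g

theorem isCompact_coshDist_le (M : ℝ) : IsCompact {g : G₀ | coshDist g ≤ M} := by
  have hcl := Matrix.SpecialLinearGroup.isClosedEmbedding_val (n := Fin 2) (R := ℂ)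
  have hsub : {g : G₀ | coshDist g ≤ M} ⊆ (fun g : G₀ => (g : Matrix (Fin 2) (Fin 2) ℂ)) ⁻¹'
      (Set.pi Set.univ fun _ : Fin 2 => Set.pi Set.univ fun _ : Fin 2 =>
        Metric.closedBall (0 : ℂ) (1 + 2 * M)) := by
    intro g hg i _ j _
    have hg' : coshDist g ≤ M := hg
    have h1 := one_le_coshDist g
    rw [mem_closedBall_zero_iff]
    have h2 : ‖g i j‖ ^ 2 ≤ 2 * M := by
      unfold coshDist at hg'
      fin_cases i <;> fin_cases j <;> simp <;>
        nlinarith [sq_nonneg ‖g 0 0‖, sq_nonneg ‖g 0 1‖, sq_nonneg ‖g 1 0‖, sq_nonneg ‖g 1 1‖]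
    nlinarith [norm_nonneg (g i j)]
  refine IsCompact.of_isClosed_subset (hcl.isCompact_preimage ?_)
    (isClosed_le continuous_coshDist continuous_const) hsub
  exact isCompact_univ_pi fun _ => isCompact_univ_pi fun _ => isCompact_closedBall _ _

theorem exists_coshDist_bound {k : G₀ → ℂ} (hk : HasCompactSupport k) :
    ∃ M : ℝ, 1 ≤ M ∧ ∀ g, M ≤ coshDist g → k g = 0 := by
  obtain ⟨C, hC⟩ := (hk.image continuous_coshDist).bddAbove
  refine ⟨max 1 (C + 1), le_max_left _ _, fun g hg => ?_⟩
  by_contra h0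
  have := hC ⟨g, subset_tsupport _ h0, rfl⟩
  linarith [le_max_right 1 (C + 1)]

/-! ### Integration over ℍ³ and the spherical transform in Iwasawa coordinates. -/

theorem isClosedEmbedding_na : Topology.IsClosedEmbedding fun p : ℂ × ℝ => n p.1 * a p.2 := by
  have h1 : Topology.IsClosedEmbedding fun p : ℂ × ℝ => ((p, 1) : NA × K₀) := by
    refine Topology.IsClosedEmbedding.of_continuous_injective_isClosedMap
      (Continuous.prodMk continuous_id continuous_const) (fun p q h => congrArg Prod.fst h)
      fun s hs => ?_
    have h : (fun p : ℂ × ℝ => ((p, 1) : NA × K₀)) '' s = (s : Set NA) ×ˢ {1} := by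
      rw [Set.prod_singleton]; rfl
    rw [h]
    exact IsClosed.prod hs isClosed_singleton
  have h2 := iwasawaHomeo.isClosedEmbedding.comp h1
  convert h2 using 2 with p
  change n p.1 * a p.2 = NA.toG p * (((1 : K₀)⁻¹ : K₀) : G₀)
  simp [NA.toG]

/-- The integral of a right `SU(2)`-invariant function is its integral over `ℍ³`. -/
theorem integral_haarG₀_of_right_invariant {f : G₀ → ℂ} (hf : Continuous f)
    (hinv : ∀ g, ∀ k ∈ K₀, f (g * k) = f g) :
    ∫ g, f g ∂haarG₀ = ∫ p : ℂ × ℝ, f (n p.1 * a p.2) ∂hypVolume := by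
  have hc : Continuous fun p : (ℂ × ℝ) × K₀ => n p.1.1 * a p.1.2 * (p.2 : G₀) :=
    (isClosedEmbedding_na.continuous.comp continuous_fst).mul
      (continuous_subtype_val.comp continuous_snd)
  rw [haarG₀, integral_map hc.aemeasurable hf.aestronglyMeasurable]
  have h1 : ∀ p : (ℂ × ℝ) × K₀, f (n p.1.1 * a p.1.2 * (p.2 : G₀)) = f (n p.1.1 * a p.1.2) :=
    fun p => hinv _ _ p.2.2
  simp only [h1]
  rw [integral_fun_fst (fun p : ℂ × ℝ => f (n p.1 * a p.2))]
  simp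

/-- After exchanging the integrals, the translation g ↦ κ⁻¹g removes the average over K from the
spherical function, since k is left invariant. The remaining integrand is right invariant, so it
lives on ℍ³. -/
theorem sphericalTransform_eq {k : G₀ → ℂ} (hk : Continuous k) (hc : HasCompactSupport k)
    (hb : IsBiinvariant k) (s : ℝ) :
    sphericalTransform k s = ∫ p : ℂ × ℝ, k (n p.1 * a p.2) *
      Complex.exp ((1 + Complex.I * (s : ℂ)) * (p.2 : ℂ)) ∂hypVolume := by
  set e : G₀ → ℂ := fun g => Complex.exp ((1 + Complex.I * (s : ℂ)) * (iwasawa g : ℂ)) with he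
  have hec : Continuous e := by
    have := continuous_iwasawa
    fun_prop
  have hint : Integrable (Function.uncurry fun (g : G₀) (κ : K₀) => k g * e (κ * g))
      (haarG₀.prod haarK₀) := by
    refine Continuous.integrable_of_hasCompactSupport ?_ ?_
    · exact (hk.comp continuous_fst).mul (hec.comp
        ((continuous_subtype_val.comp continuous_snd).mul continuous_fst))
    · refine HasCompactSupport.intro (K := tsupport k ×ˢ (Set.univ : Set K₀))
        (hc.isCompact.prod isCompact_univ) fun x hx => ?_
      have : k x.1 = 0 := image_eq_zero_of_notMem_tsupport fun h => hx ⟨h, trivial⟩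
      simp [Function.uncurry, this]
  have h1 : sphericalTransform k s = ∫ g, ∫ κ : K₀, k g * e (κ * g) ∂haarK₀ ∂haarG₀ := by
    simp only [integral_const_mul]; rfl
  have h2 : ∀ κ : K₀, ∫ g, k g * e (κ * g) ∂haarG₀ = ∫ g, k g * e g ∂haarG₀ := by
    intro κ
    rw [← integral_mul_left_eq_self (fun g => k g * e g) (κ : G₀)]
    simp only [hb.mul_left _ κ.2]
  rw [h1, integral_integral_swap hint]
  simp only [h2]
  rw [integral_const, probReal_univ, one_smul,
    integral_haarG₀_of_right_invariant (f := fun g => k g * e g) (hk.mul hec) fun g κ hκ => ?_]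
  · simp only [he]
    congr 1
    funext p
    have := iwasawa_nak p.1 p.2 K₀.one_mem
    rw [mul_one] at this
    rw [this]
  · have hi : iwasawa (g * κ) = iwasawa g := by
      have h3 : g = n (iwasawaN g) * a (iwasawa g) *
          ((n (iwasawaN g) * a (iwasawa g))⁻¹ * g) := by rw [mul_inv_cancel_left]
      conv_lhs => rw [h3, mul_assoc _ _ κ]
      exact iwasawa_nak _ _ (K₀.mul_mem (iwasawa_K_mem g) hκ)
    simp only [he, hb.mul_right g hκ, hi]

end HypThree

namespace HypThree

/-! ### The Abel transform -/

open Filter Topology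

/-- A bi-invariant function as a function of the hyperbolic cosine of the distance. -/
def radial (k : G₀ → ℂ) (u : ℝ) : ℂ := k (a (Real.arcosh (max 1 u)))

/-- Clamping at 1 makes the radial profile a continuous function on all of ℝ, so primitives of it
can be differentiated everywhere. -/
theorem continuous_arcosh_max : Continuous fun u : ℝ => Real.arcosh (max 1 u) :=
  Real.continuousOn_arcosh.comp_continuous (by fun_prop)
    fun _ => Set.mem_Ici.2 (le_max_left _ _)

theorem continuous_radial {k : G₀ → ℂ} (hk : Continuous k) : Continuous (radial k) :=
  hk.comp (continuous_a.comp continuous_arcosh_max)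

theorem IsBiinvariant.radial_coshDist {k : G₀ → ℂ} (hk : IsBiinvariant k) (g : G₀) :
    radial k (coshDist g) = k g := by
  rw [radial, max_eq_right (one_le_coshDist g), ← hk.eq_radial]

theorem radial_eq_zero {k : G₀ → ℂ} {M : ℝ}
    (h : ∀ g, M ≤ coshDist g → k g = 0) {u : ℝ} (hu : M ≤ u) : radial k u = 0 := by
  refine h _ ?_
  rw [coshDist_a, Real.cosh_arcosh (le_max_left _ _)]
  exact hu.trans (le_max_right _ _)

/-- The primitive `u ↦ ∫_u^M F`. -/
def primitive (F : ℝ → ℂ) (M u : ℝ) : ℂ := ∫ x in u..M, F x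

theorem hasDerivAt_primitive {F : ℝ → ℂ} (hF : Continuous F) (M u : ℝ) :
    HasDerivAt (primitive F M) (-F u) u :=
  intervalIntegral.integral_hasDerivAt_left (hF.intervalIntegrable _ _)
    (hF.stronglyMeasurableAtFilter _ _) hF.continuousAt

theorem continuous_primitive {F : ℝ → ℂ} (hF : Continuous F) (M : ℝ) :
    Continuous (primitive F M) :=
  continuous_iff_continuousAt.2 fun u => (hasDerivAt_primitive hF M u).continuousAt

theorem primitive_eq_zero {F : ℝ → ℂ} {M u : ℝ} (h : ∀ x, M ≤ x → F x = 0) (hu : M ≤ u) :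
    primitive F M u = 0 := by
  rw [primitive, intervalIntegral.integral_symm, neg_eq_zero,
    intervalIntegral.integral_congr (g := fun _ => 0), intervalIntegral.integral_zero]
  intro x hx
  rw [Set.uIcc_of_le hu] at hx
  exact h x hx.1

/-- In polar coordinates the substitution u = c + r²ε has du = 2ε r dr, so the planar integral is an
ordinary primitive. This is special to ℍ³, where horospheres are two-dimensional, and makes the Abel
transform invertible by one differentiation. -/
theorem integral_plane_radial {F : ℝ → ℂ} (hF : Continuous F) {M : ℝ}
    (h : ∀ x, M ≤ x → F x = 0) (c : ℝ) {ε : ℝ} (hε : 0 < ε) :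
    ∫ z : ℂ, F (c + ‖z‖ ^ 2 * ε) = ((Real.pi / ε : ℝ) : ℂ) * primitive F M c := by
  rw [integral_fun_norm_addHaar volume (fun r : ℝ => F (c + r ^ 2 * ε))]
  have hlim : Tendsto (fun r : ℝ => c + r ^ 2 * ε) atTop atTop :=
    tendsto_atTop_add_const_left _ _ ((tendsto_pow_atTop two_ne_zero).atTop_mul_const hε)
  obtain ⟨R, hR⟩ := eventually_atTop.1 (hlim.eventually_ge_atTop M)
  have hcont : Continuous fun r : ℝ => r • F (c + r ^ 2 * ε) := by fun_prop
  have hint : IntegrableOn (fun r : ℝ => r • F (c + r ^ 2 * ε)) (Set.Ioi 0) := by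
    have h1 : IntegrableOn (fun r : ℝ => r • F (c + r ^ 2 * ε)) (Set.Icc 0 (max R 0)) :=
      hcont.continuousOn.integrableOn_Icc
    refine h1.of_forall_sdiff_eq_zero measurableSet_Ioi fun x hx => ?_
    have hx2 : R ≤ x := by
      by_contra hlt
      exact hx.2 ⟨le_of_lt hx.1, (not_le.1 hlt).le.trans (le_max_left _ _)⟩
    rw [h _ (hR x hx2), smul_zero]
  have hd : ∀ r : ℝ, HasDerivAt (fun r : ℝ => -((1 / (2 * ε) : ℝ) : ℂ) *
      primitive F M (c + r ^ 2 * ε)) (r • F (c + r ^ 2 * ε)) r := by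
    intro r
    have h1 : HasDerivAt (fun r : ℝ => c + r ^ 2 * ε) (2 * r * ε) r := by
      simpa using ((hasDerivAt_pow 2 r).mul_const ε).const_add c
    have h2 := ((hasDerivAt_primitive hF M (c + r ^ 2 * ε)).scomp r h1).const_mul
      (-((1 / (2 * ε) : ℝ) : ℂ))
    refine h2.congr_deriv ?_
    have : (ε : ℂ) ≠ 0 := Complex.ofReal_ne_zero.2 hε.ne'
    simp only [Complex.real_smul]
    push_cast
    field_simp
  have hint2 := integral_Ioi_of_hasDerivAt_of_tendsto (a := 0) (m := 0)
    (hd 0).continuousAt.continuousWithinAt (fun r _ => hd r) hint (by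
      refine tendsto_const_nhds.congr' ?_
      filter_upwards [eventually_ge_atTop R] with r hr
      rw [primitive_eq_zero h (hR r hr), mul_zero])
  simp only [Complex.finrank_real_complex, Nat.add_one_sub_one, pow_one]
  rw [hint2]
  have hb : (volume : Measure ℂ).real (Metric.ball 0 1) = Real.pi := by
    simp [Measure.real, Complex.volume_ball]
  have : (ε : ℂ) ≠ 0 := Complex.ofReal_ne_zero.2 hε.ne'
  rw [hb, Complex.real_smul]
  push_cast
  simp
  field_simp

theorem integral_hypVolume {f : ℂ × ℝ → ℂ} (hf : Continuous f) (hc : HasCompactSupport f) :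
    ∫ p, f p ∂hypVolume = ∫ t : ℝ, (Real.exp (-2 * t) : ℂ) * ∫ z : ℂ, f (z, t) := by
  rw [hypVolume, integral_withDensity_eq_integral_toReal_smul (by fun_prop) (by simp),
    Measure.volume_eq_prod, integral_prod_symm]
  · refine integral_congr_ae (ae_of_all _ fun t => ?_)
    simp only [ENNReal.toReal_ofReal (Real.exp_pos _).le, Complex.real_smul]
    rw [integral_const_mul]
  · have h1 : Continuous fun p : ℂ × ℝ => (ENNReal.ofReal (Real.exp (-2 * p.2))).toReal • f p := by
      simp only [ENNReal.toReal_ofReal (Real.exp_pos _).le]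
      fun_prop
    rw [← Measure.volume_eq_prod]
    exact h1.integrable_of_hasCompactSupport
      (hc.mono fun p hp => right_ne_zero_of_smul (Function.mem_support.1 hp))

theorem hasCompactSupport_na {k : G₀ → ℂ} (hc : HasCompactSupport k) :
    HasCompactSupport fun p : ℂ × ℝ => k (n p.1 * a p.2) :=
  hc.comp_isClosedEmbedding isClosedEmbedding_na

/-- At height t one has cosh(dist) = cosh t + |z|² e^{-t}/2, so integration over z produces 2π e^t
times the primitive at cosh t. Together with e^{-2t} from the volume and e^t from e^{(1+is)t} all
real exponentials cancel, and a Fourier transform in t remains. -/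
theorem sphericalTransform_eq_abel {k : G₀ → ℂ} (hk : Continuous k) (hc : HasCompactSupport k)
    (hb : IsBiinvariant k) {M : ℝ} (h : ∀ g, M ≤ coshDist g → k g = 0) (s : ℝ) :
    sphericalTransform k s = ∫ t : ℝ, ((2 * Real.pi : ℝ) : ℂ) *
      primitive (radial k) M (Real.cosh t) * Complex.exp (Complex.I * s * t) := by
  rw [sphericalTransform_eq hk hc hb, integral_hypVolume (f := fun p => k (n p.1 * a p.2) *
    Complex.exp ((1 + Complex.I * (s : ℂ)) * (p.2 : ℂ)))
    ((hk.comp isClosedEmbedding_na.continuous).mul (by fun_prop))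
    (hasCompactSupport_na hc).mul_right]
  refine integral_congr_ae (ae_of_all _ fun t => ?_)
  simp only
  rw [integral_mul_const]
  have h1 : ∀ z : ℂ, k (n z * a t) =
      radial k (Real.cosh t + ‖z‖ ^ 2 * (Real.exp (-t) / 2)) := fun z => by
    rw [← hb.radial_coshDist, coshDist_na, mul_div_assoc]
  simp only [h1]
  rw [integral_plane_radial (continuous_radial hk) (fun x hx => radial_eq_zero h hx) _
    (by positivity)]
  have e1 : Complex.exp ((1 + Complex.I * (s : ℂ)) * (t : ℂ)) =
      Complex.exp t * Complex.exp (Complex.I * s * t) := by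
    rw [← Complex.exp_add]; congr 1; ring
  have e2 : ((Real.pi / (Real.exp (-t) / 2) : ℝ) : ℂ) = 2 * Real.pi * Complex.exp t := by
    rw [Real.exp_neg]
    push_cast
    field_simp
  have e3 : (Real.exp (-2 * t) : ℂ) * (Complex.exp t * Complex.exp t) = 1 := by
    rw [Complex.ofReal_exp, ← Complex.exp_add, ← Complex.exp_add]
    push_cast
    ring_nf
    simp
  rw [e1, e2]
  push_cast at e3 ⊢
  linear_combination (2 * Real.pi * primitive (radial k) M (Real.cosh t) *
    Complex.exp (Complex.I * s * t)) * e3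

/-! ### Injectivity of the spherical transform. -/

open scoped FourierTransform in
theorem eq_zero_of_integral_exp_eq_zero {Q : ℝ → ℂ} (hQ : Continuous Q)
    (hc : HasCompactSupport Q)
    (h : ∀ s : ℝ, ∫ t : ℝ, Q t * Complex.exp (Complex.I * s * t) = 0) : Q = 0 := by
  have h0 : 𝓕 Q = 0 := by
    funext w
    rw [Real.fourier_real_eq_integral_exp_smul, Pi.zero_apply, ← h (-2 * Real.pi * w)]
    refine integral_congr_ae (ae_of_all _ fun t => ?_)
    simp only [smul_eq_mul]
    rw [mul_comm]
    congr 2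
    push_cast
    ring
  have h1 := hQ.fourierInv_fourier_eq (hQ.integrable_of_hasCompactSupport hc)
    (by rw [h0]; exact integrable_zero _ _ _)
  rw [← h1, h0]
  funext w
  simp [Real.fourierInv_eq]

theorem abs_le_cosh (t : ℝ) : |t| ≤ Real.cosh t := by
  rw [← Real.cosh_abs, Real.cosh_eq]
  have h1 := Real.quadratic_le_exp_of_nonneg (abs_nonneg t)
  have h2 := Real.exp_pos (-|t|)
  nlinarith [sq_nonneg (|t| - 1)]

theorem hasCompactSupport_primitive_cosh {F : ℝ → ℂ} {M : ℝ} (h : ∀ x, M ≤ x → F x = 0) :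
    HasCompactSupport fun t : ℝ => primitive F M (Real.cosh t) := by
  refine HasCompactSupport.intro (isCompact_Icc (a := -M) (b := M)) fun t ht => ?_
  refine primitive_eq_zero h ?_
  by_contra hlt
  have := (abs_le_cosh t).trans (not_le.1 hlt).le
  exact ht (abs_le.1 this)

/-- The spherical transform is injective. -/
theorem eq_zero_of_sphericalTransform_eq_zero {k : G₀ → ℂ} (hk : Continuous k)
    (hc : HasCompactSupport k) (hb : IsBiinvariant k) (h0 : ∀ s, sphericalTransform k s = 0) :
    k = 0 := by
  obtain ⟨M, hM, h⟩ := exists_coshDist_bound hc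
  have hF : ∀ x, M ≤ x → radial k x = 0 := fun x hx => radial_eq_zero h hx
  have hFc := continuous_radial hk
  have hQ := eq_zero_of_integral_exp_eq_zero (Q := fun t => ((2 * Real.pi : ℝ) : ℂ) *
    primitive (radial k) M (Real.cosh t))
    (continuous_const.mul ((continuous_primitive hFc M).comp Real.continuous_cosh))
    (hasCompactSupport_primitive_cosh hF).mul_left
    (fun s => by rw [← sphericalTransform_eq_abel hk hc hb h, h0])
  have hG : ∀ u, 1 ≤ u → primitive (radial k) M u = 0 := fun u hu => by
    have := congrFun hQ (Real.arcosh u)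
    simp only [Real.cosh_arcosh hu, Pi.zero_apply] at this
    exact (mul_eq_zero.1 this).resolve_left (by simp [Real.pi_ne_zero])
  -- The primitive vanishes on [1, ∞), so its derivative, minus the profile, vanishes on (1, ∞);
  -- continuity extends this to the endpoint.
  have h1 : Set.EqOn (radial k) 0 (Set.Ioi 1) := fun u hu => by
    have h2 : HasDerivAt (primitive (radial k) M) 0 u := by
      refine (hasDerivAt_const u (0 : ℂ)).congr_of_eventuallyEq ?_
      filter_upwards [Ioi_mem_nhds hu] with v hv
      exact hG v (le_of_lt hv)
    have h3 := (hasDerivAt_primitive hFc M u).unique h2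
    simpa using h3
  have h2 := h1.closure hFc continuous_zero
  rw [closure_Ioi] at h2
  funext g
  rw [← hb.radial_coshDist]
  exact h2 (one_le_coshDist g)

/-- A function with even real spherical transform is real-valued. -/
theorem conj_eq_of_hasSphericalTransform {k : G₀ → ℂ} {H : ℝ → ℂ}
    (hk : HasSphericalTransform k H) (heven : ∀ s, H (-s) = H s) (hreal : ∀ s, conj (H s) = H s)
    (g : G₀) : conj (k g) = k g := by
  obtain ⟨hc, hs, hb, hH⟩ := hk
  obtain ⟨M, hM, h⟩ := exists_coshDist_bound hs
  have hb : IsBiinvariant k := hb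
  have hs' : HasCompactSupport fun g => conj (k g) := hs.comp_left (map_zero _)
  have hc' : Continuous fun g => conj (k g) := Complex.continuous_conj.comp hc
  have hdb : IsBiinvariant fun g => k g - conj (k g) := fun u hu v hv g => by
    simp only [hb u hu v hv g]
  have hds : HasCompactSupport fun g => k g - conj (k g) :=
    HasCompactSupport.sub hs hs'
  -- By injectivity it is enough that k - k̄ has zero transform; that of k̄ at s is the conjugate of
  -- H(-s).
  have hd0 := eq_zero_of_sphericalTransform_eq_zero (hc.sub hc') hds hdb fun s => ?_
  · have := congrFun hd0 g
    exact (sub_eq_zero.1 this).symm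
  have hF : ∀ x, M ≤ x → radial k x = 0 := fun x hx => radial_eq_zero h hx
  have hFc := continuous_radial hc
  have hd : ∀ g, M ≤ coshDist g → k g - conj (k g) = 0 := fun g hg => by simp [h g hg]
  rw [sphericalTransform_eq_abel (hc.sub hc') hds hdb hd]
  have h1 : ∀ u, primitive (radial fun g => k g - conj (k g)) M u =
      primitive (radial k) M u - conj (primitive (radial k) M u) := fun u => by
    have e : conj (primitive (radial k) M u) = ∫ x in u..M, conj (radial k x) :=
      (Complex.conjCLE.toContinuousLinearMap.intervalIntegral_comp_comm
        (hFc.intervalIntegrable u M)).symm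
    rw [e]
    exact intervalIntegral.integral_sub (f := radial k) (g := fun x => conj (radial k x))
      (hFc.intervalIntegrable _ _) ((Complex.continuous_conj.comp hFc).intervalIntegrable _ _)
  set Q : ℝ → ℂ := fun t => ((2 * Real.pi : ℝ) : ℂ) * primitive (radial k) M (Real.cosh t) with hQ
  have hQc : Continuous Q :=
    continuous_const.mul ((continuous_primitive hFc M).comp Real.continuous_cosh)
  have hQs : HasCompactSupport Q := (hasCompactSupport_primitive_cosh hF).mul_left
  have hint : ∀ s : ℝ, Integrable fun t : ℝ => Q t * Complex.exp (Complex.I * s * t) := fun s =>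
    Continuous.integrable_of_hasCompactSupport (by fun_prop) hQs.mul_right
  have hQt : ∀ s : ℝ, ∫ t, Q t * Complex.exp (Complex.I * s * t) = H s := fun s => by
    rw [← hH, sphericalTransform_eq_abel hc hs hb h]
  have h2 : ∀ t : ℝ, ((2 * Real.pi : ℝ) : ℂ) *
      primitive (radial fun g => k g - conj (k g)) M (Real.cosh t) *
        Complex.exp (Complex.I * s * t) = Q t * Complex.exp (Complex.I * s * t) -
          conj (Q t * Complex.exp (Complex.I * (-s : ℝ) * t)) := fun t => by
    rw [h1]
    simp only [hQ, map_mul, Complex.conj_ofReal, ← Complex.exp_conj, Complex.conj_I]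
    push_cast
    ring_nf
  refine (integral_congr_ae (ae_of_all _ h2)).trans ?_
  rw [integral_sub (hint s) ((hint (-s)).norm.mono'
    (by fun_prop) (ae_of_all _ fun t => by rw [RCLike.norm_conj])), integral_conj, hQt, hQt, heven,
    hreal, sub_self]

end HypThree

namespace HypThree

/-! ### Existence of functions with given spherical transform -/

open Filter Topology

/-- Inversion of the Abel transform: Q(t) = 2π P(cosh t) with P' = -F forces F(cosh t) = -Q'(t) /
(2π sinh t). As Q is even, Q' vanishes at 0, and being differentiable it leaves a quotient that
extends continuously to t = 0. -/
theorem exists_hasSphericalTransform {Q : ℝ → ℂ} (hQ : ContDiff ℝ 2 Q)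
    (heven : ∀ t, Q (-t) = Q t) (hs : HasCompactSupport Q) :
    ∃ k, HasSphericalTransform k fun s => ∫ t : ℝ, Q t * Complex.exp (Complex.I * s * t) := by
  set q : ℝ → ℂ := deriv Q with hq
  have hQd : ∀ t, HasDerivAt Q (q t) t := fun t =>
    (hQ.differentiable (by norm_num)).differentiableAt.hasDerivAt
  have hqC : ContDiff ℝ 1 q := by
    have : ContDiff ℝ (1 + 1) Q := by simpa [one_add_one_eq_two] using hQ
    exact (contDiff_succ_iff_deriv.1 this).2.2
  have hqd : Differentiable ℝ q := hqC.differentiable (by norm_num)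
  have hq0 : q 0 = 0 := by
    have h1 : HasDerivAt (fun t => Q (-t)) (-q 0) 0 :=
      ((hQd (-0)).scomp (0 : ℝ) (hasDerivAt_neg (0 : ℝ))).congr_deriv (by simp)
    have h2 : (fun t => Q (-t)) = Q := funext heven
    rw [h2] at h1
    exact self_eq_neg.1 ((hQd 0).unique h1)
  obtain ⟨T, hT0, hT⟩ : ∃ T : ℝ, 0 < T ∧ ∀ t, T ≤ t → Q t = 0 ∧ q t = 0 := by
    obtain ⟨C, hC⟩ := hs.isCompact.bddAbove
    refine ⟨max 1 (C + 1), by positivity, fun t ht => ?_⟩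
    have hn : t ∉ tsupport Q := fun h => by
      have := hC h
      linarith [le_max_right 1 (C + 1)]
    exact ⟨image_eq_zero_of_notMem_tsupport hn,
      image_eq_zero_of_notMem_tsupport fun h => hn (tsupport_deriv_subset (𝕜 := ℝ) h)⟩
  -- Numerator and denominator are both divided by t. At t = 0 `dslope` takes the value of the
  -- derivative, which removes the singularity.
  set κ : ℝ → ℂ := fun t => -(((1 / (2 * Real.pi)) * (dslope Real.sinh 0 t)⁻¹ : ℝ) : ℂ) *
    dslope q 0 t with hκ
  have hsinh : ∀ t, dslope Real.sinh 0 t ≠ 0 := fun t => by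
    rcases eq_or_ne t 0 with rfl | ht
    · simp
    · rw [dslope_of_ne _ ht, slope_def_field]
      simp [ht, Real.sinh_eq_zero]
  have hcont : Continuous κ := by
    have h1 : Continuous (dslope Real.sinh 0) := continuous_iff_continuousAt.2 fun t => by
      rcases eq_or_ne t 0 with rfl | ht
      · exact continuousAt_dslope_same.2 Real.differentiable_sinh.differentiableAt
      · exact (continuousAt_dslope_of_ne ht).2 Real.continuous_sinh.continuousAt
    have h2 : Continuous (dslope q 0) := continuous_iff_continuousAt.2 fun t => by
      rcases eq_or_ne t 0 with rfl | ht
      · exact continuousAt_dslope_same.2 hqd.differentiableAt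
      · exact (continuousAt_dslope_of_ne ht).2 hqd.continuous.continuousAt
    exact (Complex.continuous_ofReal.comp
      (continuous_const.mul (h1.inv₀ hsinh))).neg.mul h2
  have hκt : ∀ t, κ t * Real.sinh t = -(1 / (2 * Real.pi) : ℝ) * q t := fun t => by
    rcases eq_or_ne t 0 with rfl | ht
    · simp [hq0]
    · have h1 : (Real.sinh t : ℂ) ≠ 0 := by
        rw [Complex.ofReal_ne_zero]; simpa [Real.sinh_eq_zero] using ht
      have h2 : (t : ℂ) ≠ 0 := Complex.ofReal_ne_zero.2 ht
      simp only [hκ, dslope_of_ne _ ht, slope_def_field, slope_def_module, hq0, Real.sinh_zero,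
        sub_zero, Complex.real_smul]
      push_cast at h1 ⊢
      field_simp
  set k : G₀ → ℂ := fun g => κ (Real.arcosh (coshDist g)) with hk
  have hkc : Continuous k := by
    refine hcont.comp (Real.continuousOn_arcosh.comp_continuous continuous_coshDist
      fun g => Set.mem_Ici.2 (one_le_coshDist g))
  have hkz : ∀ g, Real.cosh T ≤ coshDist g → k g = 0 := fun g hg => by
    have h1 : T ≤ Real.arcosh (coshDist g) := by
      rw [← Real.arcosh_cosh hT0.le]
      exact (Real.arcosh_le_arcosh (Real.cosh_pos _)
        (zero_lt_one.trans_le (one_le_coshDist g))).2 hg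
    have h2 : (Real.sinh (Real.arcosh (coshDist g)) : ℂ) ≠ 0 := by
      rw [Complex.ofReal_ne_zero]
      exact (Real.sinh_pos_iff.2 (hT0.trans_le h1)).ne'
    have h3 := hκt (Real.arcosh (coshDist g))
    rw [(hT _ h1).2, mul_zero] at h3
    exact (mul_eq_zero.1 h3).resolve_right h2
  have hkb : IsBiinvariant k := fun u hu v hv g => by
    simp only [hk, coshDist_mul_right _ hv, coshDist_mul_left _ hu]
  have hks : HasCompactSupport k :=
    HasCompactSupport.intro (isCompact_coshDist_le (Real.cosh T)) fun g hg =>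
      hkz g (le_of_lt (not_le.1 hg))
  refine ⟨k, hkc, hks, hkb, fun s => ?_⟩
  rw [sphericalTransform_eq_abel hkc hks hkb hkz]
  have hF : ∀ x, Real.cosh T ≤ x → radial k x = 0 := fun x hx => radial_eq_zero hkz hx
  have hFr : ∀ t, 0 ≤ t → radial k (Real.cosh t) = κ t := fun t ht => by
    rw [radial, max_eq_right (Real.one_le_cosh t), Real.arcosh_cosh ht, hk]
    simp only
    rw [coshDist_a, Real.arcosh_cosh ht]
  have hFc := continuous_radial hkc
  -- D is the defect between the Abel transform of k and Q; on [0, ∞) its derivative is zero, and it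
  -- vanishes for large t.
  set D : ℝ → ℂ := fun t =>
    ((2 * Real.pi : ℝ) : ℂ) * primitive (radial k) (Real.cosh T) (Real.cosh t) - Q t with hD
  have hDd : ∀ t, 0 ≤ t → HasDerivAt D 0 t := fun t ht => by
    have h1 := (((hasDerivAt_primitive hFc (Real.cosh T) (Real.cosh t)).scomp t
      (Real.hasDerivAt_cosh t)).const_mul ((2 * Real.pi : ℝ) : ℂ)).sub (hQd t)
    refine h1.congr_deriv ?_
    have h2 := hκt t
    rw [hFr t ht, Complex.real_smul]
    have hpi : (Real.pi : ℂ) ≠ 0 := Complex.ofReal_ne_zero.2 Real.pi_ne_zero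
    push_cast at h2 ⊢
    field_simp at h2
    linear_combination -h2
  have hD0 : ∀ t, 0 ≤ t → D t = 0 := fun t ht => by
    have h1 := constant_of_has_deriv_right_zero (f := D) (a := t) (b := max t T)
      (fun x hx => (hDd x (ht.trans hx.1)).continuousAt.continuousWithinAt)
      (fun x hx => (hDd x (ht.trans hx.1)).hasDerivWithinAt) _ ⟨le_max_left _ _, le_rfl⟩
    rw [← h1]
    simp only [hD]
    rw [(hT _ (le_max_right t T)).1, primitive_eq_zero hF, mul_zero, sub_zero]
    rw [Real.cosh_le_cosh, abs_of_pos hT0]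
    exact (le_max_right _ _).trans (le_abs_self _)
  refine integral_congr_ae (ae_of_all _ fun t => ?_)
  simp only
  congr 1
  have h1 := sub_eq_zero.1 (hD0 |t| (abs_nonneg t))
  rw [Real.cosh_abs] at h1
  rw [h1]
  rcases abs_choice t with h | h <;> rw [h]
  exact heven t

end HypThree

namespace HypThree

/-! ### The Paley-Wiener theorem and the test function `k_λ⁰` -/

open Filter Topology

theorem one_add_sq_le (x y : ℝ) : 1 + x ^ 2 ≤ (1 + ‖(x + y * Complex.I : ℂ)‖) ^ 2 := by
  have h1 : |x| ≤ ‖(x + y * Complex.I : ℂ)‖ := by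
    simpa using Complex.abs_re_le_norm (x + y * Complex.I : ℂ)
  have h2 : x ^ 2 ≤ ‖(x + y * Complex.I : ℂ)‖ ^ 2 := by
    rw [← sq_abs x]; exact pow_le_pow_left₀ (abs_nonneg _) h1 2
  nlinarith [norm_nonneg (x + y * Complex.I : ℂ)]

section Contour

variable {H : ℂ → ℂ} (hH : Differentiable ℂ H) {R C : ℝ}
  (hC : ∀ z : ℂ, ‖H z‖ * (1 + ‖z‖) ^ 2 ≤ C * Real.exp (R * |z.im|))

include hC in
theorem norm_mul_exp_le (t x y : ℝ) :
    ‖H (x + y * Complex.I) * Complex.exp (-Complex.I * t * (x + y * Complex.I))‖ ≤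
      C * Real.exp (R * |y| + t * y) * (1 + x ^ 2)⁻¹ := by
  have h1 := hC (x + y * Complex.I)
  have h2 : (x + y * Complex.I : ℂ).im = y := by simp
  rw [h2] at h1
  have h3 : ‖Complex.exp (-Complex.I * t * (x + y * Complex.I))‖ = Real.exp (t * y) := by
    rw [Complex.norm_exp]; congr 1; simp
  rw [norm_mul, h3, ← div_eq_mul_inv, le_div_iff₀ (by positivity), Real.exp_add]
  have h4 := mul_le_mul_of_nonneg_left (one_add_sq_le x y) (norm_nonneg (H (x + y * Complex.I)))
  have h5 := mul_le_mul_of_nonneg_right (h4.trans h1) (Real.exp_pos (t * y)).le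
  linarith

include hH in
theorem continuous_line (t y : ℝ) : Continuous fun x : ℝ =>
    H (x + y * Complex.I) * Complex.exp (-Complex.I * t * (x + y * Complex.I)) := by
  have := hH.continuous
  fun_prop

include hH hC in
theorem integrable_line (t y : ℝ) : Integrable fun x : ℝ =>
    H (x + y * Complex.I) * Complex.exp (-Complex.I * t * (x + y * Complex.I)) :=
  (integrable_inv_one_add_sq.const_mul (C * Real.exp (R * |y| + t * y))).mono'
    (continuous_line hH t y).aestronglyMeasurable (ae_of_all _ fun x => norm_mul_exp_le hC t x y)

include hC in
theorem tendsto_vertical (t y : ℝ) {l : Filter ℝ} {T : ℝ → ℝ}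
    (hT : Tendsto (fun i => 1 + T i ^ 2) l atTop) :
    Tendsto (fun i => ∫ x in (0 : ℝ)..y, H (T i + x * Complex.I) *
      Complex.exp (-Complex.I * t * (T i + x * Complex.I))) l (𝓝 0) := by
  have hC0 : 0 ≤ C := by
    have := (norm_mul_exp_le hC 0 0 0).trans' (norm_nonneg _)
    simpa using this
  rw [tendsto_zero_iff_norm_tendsto_zero]
  have h0 : Tendsto (fun i => C * Real.exp (|R| * |y| + |t| * |y|) * (1 + T i ^ 2)⁻¹ * |y - 0|) l
      (𝓝 0) := by
    have := ((tendsto_inv_atTop_zero.comp hT).const_mul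
      (C * Real.exp (|R| * |y| + |t| * |y|))).mul_const |y - 0|
    simpa using this
  refine squeeze_zero (fun _ => norm_nonneg _) (fun i => ?_) h0
  refine intervalIntegral.norm_integral_le_of_norm_le_const fun x hx => ?_
  refine (norm_mul_exp_le hC t (T i) x).trans ?_
  have hxy : |x| ≤ |y| := by
    rcases le_total 0 y with h | h
    · rw [Set.uIoc_of_le h] at hx
      rw [abs_of_pos hx.1, abs_of_nonneg h]; exact hx.2
    · rw [Set.uIoc_of_ge h] at hx
      rw [abs_of_nonpos hx.2, abs_of_nonpos h]; linarith [hx.1]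
  have htx : t * x ≤ |t| * |y| :=
    calc t * x ≤ |t * x| := le_abs_self _
      _ = |t| * |x| := abs_mul _ _
      _ ≤ |t| * |y| := by gcongr
  have hRx : R * |x| ≤ |R| * |y| :=
    (mul_le_mul_of_nonneg_right (le_abs_self R) (abs_nonneg x)).trans (by gcongr)
  gcongr

include hH hC in
-- Cauchy's theorem on the rectangles over [-T, T]; their vertical sides disappear as T → ∞ because
-- H decays on horizontal strips.
theorem integral_line_eq (t y : ℝ) :
    ∫ x : ℝ, H (x + y * Complex.I) * Complex.exp (-Complex.I * t * (x + y * Complex.I)) =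
      ∫ x : ℝ, H x * Complex.exp (-Complex.I * t * x) := by
  set f : ℂ → ℂ := fun z => H z * Complex.exp (-Complex.I * t * z) with hf
  have hfd : Differentiable ℂ f := by fun_prop
  have hrect : ∀ T : ℝ, (∫ x in (-T)..T, f (x + (0 : ℝ) * Complex.I)) -
      (∫ x in (-T)..T, f (x + y * Complex.I)) + Complex.I • (∫ s in (0 : ℝ)..y,
        f (T + s * Complex.I)) - Complex.I • (∫ s in (0 : ℝ)..y, f ((-T : ℝ) + s * Complex.I)) =
          0 := fun T => by
    have := Complex.integral_boundary_rect_eq_zero_of_differentiableOn f ((-T : ℝ) : ℂ)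
      (T + y * Complex.I) hfd.differentiableOn
    simpa using this
  have hT1 : Tendsto (fun T : ℝ => 1 + T ^ 2) atTop atTop :=
    tendsto_atTop_add_const_left _ _ (tendsto_pow_atTop two_ne_zero)
  have hT2 : Tendsto (fun T : ℝ => 1 + (-T) ^ 2) atTop atTop := by simpa using hT1
  have l1 := intervalIntegral_tendsto_integral (integrable_line hH hC t 0) tendsto_neg_atTop_atBot
    tendsto_id
  have l2 := intervalIntegral_tendsto_integral (integrable_line hH hC t y) tendsto_neg_atTop_atBot
    tendsto_id
  have l3 := (tendsto_vertical hC t y (T := fun T => T) hT1).const_smul Complex.I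
  have l4 := (tendsto_vertical hC t y hT2).const_smul Complex.I
  have l5 := ((l1.sub l2).add l3).sub l4
  have l6 := tendsto_nhds_unique (l5.congr fun T => hrect T) tendsto_const_nhds
  simp only [smul_zero, add_zero, sub_zero] at l6
  rw [← sub_eq_zero.1 l6]
  simp

include hH hC in
-- Move the line of integration to height y with ty = -|t|Y. Exponential type bounds the integral by
-- a multiple of e^{-(|t| - |R|)Y}, which tends to zero as Y → ∞.
theorem integral_exp_eq_zero_of_lt {t : ℝ} (ht : |R| < |t|) :
    ∫ x : ℝ, H x * Complex.exp (-Complex.I * t * x) = 0 := by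
  have hC0 : 0 ≤ C := by
    have := (norm_mul_exp_le hC 0 0 0).trans' (norm_nonneg _)
    simpa using this
  have hb : ∀ Y : ℝ, 0 ≤ Y → ‖∫ x : ℝ, H x * Complex.exp (-Complex.I * t * x)‖ ≤
      C * Real.exp (-(|t| - |R|) * Y) * Real.pi := fun Y hY => by
    obtain ⟨y, hy1, hy2⟩ : ∃ y : ℝ, |y| = Y ∧ t * y = -(|t| * Y) := by
      rcases le_total 0 t with h | h
      · exact ⟨-Y, by rw [abs_neg, abs_of_nonneg hY], by rw [abs_of_nonneg h]; ring⟩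
      · exact ⟨Y, abs_of_nonneg hY, by rw [abs_of_nonpos h]; ring⟩
    rw [← integral_line_eq hH hC t y]
    refine (norm_integral_le_of_norm_le (integrable_inv_one_add_sq.const_mul _)
      (ae_of_all _ fun x => norm_mul_exp_le hC t x y)).trans ?_
    rw [integral_const_mul, integral_univ_inv_one_add_sq, hy1, hy2]
    gcongr
    nlinarith [le_abs_self R]
  have hlim : Tendsto (fun Y : ℝ => C * Real.exp (-(|t| - |R|) * Y) * Real.pi) atTop (𝓝 0) := by
    have h1 : Tendsto (fun Y : ℝ => -(|t| - |R|) * Y) atTop atBot :=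
      tendsto_id.const_mul_atTop_of_neg (by linarith)
    have := ((Real.tendsto_exp_atBot.comp h1).const_mul C).mul_const Real.pi
    simpa using this
  have := ge_of_tendsto hlim ((eventually_ge_atTop 0).mono hb)
  exact norm_le_zero_iff.1 this

end Contour

open scoped FourierTransform in
/-- The Paley-Wiener theorem, for the Fourier transform `q` of a function `h`. -/
theorem IsPaleyWiener.exists_fourier {h : ℝ → ℝ} (hh : IsPaleyWiener h) :
    ∃ q : ℝ → ℂ, ContDiff ℝ 2 q ∧ HasCompactSupport q ∧
      ∀ s : ℝ, ∫ t : ℝ, q t * Complex.exp (Complex.I * s * t) = h s := by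
  obtain ⟨H, hH, hHh, R, hR⟩ := hh
  set f : ℝ → ℂ := fun x => (h x : ℂ) with hf
  have hfH : ∀ x : ℝ, f x = H x := fun x => (hHh x).symm
  have hfc : Continuous f := by
    have : f = fun x : ℝ => H x := funext hfH
    rw [this]
    exact hH.continuous.comp Complex.continuous_ofReal
  have hint : ∀ m : ℕ, Integrable fun x : ℝ => ‖x‖ ^ m * ‖f x‖ := fun m => by
    -- Two powers pay for integrability, the other m absorb the weight; the moments up to order two
    -- make the Fourier transform twice differentiable.
    obtain ⟨C, hC⟩ := hR (m + 2)
    refine (integrable_inv_one_add_sq.const_mul C).mono' (by fun_prop) (ae_of_all _ fun x => ?_)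
    have h1 := hC x
    simp only [Complex.ofReal_im, abs_zero, mul_zero, Real.exp_zero, mul_one] at h1
    have h2 := one_add_sq_le x 0
    simp only [Complex.ofReal_zero, zero_mul, add_zero] at h2
    rw [norm_mul, norm_pow, norm_norm, norm_norm, ← div_eq_mul_inv, le_div_iff₀ (by positivity)]
    refine le_trans ?_ h1
    rw [hfH, mul_comm (‖x‖ ^ m), mul_assoc, pow_add]
    have h3 : ‖x‖ ≤ 1 + ‖(x : ℂ)‖ := by rw [Complex.norm_real]; linarith
    gcongr
  have hfi : Integrable f := by
    have := hint 0
    simp only [pow_zero, one_mul] at this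
    exact (integrable_norm_iff hfc.aestronglyMeasurable).1 this
  have hsm : ContDiff ℝ 2 (𝓕 f) := Real.contDiff_fourier (N := 2) fun m _ => hint m
  have hFe : ∀ w, 𝓕 f w = ∫ x : ℝ, H x * Complex.exp (-Complex.I * (2 * Real.pi * w : ℝ) * x) :=
    fun w => by
    rw [Real.fourier_real_eq_integral_exp_smul]
    refine integral_congr_ae (ae_of_all _ fun x => ?_)
    simp only [smul_eq_mul, hfH]
    rw [mul_comm]
    congr 2
    push_cast
    ring
  have hcs : HasCompactSupport (𝓕 f) := by
    obtain ⟨C, hC⟩ := hR 2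
    refine HasCompactSupport.intro (isCompact_Icc (a := -|R|) (b := |R|)) fun w hw => ?_
    rw [hFe]
    refine integral_exp_eq_zero_of_lt hH hC ?_
    have h1 : |R| < |w| := by
      by_contra hle
      exact hw (abs_le.1 (not_lt.1 hle))
    rw [abs_mul, abs_of_pos (by positivity : 0 < 2 * Real.pi)]
    nlinarith [Real.pi_gt_three, abs_nonneg w]
  have hinv := hfc.fourierInv_fourier_eq hfi (hsm.continuous.integrable_of_hasCompactSupport hcs)
  -- The factor 2π passes from the kernel e^{2πiwx} of the Fourier transform to the kernel e^{ist}
  -- used here.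
  refine ⟨fun t => ((1 / (2 * Real.pi) : ℝ) : ℂ) * 𝓕 f ((2 * Real.pi)⁻¹ * t),
    contDiff_const.mul (hsm.comp (contDiff_const.mul contDiff_id)), ?_, fun s => ?_⟩
  · refine HasCompactSupport.mul_left ?_
    exact hcs.comp_homeomorph (Homeomorph.mulLeft₀ (2 * Real.pi)⁻¹ (by positivity))
  · have h1 := congrFun hinv s
    rw [Real.fourierInv_eq'] at h1
    have h2 := Measure.integral_comp_mul_left
      (fun w : ℝ => 𝓕 f w * Complex.exp (Complex.I * s * (2 * Real.pi * w : ℝ))) (2 * Real.pi)⁻¹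
    change _ = f s
    rw [← h1]
    have h3 : ∀ t : ℝ, ((1 / (2 * Real.pi) : ℝ) : ℂ) * 𝓕 f ((2 * Real.pi)⁻¹ * t) *
        Complex.exp (Complex.I * s * t) = ((1 / (2 * Real.pi) : ℝ) : ℂ) *
        (𝓕 f ((2 * Real.pi)⁻¹ * t) *
          Complex.exp (Complex.I * s * (2 * Real.pi * ((2 * Real.pi)⁻¹ * t) : ℝ))) := fun t => by
      rw [mul_inv_cancel_left₀ (by positivity : 2 * Real.pi ≠ 0), mul_assoc]
    simp only [h3]
    rw [integral_const_mul, h2, inv_inv, abs_of_pos (by positivity), Complex.real_smul, ← mul_assoc,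
      ← Complex.ofReal_mul, one_div, inv_mul_cancel₀ (by positivity), Complex.ofReal_one, one_mul]
    refine integral_congr_ae (ae_of_all _ fun w => ?_)
    simp only [smul_eq_mul]
    rw [mul_comm]
    congr 2
    simp
    ring

/-- Multiplication of q by e^{-iλt} shifts its transform by λ, and adding the reflection t ↦ -t
makes the result even, with transform h(s - λ) + h(-s - λ). Existence of one such kernel is what
makes the chosen one meaningful. -/
theorem hasSphericalTransform_k0 {h : ℝ → ℝ} (hh : IsPaleyWiener h) (lam : ℝ) :
    HasSphericalTransform (k0 h lam) (h0 h lam) := by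
  obtain ⟨q, hq, hqs, hqt⟩ := hh.exists_fourier
  set Q : ℝ → ℂ := fun t => Complex.exp (-Complex.I * lam * t) * q t +
    Complex.exp (-Complex.I * lam * (-t : ℝ)) * q (-t) with hQ
  have hqs' : HasCompactSupport fun t => q (-t) := hqs.comp_homeomorph (Homeomorph.neg ℝ)
  have he : ContDiff ℝ 2 fun t : ℝ => Complex.exp (-Complex.I * lam * t) :=
    (contDiff_const.mul Complex.ofRealCLM.contDiff).cexp
  have hqc := hq.continuous
  have hQc : ContDiff ℝ 2 Q :=
    (he.mul hq).add ((he.comp contDiff_neg).mul (hq.comp contDiff_neg))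
  obtain ⟨k, hk⟩ := exists_hasSphericalTransform hQc (fun t => by
    simp only [hQ, neg_neg]; rw [add_comm]) ((hqs.mul_left).add hqs'.mul_left)
  have hkh : (fun s : ℝ => ∫ t : ℝ, Q t * Complex.exp (Complex.I * s * t)) = h0 h lam := by
    funext s
    have i1 : Integrable fun t : ℝ => q t * Complex.exp (Complex.I * (s - lam : ℝ) * t) :=
      Continuous.integrable_of_hasCompactSupport (by fun_prop) hqs.mul_right
    have i2 : Integrable fun t : ℝ => q t * Complex.exp (Complex.I * (-s - lam : ℝ) * t) :=
      Continuous.integrable_of_hasCompactSupport (by fun_prop) hqs.mul_right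
    have e1 : ∀ t : ℝ, Q t * Complex.exp (Complex.I * s * t) =
        q t * Complex.exp (Complex.I * (s - lam : ℝ) * t) +
          q (-t) * Complex.exp (Complex.I * (-s - lam : ℝ) * (-t : ℝ)) := fun t => by
      have e2 : Complex.exp (Complex.I * (s - lam : ℝ) * t) =
          Complex.exp (-Complex.I * lam * t) * Complex.exp (Complex.I * s * t) := by
        rw [← Complex.exp_add]; congr 1; push_cast; ring
      have e3 : Complex.exp (Complex.I * (-s - lam : ℝ) * (-t : ℝ)) =
          Complex.exp (-Complex.I * lam * (-t : ℝ)) * Complex.exp (Complex.I * s * t) := by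
        rw [← Complex.exp_add]; congr 1; push_cast; ring
      simp only [hQ]
      rw [e2, e3]
      ring
    rw [integral_congr_ae (ae_of_all _ e1), integral_add i1 i2.comp_neg, hqt,
      integral_neg_eq_self (fun t : ℝ => q t * Complex.exp (Complex.I * (-s - lam : ℝ) * t)), hqt,
      h0, Complex.ofReal_add]
  rw [hkh] at hk
  exact Classical.epsilon_spec (p := fun k => HasSphericalTransform k (h0 h lam)) ⟨k, hk⟩

end HypThree

namespace HypThree

/-! ### The Laplace operator on `ℂ × ℝ` and Green's formula -/

open Filter Topology

/-- The derivative in the direction `v`. -/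
def dirDeriv {E : Type*} [NormedAddCommGroup E] [NormedSpace ℝ E] (v : E) (f : E → ℂ) (p : E) : ℂ :=
  fderiv ℝ f p v

section DirDeriv

variable {E : Type*} [NormedAddCommGroup E] [NormedSpace ℝ E]

theorem dirDeriv_eq {v : E} {f : E → ℂ} {p : E} {f' : ℂ} (hf : DifferentiableAt ℝ f p)
    (h : HasDerivAt (fun s : ℝ => f (p + s • v)) f' 0) : dirDeriv v f p = f' :=
  (hf.hasFDerivAt.hasLineDerivAt v).lineDeriv.symm.trans (HasLineDerivAt.lineDeriv h)

theorem hasDerivAt_dirDeriv {v : E} {f : E → ℂ} {p : E} (hf : DifferentiableAt ℝ f p) :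
    HasDerivAt (fun s : ℝ => f (p + s • v)) (dirDeriv v f p) 0 :=
  hf.hasFDerivAt.hasLineDerivAt v

theorem contDiff_dirDeriv {v : E} {f : E → ℂ} {m k : WithTop ℕ∞} (hf : ContDiff ℝ k f)
    (h : m + 1 ≤ k) : ContDiff ℝ m (dirDeriv v f) :=
  (hf.fderiv_right h).clm_apply contDiff_const

theorem hasCompactSupport_dirDeriv {v : E} {f : E → ℂ} (hf : HasCompactSupport f) :
    HasCompactSupport (dirDeriv v f) :=
  (hf.fderiv (𝕜 := ℝ)).mono' fun p hp => subset_tsupport _ fun h => hp (by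
    rw [dirDeriv, h]; rfl)

/-- Integration by parts on each side leads to the same expression -∫ w ∂U ∂Φ. Compact support of U
alone removes the boundary terms. -/
theorem integral_dirDeriv_mul [MeasurableSpace E] [BorelSpace E] [FiniteDimensional ℝ E]
    {μ : Measure E} [μ.IsAddHaarMeasure] {U Φ w : E → ℂ} (v : E) (hU : ContDiff ℝ 2 U)
    (hΦ : ContDiff ℝ 2 Φ) (hw : ContDiff ℝ 1 w) (hs : HasCompactSupport U) :
    ∫ p, dirDeriv v (fun p => w p * dirDeriv v U p) p * Φ p ∂μ =
      ∫ p, U p * dirDeriv v (fun p => w p * dirDeriv v Φ p) p ∂μ := by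
  have hU1 : ContDiff ℝ 1 (dirDeriv v U) := contDiff_dirDeriv hU (by norm_num)
  have hΦ1 : ContDiff ℝ 1 (dirDeriv v Φ) := contDiff_dirDeriv hΦ (by norm_num)
  have hwU := hw.mul hU1
  have hwΦ := hw.mul hΦ1
  have cU := hU.continuous
  have cΦ := hΦ.continuous
  have c1 := hU1.continuous
  have c2 := hΦ1.continuous
  have c3 := hw.continuous
  have c4 : Continuous (dirDeriv v fun p => w p * dirDeriv v U p) :=
    (contDiff_dirDeriv (m := 0) hwU (by norm_num)).continuous
  have c5 : Continuous (dirDeriv v fun p => w p * dirDeriv v Φ p) :=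
    (contDiff_dirDeriv (m := 0) hwΦ (by norm_num)).continuous
  have s1 : HasCompactSupport (dirDeriv v U) := hasCompactSupport_dirDeriv hs
  have s2 : HasCompactSupport fun p => w p * dirDeriv v U p := s1.mul_left
  have s3 : HasCompactSupport (dirDeriv v fun p => w p * dirDeriv v U p) :=
    hasCompactSupport_dirDeriv s2
  have h1 : ∫ p, w p * dirDeriv v U p * dirDeriv v Φ p ∂μ =
      -∫ p, dirDeriv v (fun p => w p * dirDeriv v U p) p * Φ p ∂μ :=
    integral_mul_fderiv_eq_neg_fderiv_mul_of_integrable (𝕜 := ℂ)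
      (f := fun p => w p * dirDeriv v U p) (g := Φ)
      ((c4.mul cΦ).integrable_of_hasCompactSupport s3.mul_right)
      (((c3.mul c1).mul c2).integrable_of_hasCompactSupport s2.mul_right)
      (((c3.mul c1).mul cΦ).integrable_of_hasCompactSupport s2.mul_right)
      (fun p _ => (hwU.differentiable (by norm_num)).differentiableAt)
      (fun p _ => (hΦ.differentiable (by norm_num)).differentiableAt)
  have h2 : ∫ p, U p * dirDeriv v (fun p => w p * dirDeriv v Φ p) p ∂μ =
      -∫ p, dirDeriv v U p * (w p * dirDeriv v Φ p) ∂μ :=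
    integral_mul_fderiv_eq_neg_fderiv_mul_of_integrable (𝕜 := ℂ)
      (f := U) (g := fun p => w p * dirDeriv v Φ p)
      ((c1.mul (c3.mul c2)).integrable_of_hasCompactSupport s1.mul_right)
      ((cU.mul c5).integrable_of_hasCompactSupport hs.mul_right)
      ((cU.mul (c3.mul c2)).integrable_of_hasCompactSupport hs.mul_right)
      (fun p _ => (hU.differentiable (by norm_num)).differentiableAt)
      (fun p _ => (hwΦ.differentiable (by norm_num)).differentiableAt)
  rw [h2, ← neg_eq_iff_eq_neg.2 h1]
  congr 2
  funext p
  ring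

end DirDeriv

/-- The Laplace operator of `ℍ³` in the coordinates `(z, t) ∈ ℂ × ℝ`. -/
def lap (f : ℂ × ℝ → ℂ) (p : ℂ × ℝ) : ℂ :=
  (Real.exp (2 * p.2) : ℂ) * (dirDeriv (1, 0) (dirDeriv (1, 0) f) p +
    dirDeriv (Complex.I, 0) (dirDeriv (Complex.I, 0) f) p) +
  dirDeriv (0, 1) (dirDeriv (0, 1) f) p - 2 * dirDeriv (0, 1) f p

/-- The weight `e^{-2t}` of the hyperbolic volume. -/
def weight (p : ℂ × ℝ) : ℂ := (Real.exp (-2 * p.2) : ℂ)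

theorem contDiff_weight {k : WithTop ℕ∞} : ContDiff ℝ k weight :=
  Complex.ofRealCLM.contDiff.comp ((contDiff_const.mul contDiff_snd).exp)

/-- Divergence form: multiplied by the volume density, Δ becomes ∂_x² + ∂_y² + ∂_t e^{-2t} ∂_t,
ready for integration by parts. -/
theorem weight_mul_lap {f : ℂ × ℝ → ℂ} (hf : ContDiff ℝ 2 f) (p : ℂ × ℝ) :
    weight p * lap f p = dirDeriv (1, 0) (fun p => 1 * dirDeriv (1, 0) f p) p +
      dirDeriv (Complex.I, 0) (fun p => 1 * dirDeriv (Complex.I, 0) f p) p +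
      dirDeriv (0, 1) (fun p => weight p * dirDeriv (0, 1) f p) p := by
  have h1 : ContDiff ℝ 1 (dirDeriv (0, 1) f) := contDiff_dirDeriv hf (by norm_num)
  have h2 : dirDeriv (0, 1) (fun p => weight p * dirDeriv (0, 1) f p) p =
      -2 * weight p * dirDeriv (0, 1) f p +
        weight p * dirDeriv (0, 1) (dirDeriv (0, 1) f) p := by
    refine dirDeriv_eq ((contDiff_weight.mul h1).differentiable (by norm_num)).differentiableAt ?_
    have e1 : HasDerivAt (fun s : ℝ => weight (p + s • ((0, 1) : ℂ × ℝ))) (-2 * weight p) 0 := by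
      have e2 : HasDerivAt (fun s : ℝ => Real.exp (-2 * (p.2 + s)))
          (Real.exp (-2 * (p.2 + 0)) * (-2 * 1)) 0 :=
        (((hasDerivAt_id (0 : ℝ)).const_add p.2).const_mul (-2)).exp
      have e3 := e2.ofReal_comp
      simp only [weight]
      convert! e3 using 2
      · simp
      · simp; ring
    have e4 := e1.mul (hasDerivAt_dirDeriv (v := ((0, 1) : ℂ × ℝ))
      (h1.differentiable (by norm_num)).differentiableAt (p := p))
    exact e4.congr_deriv (by simp)
  have h3 : weight p * (Real.exp (2 * p.2) : ℂ) = 1 := by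
    rw [weight, ← Complex.ofReal_mul, ← Real.exp_add]; simp
  simp only [one_mul]
  rw [h2, lap]
  change _ = dirDeriv (1, 0) (dirDeriv (1, 0) f) p +
    dirDeriv (Complex.I, 0) (dirDeriv (Complex.I, 0) f) p + _
  linear_combination (dirDeriv (1, 0) (dirDeriv (1, 0) f) p +
    dirDeriv (Complex.I, 0) (dirDeriv (Complex.I, 0) f) p) * h3

theorem continuous_lap {f : ℂ × ℝ → ℂ} (hf : ContDiff ℝ 2 f) : Continuous (lap f) := by
  have h : ∀ v, Continuous (dirDeriv v (dirDeriv v f)) := fun v =>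
    (contDiff_dirDeriv (m := 0) (k := 1) (contDiff_dirDeriv hf (by norm_num))
      (by norm_num)).continuous
  have h' : ∀ v, Continuous (dirDeriv v f) := fun v =>
    (contDiff_dirDeriv (m := 1) hf (by norm_num)).continuous
  have := h (1, 0)
  have := h (Complex.I, 0)
  have := h (0, 1)
  have := h' (0, 1)
  unfold lap
  fun_prop

theorem integral_add_add {α : Type*} [MeasurableSpace α] {μ : Measure α} {f g h : α → ℂ}
    (hf : Integrable f μ) (hg : Integrable g μ) (hh : Integrable h μ) :
    ∫ x, f x + g x + h x ∂μ = ∫ x, f x ∂μ + ∫ x, g x ∂μ + ∫ x, h x ∂μ := by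
  rw [← integral_add hf hg]
  exact integral_add (hf.add hg) hh

instance : (volume : Measure (ℂ × ℝ)).IsAddHaarMeasure :=
  inferInstanceAs ((volume : Measure ℂ).prod (volume : Measure ℝ)).IsAddHaarMeasure

/-- Green's formula: the Laplace operator is symmetric for the hyperbolic volume. -/
theorem green {U Φ : ℂ × ℝ → ℂ} (hU : ContDiff ℝ 2 U) (hs : HasCompactSupport U)
    (hΦ : ContDiff ℝ 2 Φ) :
    ∫ p, weight p * (lap U p * Φ p) = ∫ p, weight p * (U p * lap Φ p) := by
  have e1 : ∀ p, weight p * (lap U p * Φ p) =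
      dirDeriv (1, 0) (fun p => 1 * dirDeriv (1, 0) U p) p * Φ p +
      dirDeriv (Complex.I, 0) (fun p => 1 * dirDeriv (Complex.I, 0) U p) p * Φ p +
      dirDeriv (0, 1) (fun p => weight p * dirDeriv (0, 1) U p) p * Φ p := fun p => by
    rw [← mul_assoc, weight_mul_lap hU]; ring
  have e2 : ∀ p, weight p * (U p * lap Φ p) =
      U p * dirDeriv (1, 0) (fun p => 1 * dirDeriv (1, 0) Φ p) p +
      U p * dirDeriv (Complex.I, 0) (fun p => 1 * dirDeriv (Complex.I, 0) Φ p) p +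
      U p * dirDeriv (0, 1) (fun p => weight p * dirDeriv (0, 1) Φ p) p := fun p => by
    rw [mul_left_comm, weight_mul_lap hΦ]; ring
  have hone : ContDiff ℝ 1 (fun _ : ℂ × ℝ => (1 : ℂ)) := contDiff_const
  have c1 : ∀ v {w : ℂ × ℝ → ℂ}, ContDiff ℝ 1 w →
      Continuous (dirDeriv v fun p => w p * dirDeriv v U p) := fun v w hw =>
    (contDiff_dirDeriv (m := 0) (hw.mul (contDiff_dirDeriv hU (by norm_num)))
      (by norm_num)).continuous
  have c2 : ∀ v {w : ℂ × ℝ → ℂ}, ContDiff ℝ 1 w →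
      Continuous (dirDeriv v fun p => w p * dirDeriv v Φ p) := fun v w hw =>
    (contDiff_dirDeriv (m := 0) (hw.mul (contDiff_dirDeriv hΦ (by norm_num)))
      (by norm_num)).continuous
  have i1 : ∀ v {w : ℂ × ℝ → ℂ}, ContDiff ℝ 1 w → Integrable fun p =>
      dirDeriv v (fun p => w p * dirDeriv v U p) p * Φ p := fun v w hw =>
    ((c1 v hw).mul hΦ.continuous).integrable_of_hasCompactSupport
      (hasCompactSupport_dirDeriv (hasCompactSupport_dirDeriv hs).mul_left).mul_right
  have i2 : ∀ v {w : ℂ × ℝ → ℂ}, ContDiff ℝ 1 w → Integrable fun p =>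
      U p * dirDeriv v (fun p => w p * dirDeriv v Φ p) p := fun v w hw =>
    (hU.continuous.mul (c2 v hw)).integrable_of_hasCompactSupport hs.mul_right
  simp only [e1, e2]
  rw [integral_add_add (i1 _ hone) (i1 _ hone) (i1 _ contDiff_weight),
    integral_add_add (i2 _ hone) (i2 _ hone) (i2 _ contDiff_weight),
    integral_dirDeriv_mul _ hU hΦ hone hs,
    integral_dirDeriv_mul _ hU hΦ hone hs, integral_dirDeriv_mul _ hU hΦ contDiff_weight hs]

/-- The hyperbolic cosine of the distance from the base point, in coordinates. -/
def dist₀ (p : ℂ × ℝ) : ℝ :=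
  Real.cosh p.2 + (p.1.re ^ 2 + p.1.im ^ 2) * Real.exp (-p.2) / 2

theorem coshDist_na_eq (p : ℂ × ℝ) : coshDist (n p.1 * a p.2) = dist₀ p := by
  rw [coshDist_na, dist₀, ← Complex.normSq_eq_norm_sq, Complex.normSq_apply]; ring

theorem contDiff_dist₀ {k : WithTop ℕ∞} : ContDiff ℝ k dist₀ := by
  have h1 : ContDiff ℝ k fun p : ℂ × ℝ => p.1.re := Complex.reCLM.contDiff.comp contDiff_fst
  have h2 : ContDiff ℝ k fun p : ℂ × ℝ => p.1.im := Complex.imCLM.contDiff.comp contDiff_fst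
  exact contDiff_snd.cosh.add ((((h1.pow 2).add (h2.pow 2)).mul contDiff_snd.neg.exp).div_const 2)

theorem dirDeriv_comp_dist₀ {η η₁ : ℝ → ℂ} (h : ∀ v, HasDerivAt η (η₁ v) v) {v p : ℂ × ℝ} {d : ℝ}
    (hd : HasDerivAt (fun s : ℝ => dist₀ (p + s • v)) d 0) :
    dirDeriv v (fun p => η (dist₀ p)) p = d * η₁ (dist₀ p) := by
  refine dirDeriv_eq ?_ ?_
  · have h1 : Differentiable ℝ η := fun v => (h v).differentiableAt
    exact (h1.comp (contDiff_dist₀ (k := 1).differentiable (by norm_num))).differentiableAt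
  · have h1 : HasDerivAt η (η₁ (dist₀ p)) (dist₀ (p + (0 : ℝ) • v)) := by simpa using h (dist₀ p)
    have := h1.scomp (0 : ℝ) hd
    rwa [Complex.real_smul] at this

theorem dirDeriv_mul_comp_dist₀ {η η₁ : ℝ → ℂ} (hη : ∀ v, HasDerivAt η (η₁ v) v) {v p : ℂ × ℝ}
    {d : ℝ} (hd : HasDerivAt (fun s : ℝ => dist₀ (p + s • v)) d 0) {δ : ℂ × ℝ → ℝ} {d' : ℝ}
    (hδ : ContDiff ℝ 1 δ) (hδ' : HasDerivAt (fun s : ℝ => δ (p + s • v)) d' 0) :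
    dirDeriv v (fun p => δ p * η (dist₀ p)) p = d' * η (dist₀ p) + δ p * (d * η₁ (dist₀ p)) := by
  have h1 : Differentiable ℝ η := fun v => (hη v).differentiableAt
  have h2 : Differentiable ℝ fun p => η (dist₀ p) :=
    h1.comp (contDiff_dist₀ (k := 1).differentiable (by norm_num))
  have h3 : Differentiable ℝ fun p => (δ p : ℂ) :=
    (Complex.ofRealCLM.contDiff.comp hδ).differentiable (by norm_num)
  refine dirDeriv_eq (h3.mul h2).differentiableAt ?_
  have e1 := hδ'.ofReal_comp.mul (hasDerivAt_dirDeriv (v := v) (h2.differentiableAt (x := p)))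
  rw [dirDeriv_comp_dist₀ hη hd] at e1
  exact e1.congr_deriv (by simp)

theorem hasDerivAt_dist₀_re (p : ℂ × ℝ) :
    HasDerivAt (fun s : ℝ => dist₀ (p + s • ((1, 0) : ℂ × ℝ))) (p.1.re * Real.exp (-p.2)) 0 := by
  have h1 : HasDerivAt (fun s : ℝ => Real.cosh p.2 + ((p.1.re + s) ^ 2 + p.1.im ^ 2) *
      Real.exp (-p.2) / 2) (((2 : ℕ) * (p.1.re + 0) ^ (2 - 1) * 1) * Real.exp (-p.2) / 2) 0 :=
    ((((((hasDerivAt_id (0 : ℝ)).const_add p.1.re).pow 2).add_const _).mul_const _).div_const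
      2).const_add _
  convert! h1 using 1
  · funext s; simp [dist₀]
  · simp; ring

theorem hasDerivAt_dist₀_im (p : ℂ × ℝ) :
    HasDerivAt (fun s : ℝ => dist₀ (p + s • ((Complex.I, 0) : ℂ × ℝ)))
      (p.1.im * Real.exp (-p.2)) 0 := by
  have h1 : HasDerivAt (fun s : ℝ => Real.cosh p.2 + (p.1.re ^ 2 + (p.1.im + s) ^ 2) *
      Real.exp (-p.2) / 2) (((2 : ℕ) * (p.1.im + 0) ^ (2 - 1) * 1) * Real.exp (-p.2) / 2) 0 :=
    ((((((hasDerivAt_id (0 : ℝ)).const_add p.1.im).pow 2).const_add _).mul_const _).div_const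
      2).const_add _
  convert! h1 using 1
  · funext s; simp [dist₀]
  · simp; ring

theorem hasDerivAt_dist₀_t (p : ℂ × ℝ) :
    HasDerivAt (fun s : ℝ => dist₀ (p + s • ((0, 1) : ℂ × ℝ)))
      (Real.sinh p.2 - (p.1.re ^ 2 + p.1.im ^ 2) * Real.exp (-p.2) / 2) 0 := by
  have h1 : HasDerivAt (fun s : ℝ => Real.cosh (p.2 + s) + (p.1.re ^ 2 + p.1.im ^ 2) *
      Real.exp (-(p.2 + s)) / 2) (Real.sinh (p.2 + 0) * 1 + (p.1.re ^ 2 + p.1.im ^ 2) *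
      (Real.exp (-(p.2 + 0)) * (-1)) / 2) 0 :=
    ((hasDerivAt_id (0 : ℝ)).const_add p.2).cosh.add
      (((((hasDerivAt_id (0 : ℝ)).const_add p.2).neg.exp).const_mul _).div_const 2)
  convert! h1 using 1
  · funext s; simp [dist₀]
  · simp; ring

/-- The Laplace operator on radial functions. -/
theorem lap_comp_dist₀ {η η₁ η₂ : ℝ → ℂ} (h : ∀ v, HasDerivAt η (η₁ v) v)
    (h₁ : ∀ v, HasDerivAt η₁ (η₂ v) v) (p : ℂ × ℝ) :
    lap (fun p => η (dist₀ p)) p = ((dist₀ p : ℂ) ^ 2 - 1) * η₂ (dist₀ p) +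
      3 * dist₀ p * η₁ (dist₀ p) := by
  have cre : ContDiff ℝ 1 fun p : ℂ × ℝ => p.1.re := Complex.reCLM.contDiff.comp contDiff_fst
  have cim : ContDiff ℝ 1 fun p : ℂ × ℝ => p.1.im := Complex.imCLM.contDiff.comp contDiff_fst
  have cex : ContDiff ℝ 1 fun p : ℂ × ℝ => Real.exp (-p.2) := contDiff_snd.neg.exp
  have e1 : dirDeriv (1, 0) (fun p => η (dist₀ p)) =
      fun p => ((p.1.re * Real.exp (-p.2) : ℝ) : ℂ) * η₁ (dist₀ p) :=
    funext fun p => dirDeriv_comp_dist₀ h (hasDerivAt_dist₀_re p)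
  have e2 : dirDeriv (Complex.I, 0) (fun p => η (dist₀ p)) =
      fun p => ((p.1.im * Real.exp (-p.2) : ℝ) : ℂ) * η₁ (dist₀ p) :=
    funext fun p => dirDeriv_comp_dist₀ h (hasDerivAt_dist₀_im p)
  have e3 : dirDeriv (0, 1) (fun p => η (dist₀ p)) = fun p =>
      ((Real.sinh p.2 - (p.1.re ^ 2 + p.1.im ^ 2) * Real.exp (-p.2) / 2 : ℝ) : ℂ) *
        η₁ (dist₀ p) :=
    funext fun p => dirDeriv_comp_dist₀ h (hasDerivAt_dist₀_t p)
  have f1 := dirDeriv_mul_comp_dist₀ h₁ (hasDerivAt_dist₀_re p)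
    (δ := fun p => p.1.re * Real.exp (-p.2)) (d' := Real.exp (-p.2)) (cre.mul cex) (by
      have := ((hasDerivAt_id (0 : ℝ)).const_add p.1.re).mul_const (Real.exp (-p.2))
      simpa using this)
  have f2 := dirDeriv_mul_comp_dist₀ h₁ (hasDerivAt_dist₀_im p)
    (δ := fun p => p.1.im * Real.exp (-p.2)) (d' := Real.exp (-p.2)) (cim.mul cex) (by
      have := ((hasDerivAt_id (0 : ℝ)).const_add p.1.im).mul_const (Real.exp (-p.2))
      simpa using this)
  have f3 := dirDeriv_mul_comp_dist₀ h₁ (hasDerivAt_dist₀_t p)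
    (δ := fun p => Real.sinh p.2 - (p.1.re ^ 2 + p.1.im ^ 2) * Real.exp (-p.2) / 2)
    (d' := dist₀ p)
    (contDiff_snd.sinh.sub ((((cre.pow 2).add (cim.pow 2)).mul cex).div_const 2)) (by
      have h1 : HasDerivAt (fun s : ℝ => Real.sinh (p.2 + s) - (p.1.re ^ 2 + p.1.im ^ 2) *
          Real.exp (-(p.2 + s)) / 2) (Real.cosh (p.2 + 0) * 1 - (p.1.re ^ 2 + p.1.im ^ 2) *
          (Real.exp (-(p.2 + 0)) * (-1)) / 2) 0 :=
        ((hasDerivAt_id (0 : ℝ)).const_add p.2).sinh.sub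
          (((((hasDerivAt_id (0 : ℝ)).const_add p.2).neg.exp).const_mul _).div_const 2)
      convert! h1 using 1
      · funext s; simp
      · simp [dist₀]; ring)
  rw [lap, e1, e2, e3, f1, f2, f3]
  simp only
  have g1 : Real.exp (2 * p.2) = Real.exp p.2 ^ 2 := by rw [← Real.exp_nat_mul]; norm_num
  have g2 : Real.exp p.2 * Real.exp (-p.2) = 1 := by rw [← Real.exp_add]; simp
  set X := Real.exp p.2
  set Y := Real.exp (-p.2)
  -- The chain rule gives Δ(η ∘ u) = |∇u|² η'' + (Δu) η' for u = cosh(dist). Here Δu = 3u, and `k3`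
  -- is |∇u|² = u² - 1.
  have k2 : Real.exp (2 * p.2) * (Y + Y) + dist₀ p -
      2 * (Real.sinh p.2 - (p.1.re ^ 2 + p.1.im ^ 2) * Y / 2) = 3 * dist₀ p := by
    rw [dist₀, Real.sinh_eq, Real.cosh_eq, g1]
    linear_combination (2 * X) * g2
  have k3 : Real.exp (2 * p.2) * (p.1.re * Y * (p.1.re * Y) + p.1.im * Y * (p.1.im * Y)) +
      (Real.sinh p.2 - (p.1.re ^ 2 + p.1.im ^ 2) * Y / 2) *
        (Real.sinh p.2 - (p.1.re ^ 2 + p.1.im ^ 2) * Y / 2) = dist₀ p ^ 2 - 1 := by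
    rw [dist₀, Real.sinh_eq, Real.cosh_eq, g1]
    change X ^ 2 * _ + ((X - Y) / 2 - _) * ((X - Y) / 2 - _) = ((X + Y) / 2 + _ * Y / 2) ^ 2 - 1
    linear_combination ((p.1.re ^ 2 + p.1.im ^ 2) * (X * Y + 1) - 1 -
      (p.1.re ^ 2 + p.1.im ^ 2)) * g2
  have k2' := congrArg (fun x : ℝ => (x : ℂ)) k2
  have k3' := congrArg (fun x : ℝ => (x : ℂ)) k3
  push_cast at k2' k3' ⊢
  linear_combination η₁ (dist₀ p) * k2' + η₂ (dist₀ p) * k3'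

end HypThree

namespace HypThree

/-! ### Radial solutions of the inhomogeneous eigenvalue equation -/

open Filter Topology

/-- The radial part of `Δ + (1 + λ²)`, in the variable `u = cosh r`. -/
def radialOp (lam : ℝ) (η η₁ η₂ : ℝ → ℂ) (v : ℝ) : ℂ :=
  ((v : ℂ) ^ 2 - 1) * η₂ v + 3 * v * η₁ v + (1 + (lam : ℂ) ^ 2) * η v

/-- These are sin(λr)/λ and cos(λr), with r and 1 at λ = 0, so that variation of constants needs no
division by λ. -/
theorem exists_sin_cos (lam : ℝ) : ∃ S c : ℝ → ℝ, (∀ r, HasDerivAt S (c r) r) ∧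
    (∀ r, HasDerivAt c (-lam ^ 2 * S r) r) ∧ ∀ r, c r ^ 2 + lam ^ 2 * S r ^ 2 = 1 := by
  rcases eq_or_ne lam 0 with rfl | h
  · refine ⟨id, fun _ => 1, hasDerivAt_id, fun r => ?_, fun r => by simp⟩
    simpa using hasDerivAt_const r (1 : ℝ)
  · refine ⟨fun r => Real.sin (lam * r) / lam, fun r => Real.cos (lam * r), fun r => ?_,
      fun r => ?_, fun r => ?_⟩
    · have := (((hasDerivAt_id r).const_mul lam).sin).div_const lam
      refine this.congr_deriv ?_
      field_simp
      simp
    · have := ((hasDerivAt_id r).const_mul lam).cos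
      refine this.congr_deriv ?_
      field_simp
      simp
    · have := Real.sin_sq_add_cos_sq (lam * r)
      field_simp
      linarith

/-- The solution of `w'' + λ² w = q` that vanishes for large `r`. -/
theorem exists_solution (lam : ℝ) {q : ℝ → ℂ} (hq : Continuous q) {T : ℝ}
    (hT : ∀ r, T ≤ r → q r = 0) : ∃ w w₁ : ℝ → ℂ, (∀ r, HasDerivAt w (w₁ r) r) ∧
      (∀ r, HasDerivAt w₁ (q r - (lam : ℂ) ^ 2 * w r) r) ∧ ∀ r, T ≤ r → w r = 0 := by
  obtain ⟨S, c, hS, hc, hSc⟩ := exists_sin_cos lam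
  have cS : Continuous S := continuous_iff_continuousAt.2 fun r => (hS r).continuousAt
  have cc : Continuous c := continuous_iff_continuousAt.2 fun r => (hc r).continuousAt
  have hA := hasDerivAt_primitive (F := fun r => q r * S r) (by fun_prop) T
  have hB := hasDerivAt_primitive (F := fun r => q r * c r) (by fun_prop) T
  set A := primitive (fun r => q r * S r) T
  set B := primitive (fun r => q r * c r) T
  have hS' : ∀ r, HasDerivAt (fun r => (S r : ℂ)) (c r) r := fun r => (hS r).ofReal_comp
  have hc' : ∀ r, HasDerivAt (fun r => (c r : ℂ)) ((-lam ^ 2 * S r : ℝ) : ℂ) r :=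
    fun r => (hc r).ofReal_comp
  -- Variation of constants with the integrals taken from r to T, which selects the solution that
  -- vanishes beyond T.
  refine ⟨fun r => c r * A r - S r * B r, fun r => -(lam : ℂ) ^ 2 * S r * A r - c r * B r,
    fun r => ?_, fun r => ?_, fun r hr => ?_⟩
  · refine (((hc' r).mul (hA r)).sub ((hS' r).mul (hB r))).congr_deriv ?_
    push_cast
    ring
  · refine ((((hS' r).const_mul (-(lam : ℂ) ^ 2)).mul (hA r)).sub
      ((hc' r).mul (hB r))).congr_deriv ?_
    have h1 := congrArg (fun x : ℝ => (x : ℂ)) (hSc r)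
    push_cast at h1 ⊢
    linear_combination q r * h1
  · have h1 : A r = 0 := primitive_eq_zero (fun x hx => by simp [hT x hx]) hr
    have h2 : B r = 0 := primitive_eq_zero (fun x hx => by simp [hT x hx]) hr
    simp [h1, h2]

theorem hasDerivAt_inv_sqrt {v : ℝ} (hv : 1 < v) :
    HasDerivAt (fun v : ℝ => (√(v ^ 2 - 1))⁻¹) (-v * (√(v ^ 2 - 1))⁻¹ ^ 3) v := by
  have h1 : 0 < v ^ 2 - 1 := by nlinarith
  have h2 : HasDerivAt (fun v : ℝ => v ^ 2 - 1) (2 * v) v := by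
    simpa using (hasDerivAt_pow 2 v).sub_const 1
  have h3 := (h2.sqrt h1.ne').inv (Real.sqrt_pos.2 h1).ne'
  refine h3.congr_deriv ?_
  have := (Real.sqrt_pos.2 h1).ne'
  field_simp

/-- Solutions of the radial inhomogeneous equation away from the base point, with bounds for the
singularity there. -/
theorem exists_radial_solution (lam : ℝ) {F : ℝ → ℂ} (hF : Continuous F) {M : ℝ} (hM : 1 ≤ M)
    (hFM : ∀ v, M ≤ v → F v = 0) : ∃ χ χ₁ χ₂ : ℝ → ℂ,
      (∀ v, 1 < v → HasDerivAt χ (χ₁ v) v) ∧ (∀ v, 1 < v → HasDerivAt χ₁ (χ₂ v) v) ∧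
      (∀ v, 1 < v → ContinuousAt χ₂ v) ∧ (∀ v, 1 < v → radialOp lam χ χ₁ χ₂ v = F v) ∧
      (∀ v, M ≤ v → χ v = 0) ∧ ∃ W : ℝ, 0 ≤ W ∧ ∀ ε : ℝ, 0 < ε → ε ≤ 1 → ∀ v, 1 + ε ^ 2 ≤ v →
        v ≤ 2 → ‖χ v‖ ≤ W / ε ∧ ‖χ₁ v‖ ≤ W / ε ^ 3 := by
  -- In dimension three the substitution χ = w / sinh r turns (Δ + 1 + λ²)χ = F into w'' + λ²w = F
  -- sinh r. Below, σ is 1 / sinh r in the variable v = cosh r.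
  obtain ⟨w, w₁, hw, hw₁, hwT⟩ := exists_solution lam
    (q := fun r => F (Real.cosh r) * Real.sinh r) (by fun_prop) (T := Real.arcosh M) (fun r hr => by
      have h0 : 0 ≤ r := (Real.arcosh_nonneg hM).trans hr
      rw [hFM, zero_mul]
      rw [← Real.cosh_arcosh hM]
      exact Real.cosh_le_cosh.2 (by
        rwa [abs_of_nonneg h0, abs_of_nonneg (Real.arcosh_nonneg hM)]))
  have cw : Continuous w := continuous_iff_continuousAt.2 fun r => (hw r).continuousAt
  have cw₁ : Continuous w₁ := continuous_iff_continuousAt.2 fun r => (hw₁ r).continuousAt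
  set σ : ℝ → ℝ := fun v => (√(v ^ 2 - 1))⁻¹ with hσ
  have hσd : ∀ v, 1 < v → HasDerivAt (fun v => (σ v : ℂ)) ((-v * σ v ^ 3 : ℝ) : ℂ) v :=
    fun v hv => (hasDerivAt_inv_sqrt hv).ofReal_comp
  have hr : ∀ v, 1 < v → HasDerivAt Real.arcosh (σ v) v := fun v hv => Real.hasDerivAt_arcosh hv
  have hwr : ∀ v, 1 < v → HasDerivAt (fun v => w (Real.arcosh v)) (σ v * w₁ (Real.arcosh v)) v :=
    fun v hv => by
      have := (hw (Real.arcosh v)).scomp v (hr v hv)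
      rwa [Complex.real_smul] at this
  have hq : ∀ v, 1 < v → σ v * (F (Real.cosh (Real.arcosh v)) * Real.sinh (Real.arcosh v)) =
      F v := fun v hv => by
    have h1 : 0 < v ^ 2 - 1 := by nlinarith
    rw [Real.cosh_arcosh hv.le, Real.sinh_arcosh hv.le, hσ]
    have h2 : ((√(v ^ 2 - 1) : ℝ) : ℂ) ≠ 0 := Complex.ofReal_ne_zero.2 (Real.sqrt_pos.2 h1).ne'
    push_cast
    field_simp
  have hwr₁ : ∀ v, 1 < v → HasDerivAt (fun v => w₁ (Real.arcosh v))
      (F v - σ v * (lam : ℂ) ^ 2 * w (Real.arcosh v)) v := fun v hv => by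
    have := (hw₁ (Real.arcosh v)).scomp v (hr v hv)
    rw [Complex.real_smul, mul_sub, hq v hv] at this
    exact this.congr_deriv (by ring)
  have hσ2 : ∀ v : ℝ, 1 < v → ((v : ℂ) ^ 2 - 1) * (σ v : ℂ) ^ 2 = 1 := fun v hv => by
    have h1 : 0 < v ^ 2 - 1 := by nlinarith
    have h2 : (v ^ 2 - 1) * σ v ^ 2 = 1 := by
      simp only [hσ]
      rw [inv_pow, Real.sq_sqrt h1.le, mul_inv_cancel₀ h1.ne']
    have := congrArg (fun x : ℝ => (x : ℂ)) h2
    push_cast at this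
    exact this
  refine ⟨fun v => σ v * w (Real.arcosh v), fun v => (σ v : ℂ) ^ 2 * w₁ (Real.arcosh v) -
      v * (σ v : ℂ) ^ 3 * w (Real.arcosh v), fun v =>
      (-3 * v * (σ v : ℂ) ^ 4) * w₁ (Real.arcosh v) + (σ v : ℂ) ^ 2 * (F v - σ v * (lam : ℂ) ^ 2 *
        w (Real.arcosh v)) - ((σ v : ℂ) ^ 3 - 3 * v ^ 2 * (σ v : ℂ) ^ 5) * w (Real.arcosh v),
    fun v hv => ?_, fun v hv => ?_, fun v hv => ?_, fun v hv => ?_, fun v hv => ?_, ?_⟩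
  · refine ((hσd v hv).mul (hwr v hv)).congr_deriv ?_
    push_cast
    ring
  · refine ((((hσd v hv).pow 2).mul (hwr₁ v hv)).sub (((hasDerivAt_id v).ofReal_comp.mul
      ((hσd v hv).pow 3)).mul (hwr v hv))).congr_deriv ?_
    simp
    ring
  · have h1 := (hσd v hv).continuousAt
    have h2 := (hwr v hv).continuousAt
    have h3 := (hwr₁ v hv).continuousAt
    have h4 : ContinuousAt Real.arcosh v := (hr v hv).continuousAt
    fun_prop
  · simp only [radialOp]
    linear_combination (F v - σ v * (lam : ℂ) ^ 2 * w (Real.arcosh v) -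
      3 * v * (σ v : ℂ) ^ 2 * w₁ (Real.arcosh v) - σ v * w (Real.arcosh v) +
      3 * v ^ 2 * (σ v : ℂ) ^ 3 * w (Real.arcosh v)) * hσ2 v hv
  · simp only
    rw [hwT _ ((Real.arcosh_le_arcosh (zero_lt_one.trans_le hM)
      (zero_lt_one.trans_le (hM.trans hv))).2 hv), mul_zero]
  · obtain ⟨W₀, hW₀⟩ := (isCompact_Icc (a := 0) (b := Real.arcosh 2)).exists_bound_of_continuousOn
      cw.continuousOn
    obtain ⟨W₁, hW₁⟩ := (isCompact_Icc (a := 0) (b := Real.arcosh 2)).exists_bound_of_continuousOn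
      cw₁.continuousOn
    have h0 : (0 : ℝ) ∈ Set.Icc 0 (Real.arcosh 2) := ⟨le_rfl, Real.arcosh_nonneg (by norm_num)⟩
    have hW₀0 := (norm_nonneg _).trans (hW₀ 0 h0)
    have hW₁0 := (norm_nonneg _).trans (hW₁ 0 h0)
    refine ⟨2 * W₀ + W₁, by positivity, fun ε hε hε1 v hv hv2 => ?_⟩
    have hv1 : 1 < v := by nlinarith
    have hmem : Real.arcosh v ∈ Set.Icc 0 (Real.arcosh 2) := ⟨Real.arcosh_nonneg hv1.le,
      (Real.arcosh_le_arcosh (by linarith) (by norm_num)).2 hv2⟩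
    -- From v ≥ 1 + ε² one gets v² - 1 ≥ ε², so σ ≤ 1/ε. There is one factor σ in χ and at most
    -- three in χ₁, whence the two exponents.
    have hs : ε ≤ √(v ^ 2 - 1) := Real.le_sqrt_of_sq_le (by nlinarith)
    have hσ0 : 0 ≤ σ v := by positivity
    have hσε : σ v ≤ ε⁻¹ := inv_anti₀ hε hs
    have n1 : ‖(σ v : ℂ)‖ = σ v := by rw [Complex.norm_real, Real.norm_of_nonneg hσ0]
    have n2 : ‖(v : ℂ)‖ = v := by rw [Complex.norm_real, Real.norm_of_nonneg (by linarith)]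
    have b0 := hW₀ _ hmem
    have b1 := hW₁ _ hmem
    have he1 : 1 ≤ ε⁻¹ := (one_le_inv₀ hε).2 hε1
    constructor
    · rw [norm_mul, n1, div_eq_mul_inv, mul_comm]
      have : W₀ ≤ 2 * W₀ + W₁ := by linarith
      exact mul_le_mul (b0.trans this) hσε hσ0 (by positivity)
    · refine (norm_sub_le _ _).trans ?_
      rw [norm_mul, norm_mul, norm_mul, norm_pow, norm_pow, n1, n2, div_eq_mul_inv, ← inv_pow]
      have c1 : σ v ^ 2 * ‖w₁ (Real.arcosh v)‖ ≤ ε⁻¹ ^ 3 * W₁ := by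
        refine mul_le_mul ?_ b1 (norm_nonneg _) (by positivity)
        calc σ v ^ 2 ≤ ε⁻¹ ^ 2 := by gcongr
          _ ≤ ε⁻¹ ^ 3 := pow_le_pow_right₀ he1 (by norm_num)
      have c2 : v * σ v ^ 3 * ‖w (Real.arcosh v)‖ ≤ 2 * ε⁻¹ ^ 3 * W₀ := by
        refine mul_le_mul ?_ b0 (norm_nonneg _) (by positivity)
        gcongr
      linarith

/-- A smooth cut-off function with bounded derivatives. -/
theorem exists_cutoff : ∃ θ θ₁ θ₂ : ℝ → ℝ, ∃ B : ℝ, (∀ x, HasDerivAt θ (θ₁ x) x) ∧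
    (∀ x, HasDerivAt θ₁ (θ₂ x) x) ∧ Continuous θ₂ ∧ (∀ x ≤ 1, θ x = 0 ∧ θ₁ x = 0 ∧ θ₂ x = 0) ∧
    (∀ x, 2 ≤ x → θ x = 1 ∧ θ₁ x = 0 ∧ θ₂ x = 0) ∧
    ∀ x, |θ x| ≤ 1 ∧ |θ₁ x| ≤ B ∧ |θ₂ x| ≤ B := by
  set θ : ℝ → ℝ := fun x => Real.smoothTransition (x - 1) with hθ
  have h0 : ContDiff ℝ 2 θ := Real.smoothTransition.contDiff.comp (contDiff_id.sub contDiff_const)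
  have h1 : ContDiff ℝ 1 (deriv θ) := by
    have : ContDiff ℝ (1 + 1) θ := by simpa [one_add_one_eq_two] using h0
    exact (contDiff_succ_iff_deriv.1 this).2.2
  have h2 : Continuous (deriv (deriv θ)) := h1.continuous_deriv le_rfl
  have d0 : ∀ x, HasDerivAt θ (deriv θ x) x := fun x =>
    (h0.differentiable (by norm_num)).differentiableAt.hasDerivAt
  have d1 : ∀ x, HasDerivAt (deriv θ) (deriv (deriv θ) x) x := fun x =>
    (h1.differentiable (by norm_num)).differentiableAt.hasDerivAt
  have z0 : ∀ x ≤ 1, θ x = 0 := fun x hx => Real.smoothTransition.zero_of_nonpos (by linarith)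
  have o0 : ∀ x, 2 ≤ x → θ x = 1 := fun x hx => Real.smoothTransition.one_of_one_le (by linarith)
  have z1 : Set.EqOn (deriv θ) 0 (Set.Iic 1) := by
    rw [← closure_Iio]
    refine Set.EqOn.closure (fun x hx => ?_) h1.continuous continuous_zero
    have : θ =ᶠ[𝓝 x] fun _ => 0 := by
      filter_upwards [Iio_mem_nhds hx] with y hy using z0 y (le_of_lt hy)
    rw [this.deriv_eq]; simp
  have o1 : Set.EqOn (deriv θ) 0 (Set.Ici 2) := by
    rw [← closure_Ioi]
    refine Set.EqOn.closure (fun x hx => ?_) h1.continuous continuous_zero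
    have : θ =ᶠ[𝓝 x] fun _ => 1 := by
      filter_upwards [Ioi_mem_nhds hx] with y hy using o0 y (le_of_lt hy)
    rw [this.deriv_eq]; simp
  have z2 : Set.EqOn (deriv (deriv θ)) 0 (Set.Iic 1) := by
    rw [← closure_Iio]
    refine Set.EqOn.closure (fun x hx => ?_) h2 continuous_zero
    have : deriv θ =ᶠ[𝓝 x] fun _ => 0 := by
      filter_upwards [Iio_mem_nhds hx] with y hy using z1 (Set.mem_Iic.2 (le_of_lt hy))
    rw [this.deriv_eq]; simp
  have o2 : Set.EqOn (deriv (deriv θ)) 0 (Set.Ici 2) := by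
    rw [← closure_Ioi]
    refine Set.EqOn.closure (fun x hx => ?_) h2 continuous_zero
    have : deriv θ =ᶠ[𝓝 x] fun _ => 0 := by
      filter_upwards [Ioi_mem_nhds hx] with y hy using o1 (Set.mem_Ici.2 (le_of_lt hy))
    rw [this.deriv_eq]; simp
  obtain ⟨B₁, hB₁⟩ := (isCompact_Icc (a := (1 : ℝ)) (b := 2)).exists_bound_of_continuousOn
    h1.continuous.continuousOn
  obtain ⟨B₂, hB₂⟩ := (isCompact_Icc (a := (1 : ℝ)) (b := 2)).exists_bound_of_continuousOn
    h2.continuousOn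
  have b1 := (norm_nonneg _).trans (hB₁ 1 ⟨le_rfl, by norm_num⟩)
  refine ⟨θ, deriv θ, deriv (deriv θ), max B₁ B₂, d0, d1, h2, fun x hx => ⟨z0 x hx, z1 hx, z2 hx⟩,
    fun x hx => ⟨o0 x hx, o1 hx, o2 hx⟩, fun x => ⟨?_, ?_, ?_⟩⟩
  · rw [abs_of_nonneg (Real.smoothTransition.nonneg _)]
    exact Real.smoothTransition.le_one _
  · rcases le_total x 1 with h | h
    · rw [z1 h]; simpa using Or.inl b1
    rcases le_total x 2 with h' | h'
    · exact (hB₁ x ⟨h, h'⟩).trans (le_max_left _ _)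
    · rw [o1 h']; simpa using Or.inl b1
  · rcases le_total x 1 with h | h
    · rw [z2 h]; simpa using Or.inl b1
    rcases le_total x 2 with h' | h'
    · exact (hB₂ x ⟨h, h'⟩).trans (le_max_right _ _)
    · rw [o2 h']; simpa using Or.inl b1

/-- Approximate solutions of the inhomogeneous eigenvalue equation by smooth radial functions. -/
theorem exists_approx_solution (lam : ℝ) {F : ℝ → ℂ} (hF : Continuous F) {M : ℝ} (hM : 1 ≤ M)
    (hFM : ∀ v, M ≤ v → F v = 0) : ∃ C : ℝ, 0 ≤ C ∧ ∀ ε : ℝ, 0 < ε → ε ≤ 1 / 2 →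
      ∃ η η₁ η₂ : ℝ → ℂ, (∀ v, HasDerivAt η (η₁ v) v) ∧ (∀ v, HasDerivAt η₁ (η₂ v) v) ∧
        Continuous η₂ ∧ (∀ v, M ≤ v → η v = 0) ∧
        (∀ v, 1 + 2 * ε ^ 2 ≤ v → radialOp lam η η₁ η₂ v = F v) ∧
        ∀ v, 1 ≤ v → v ≤ 1 + 2 * ε ^ 2 → ‖F v - radialOp lam η η₁ η₂ v‖ ≤ C / ε ^ 3 := by
  obtain ⟨χ, χ₁, χ₂, hχ, hχ₁, hχ₂, hop, hχM, W, hW0, hW⟩ := exists_radial_solution lam hF hM hFM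
  obtain ⟨θ, θ₁, θ₂, B, hθ, hθ₁, hθ₂, hz, ho, hB⟩ := exists_cutoff
  obtain ⟨F₀, hF₀⟩ := (isCompact_Icc (a := (1 : ℝ)) (b := 2)).exists_bound_of_continuousOn
    hF.continuousOn
  have hF₀0 := (norm_nonneg _).trans (hF₀ 1 ⟨le_rfl, by norm_num⟩)
  have hB0 : 0 ≤ B := (abs_nonneg _).trans (hB 0).2.1
  -- The term 2F₀ bounds (1 - θ)F, and 24 = 6 + 12 + 6 collects the three terms in which a
  -- derivative falls on the cut-off.
  refine ⟨2 * F₀ + 24 * (W * B), by positivity, fun ε hε hε2 => ?_⟩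
  -- Near the base point v - 1 is about r²/2, so cutting off at scale ε² in v is cutting off at
  -- distance of order ε.
  set δ : ℝ := ε ^ 2 with hδ
  have hδ0 : 0 < δ := by positivity
  set ℓ : ℝ → ℝ := fun v => (v - 1) / δ with hℓ
  have hℓd : ∀ v, HasDerivAt ℓ δ⁻¹ v := fun v => by
    simpa [one_div] using ((hasDerivAt_id v).sub_const 1).div_const δ
  have d0 : ∀ v, HasDerivAt (fun v => (θ (ℓ v) : ℂ)) ((θ₁ (ℓ v) * δ⁻¹ : ℝ) : ℂ) v := fun v =>
    ((hθ (ℓ v)).comp v (hℓd v)).ofReal_comp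
  have d1 : ∀ v, HasDerivAt (fun v => (θ₁ (ℓ v) : ℂ)) ((θ₂ (ℓ v) * δ⁻¹ : ℝ) : ℂ) v := fun v =>
    ((hθ₁ (ℓ v)).comp v (hℓd v)).ofReal_comp
  set η : ℝ → ℂ := fun v => θ (ℓ v) * χ v with hη
  set η₁ : ℝ → ℂ := fun v => ((δ⁻¹ : ℝ) : ℂ) * θ₁ (ℓ v) * χ v + θ (ℓ v) * χ₁ v with hη₁
  set η₂ : ℝ → ℂ := fun v => ((δ⁻¹ : ℝ) : ℂ) ^ 2 * θ₂ (ℓ v) * χ v +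
    2 * ((δ⁻¹ : ℝ) : ℂ) * θ₁ (ℓ v) * χ₁ v + θ (ℓ v) * χ₂ v with hη₂
  have hlow : ∀ v, v ≤ 1 + δ → η v = 0 ∧ η₁ v = 0 ∧ η₂ v = 0 := fun v hv => by
    have h1 : ℓ v ≤ 1 := by
      rw [hℓ]; simp only; rw [div_le_one hδ0]; linarith
    obtain ⟨a0, a1, a2⟩ := hz _ h1
    simp [hη, hη₁, hη₂, a0, a1, a2]
  have hev : ∀ v, v ≤ 1 → ∀ᶠ x in 𝓝 v, η x = 0 ∧ η₁ x = 0 ∧ η₂ x = 0 := fun v hv => by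
    filter_upwards [Iio_mem_nhds (show v < 1 + δ by linarith)] with x hx using hlow x (le_of_lt hx)
  have hmain : ∀ v, 1 < v → radialOp lam η η₁ η₂ v = θ (ℓ v) * F v + (((v : ℂ) ^ 2 - 1) *
      (((δ⁻¹ : ℝ) : ℂ) ^ 2 * θ₂ (ℓ v) * χ v + 2 * ((δ⁻¹ : ℝ) : ℂ) * θ₁ (ℓ v) * χ₁ v) +
        3 * v * (((δ⁻¹ : ℝ) : ℂ) * θ₁ (ℓ v) * χ v)) := fun v hv => by
    rw [← hop v hv]
    simp only [radialOp, hη, hη₁, hη₂]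
    ring
  refine ⟨η, η₁, η₂, fun v => ?_, fun v => ?_, ?_, fun v hv => by simp [hη, hχM v hv],
    fun v hv => ?_, fun v hv hv2 => ?_⟩
  · rcases lt_or_ge 1 v with hv | hv
    · refine ((d0 v).mul (hχ v hv)).congr_deriv ?_
      push_cast
      simp only [hη₁]
      push_cast
      ring
    · rw [(hev v hv).self_of_nhds.2.1]
      exact (hasDerivAt_const v (0 : ℂ)).congr_of_eventuallyEq ((hev v hv).mono fun x hx => hx.1)
  · rcases lt_or_ge 1 v with hv | hv
    · refine ((((d1 v).const_mul ((δ⁻¹ : ℝ) : ℂ)).mul (hχ v hv)).add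
        ((d0 v).mul (hχ₁ v hv))).congr_deriv ?_
      simp only [hη₂]
      push_cast
      ring
    · rw [(hev v hv).self_of_nhds.2.2]
      exact (hasDerivAt_const v (0 : ℂ)).congr_of_eventuallyEq ((hev v hv).mono fun x hx => hx.2.1)
  · refine continuous_iff_continuousAt.2 fun v => ?_
    rcases lt_or_ge 1 v with hv | hv
    · have c1 := (hχ v hv).continuousAt
      have c2 := (hχ₁ v hv).continuousAt
      have c3 := hχ₂ v hv
      have c4 := (d0 v).continuousAt
      have c5 := (d1 v).continuousAt
      have c6 : ContinuousAt (fun v => (θ₂ (ℓ v) : ℂ)) v :=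
        (Complex.continuous_ofReal.comp (hθ₂.comp
          (continuous_iff_continuousAt.2 fun v => (hℓd v).continuousAt))).continuousAt
      fun_prop
    · exact continuousAt_const.congr ((hev v hv).mono fun x hx => hx.2.2.symm)
  · have h1 : 2 ≤ ℓ v := by rw [hℓ]; simp only; rw [le_div_iff₀ hδ0]; linarith
    obtain ⟨a0, a1, a2⟩ := ho _ h1
    rw [hmain v (by linarith), a0, a1, a2]
    simp
  · have he3 : (1 : ℝ) ≤ 1 / ε ^ 3 := by
      rw [le_div_iff₀ (by positivity), one_mul]
      exact pow_le_one₀ hε.le (by linarith)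
    have hδ2 : 2 * δ ≤ 1 := by rw [hδ]; nlinarith
    have hFv : ‖F v‖ ≤ F₀ := hF₀ v ⟨hv, by linarith⟩
    have hWB : 0 ≤ W * B := by positivity
    rcases le_total v (1 + δ) with hv' | hv'
    · obtain ⟨a0, a1, a2⟩ := hlow v hv'
      rw [radialOp, a0, a1, a2]
      simp only [mul_zero, add_zero, sub_zero]
      rw [div_eq_mul_one_div]
      nlinarith
    · obtain ⟨x0, x1⟩ := hW ε hε (by linarith) v hv' (by linarith)
      obtain ⟨t0, t1, t2⟩ := hB (ℓ v)
      rw [hmain v (by linarith)]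
      have hδi : ‖((δ⁻¹ : ℝ) : ℂ)‖ = δ⁻¹ := by
        rw [Complex.norm_real, Real.norm_of_nonneg (by positivity)]
      -- The factor v² - 1 of the second-order term degenerates at the base point and cancels one
      -- δ⁻¹. This brings every cut-off term down to order ε⁻³.
      have nv : ‖(v : ℂ) ^ 2 - 1‖ ≤ 6 * δ := by
        rw [← Complex.ofReal_pow, ← Complex.ofReal_one, ← Complex.ofReal_sub, Complex.norm_real,
          Real.norm_of_nonneg (by nlinarith)]
        nlinarith
      have nv3 : ‖(3 * v : ℂ)‖ ≤ 6 := by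
        rw [norm_mul, Complex.norm_real, Real.norm_of_nonneg (by linarith)]
        simp; linarith
      have nt : ∀ x : ℝ, ‖(x : ℂ)‖ = |x| := fun x => by rw [Complex.norm_real, Real.norm_eq_abs]
      have y0 : ‖F v - θ (ℓ v) * F v‖ ≤ 2 * F₀ := by
        refine (norm_sub_le _ _).trans ?_
        rw [norm_mul, nt]
        nlinarith [norm_nonneg (F v)]
      have y1 : ‖((v : ℂ) ^ 2 - 1) * (((δ⁻¹ : ℝ) : ℂ) ^ 2 * θ₂ (ℓ v) * χ v)‖ ≤
          6 * (W * B) / ε ^ 3 := by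
        rw [norm_mul, norm_mul, norm_mul, norm_pow, hδi, nt]
        calc _ ≤ 6 * δ * (δ⁻¹ ^ 2 * B * (W / ε)) := by gcongr
          _ = 6 * (W * B) / ε ^ 3 := by rw [hδ]; field_simp
      have y2 : ‖((v : ℂ) ^ 2 - 1) * (2 * ((δ⁻¹ : ℝ) : ℂ) * θ₁ (ℓ v) * χ₁ v)‖ ≤
          12 * (W * B) / ε ^ 3 := by
        rw [norm_mul, norm_mul, norm_mul, norm_mul, hδi, nt, Complex.norm_two]
        calc _ ≤ 6 * δ * (2 * δ⁻¹ * B * (W / ε ^ 3)) := by gcongr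
          _ = 12 * (W * B) / ε ^ 3 := by rw [hδ]; field_simp; ring
      have y3 : ‖(3 * v : ℂ) * (((δ⁻¹ : ℝ) : ℂ) * θ₁ (ℓ v) * χ v)‖ ≤ 6 * (W * B) / ε ^ 3 := by
        rw [norm_mul (3 * v : ℂ), norm_mul _ (χ v), norm_mul ((δ⁻¹ : ℝ) : ℂ), hδi, nt (θ₁ _)]
        calc _ ≤ 6 * (δ⁻¹ * B * (W / ε)) := by gcongr
          _ = 6 * (W * B) / ε ^ 3 := by rw [hδ]; field_simp
      have e : F v - (θ (ℓ v) * F v + (((v : ℂ) ^ 2 - 1) *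
          (((δ⁻¹ : ℝ) : ℂ) ^ 2 * θ₂ (ℓ v) * χ v + 2 * ((δ⁻¹ : ℝ) : ℂ) * θ₁ (ℓ v) * χ₁ v) +
            3 * v * (((δ⁻¹ : ℝ) : ℂ) * θ₁ (ℓ v) * χ v))) = (F v - θ (ℓ v) * F v) -
          ((v : ℂ) ^ 2 - 1) * (((δ⁻¹ : ℝ) : ℂ) ^ 2 * θ₂ (ℓ v) * χ v) -
          ((v : ℂ) ^ 2 - 1) * (2 * ((δ⁻¹ : ℝ) : ℂ) * θ₁ (ℓ v) * χ₁ v) -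
          (3 * v : ℂ) * (((δ⁻¹ : ℝ) : ℂ) * θ₁ (ℓ v) * χ v) := by ring
      rw [e]
      have y4 := norm_sub_le ((F v - θ (ℓ v) * F v) -
          ((v : ℂ) ^ 2 - 1) * (((δ⁻¹ : ℝ) : ℂ) ^ 2 * θ₂ (ℓ v) * χ v) -
          ((v : ℂ) ^ 2 - 1) * (2 * ((δ⁻¹ : ℝ) : ℂ) * θ₁ (ℓ v) * χ₁ v))
          ((3 * v : ℂ) * (((δ⁻¹ : ℝ) : ℂ) * θ₁ (ℓ v) * χ v))
      have y5 := norm_sub_le ((F v - θ (ℓ v) * F v) -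
          ((v : ℂ) ^ 2 - 1) * (((δ⁻¹ : ℝ) : ℂ) ^ 2 * θ₂ (ℓ v) * χ v))
          (((v : ℂ) ^ 2 - 1) * (2 * ((δ⁻¹ : ℝ) : ℂ) * θ₁ (ℓ v) * χ₁ v))
      have y6 := norm_sub_le (F v - θ (ℓ v) * F v)
          (((v : ℂ) ^ 2 - 1) * (((δ⁻¹ : ℝ) : ℂ) ^ 2 * θ₂ (ℓ v) * χ v))
      have y7 : 2 * F₀ ≤ 2 * F₀ / ε ^ 3 := by
        rw [div_eq_mul_one_div]; nlinarith
      have y8 : (2 * F₀ + 24 * (W * B)) / ε ^ 3 = 2 * F₀ / ε ^ 3 + 6 * (W * B) / ε ^ 3 +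
        12 * (W * B) / ε ^ 3 + 6 * (W * B) / ε ^ 3 := by ring
      rw [y8]
      linarith

end HypThree

namespace HypThree

/-! ### Invariant integral operators and eigenfunctions of the Laplace operator -/

open Filter Topology

/-- The excess of cosh(dist) over 1 controls both t²/2 and |z|² e^{-t}/2. The coordinate ball is
needed only up to a constant, and 6 is not sharp. -/
theorem norm_le_of_dist₀_le {ε : ℝ} (hε : 0 < ε) (hε2 : ε ≤ 1 / 2) {p : ℂ × ℝ}
    (hp : dist₀ p ≤ 1 + 2 * ε ^ 2) : ‖p‖ ≤ 6 * ε := by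
  have h1 : 0 ≤ (p.1.re ^ 2 + p.1.im ^ 2) * Real.exp (-p.2) / 2 := by positivity
  have h2 := Real.one_le_cosh p.2
  have h3 : 1 + p.2 ^ 2 / 2 ≤ Real.cosh p.2 := by
    have e1 : Real.cosh p.2 = 1 + 2 * Real.sinh (p.2 / 2) ^ 2 := by
      have e2 := Real.cosh_two_mul (p.2 / 2)
      rw [Real.cosh_sq, mul_div_cancel₀ _ (two_ne_zero' ℝ)] at e2
      linarith
    have e3 : (p.2 / 2) ^ 2 ≤ Real.sinh (p.2 / 2) ^ 2 := by
      rw [← sq_abs, ← sq_abs (Real.sinh _), Real.abs_sinh]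
      exact pow_le_pow_left₀ (abs_nonneg _) (Real.self_le_sinh_iff.2 (abs_nonneg _)) 2
    linarith
  rw [dist₀] at hp
  have h4 : |p.2| ≤ 2 * ε := abs_le_of_sq_le_sq (by nlinarith) (by positivity)
  have h5 : (3 : ℝ)⁻¹ ≤ Real.exp (-p.2) := by
    have h6 : Real.exp p.2 ≤ 3 := (Real.exp_le_exp.2 (show p.2 ≤ 1 by
      linarith [le_abs_self p.2])).trans Real.exp_one_lt_three.le
    rw [Real.exp_neg]
    exact inv_anti₀ (Real.exp_pos _) h6
  have h7 : ‖p.1‖ ^ 2 ≤ 12 * ε ^ 2 := by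
    rw [← Complex.normSq_eq_norm_sq, Complex.normSq_apply]
    nlinarith [sq_nonneg p.1.re, sq_nonneg p.1.im]
  rw [Prod.norm_def]
  refine max_le (abs_le_of_sq_le_sq' (by nlinarith) (by positivity)).2 ?_
  rw [Real.norm_eq_abs]; linarith

theorem hasCompactSupport_comp_dist₀ {η : ℝ → ℂ} {M : ℝ} (h : ∀ v, M ≤ v → η v = 0) :
    HasCompactSupport fun p => η (dist₀ p) := by
  have h1 : IsCompact ((fun p : ℂ × ℝ => n p.1 * a p.2) ⁻¹' {g : G₀ | coshDist g ≤ M}) :=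
    isClosedEmbedding_na.isCompact_preimage (isCompact_coshDist_le M)
  refine HasCompactSupport.intro h1 fun p hp => h _ ?_
  rw [← coshDist_na_eq]
  exact (not_le.1 hp).le

/-- Green's formula moves Δ + 1 + λ² from the compactly supported radial function to Φ, which it
annihilates. -/
theorem integral_radialOp_mul_eq_zero (lam : ℝ) {η η₁ η₂ : ℝ → ℂ} (h : ∀ v, HasDerivAt η (η₁ v) v)
    (h₁ : ∀ v, HasDerivAt η₁ (η₂ v) v) (h₂ : Continuous η₂) {M : ℝ} (hM : ∀ v, M ≤ v → η v = 0)
    {Φ : ℂ × ℝ → ℂ} (hΦ : ContDiff ℝ 2 Φ)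
    (he : ∀ p, lap Φ p + (1 + (lam : ℂ) ^ 2) * Φ p = 0) :
    ∫ p, weight p * (radialOp lam η η₁ η₂ (dist₀ p) * Φ p) = 0 := by
  have cη : ContDiff ℝ 2 η := by
    have e1 : deriv η = η₁ := funext fun v => (h v).deriv
    have e2 : deriv η₁ = η₂ := funext fun v => (h₁ v).deriv
    have c1 : ContDiff ℝ 1 η₁ := contDiff_one_iff_deriv.2
      ⟨fun v => (h₁ v).differentiableAt, by rwa [e2]⟩
    have : ContDiff ℝ (1 + 1) η := contDiff_succ_iff_deriv.2
      ⟨fun v => (h v).differentiableAt, by simp, by rwa [e1]⟩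
    simpa [one_add_one_eq_two] using this
  set U : ℂ × ℝ → ℂ := fun p => η (dist₀ p) with hUdef
  have hU : ContDiff ℝ 2 U := cη.comp contDiff_dist₀
  have hs : HasCompactSupport U := hasCompactSupport_comp_dist₀ hM
  have hlap : ∀ p, lap U p = ((dist₀ p : ℂ) ^ 2 - 1) * η₂ (dist₀ p) +
      3 * dist₀ p * η₁ (dist₀ p) := fun p => lap_comp_dist₀ h h₁ p
  have hlapU : HasCompactSupport (lap U) := by
    unfold lap
    exact ((((hasCompactSupport_dirDeriv (hasCompactSupport_dirDeriv hs)).add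
      (hasCompactSupport_dirDeriv (hasCompactSupport_dirDeriv hs))).mul_left).add
      (hasCompactSupport_dirDeriv (hasCompactSupport_dirDeriv hs))).sub
      (hasCompactSupport_dirDeriv hs).mul_left
  have cw : Continuous weight := (contDiff_weight (k := 0)).continuous
  have i1 : Integrable fun p => weight p * (lap U p * Φ p) :=
    (cw.mul ((continuous_lap hU).mul hΦ.continuous)).integrable_of_hasCompactSupport
      hlapU.mul_right.mul_left
  have i2 : Integrable fun p => weight p * (U p * lap Φ p) :=
    (cw.mul (hU.continuous.mul (continuous_lap hΦ))).integrable_of_hasCompactSupport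
      hs.mul_right.mul_left
  have e : ∀ p, weight p * (radialOp lam η η₁ η₂ (dist₀ p) * Φ p) =
      weight p * (lap U p * Φ p) - weight p * (U p * lap Φ p) := fun p => by
    rw [hlap, radialOp]
    linear_combination weight p * U p * he p
  simp_rw [e]
  rw [integral_sub i1 i2, green hU hs hΦ, sub_self]

/-- F differs from (Δ + 1 + λ²)η, for a smooth η, only within distance O(ε) of the base point and by
at most O(ε⁻³). The ball has volume O(ε³), so the integral is bounded by the supremum of |Φ| near 0,
which is small since Φ(0) = 0. This replaces averaging over SU(2) and the uniqueness of spherical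
functions. -/
theorem integral_comp_dist₀_mul_eq_zero (lam : ℝ) {F : ℝ → ℂ} (hF : Continuous F) {M : ℝ}
    (hM : 1 ≤ M) (hFM : ∀ v, M ≤ v → F v = 0) {Φ : ℂ × ℝ → ℂ} (hΦ : ContDiff ℝ 2 Φ)
    (he : ∀ p, lap Φ p + (1 + (lam : ℂ) ^ 2) * Φ p = 0) (h0 : Φ 0 = 0) :
    ∫ p, weight p * (F (dist₀ p) * Φ p) = 0 := by
  obtain ⟨C, hC0, hC⟩ := exists_approx_solution lam hF hM hFM
  have cd : Continuous dist₀ := (contDiff_dist₀ (k := 0)).continuous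
  have cw : Continuous weight := (contDiff_weight (k := 0)).continuous
  set V := (volume (Metric.ball (0 : ℂ × ℝ) 1)).toReal with hV
  -- The constant 216 = 6³ comes from the volume of a ball of radius 6ε in dimension three.
  have key : ∀ δ : ℝ, 0 < δ → ‖∫ p, weight p * (F (dist₀ p) * Φ p)‖ ≤ 216 * C * V * δ := by
    intro δ hδ
    have h1 : Tendsto (fun p => weight p * Φ p) (𝓝 0) (𝓝 0) := by
      have h2 : Continuous fun p => weight p * Φ p := cw.mul hΦ.continuous
      simpa [h0] using h2.tendsto 0
    obtain ⟨r, hr, hr'⟩ := Metric.tendsto_nhds_nhds.1 h1 δ hδ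
    set ε := min (1 / 2) (r / 12) with hεd
    have hε : 0 < ε := by positivity
    have hε2 : ε ≤ 1 / 2 := min_le_left _ _
    have hεr : 6 * ε < r := by have : ε ≤ r / 12 := min_le_right _ _; linarith
    obtain ⟨η, η₁, η₂, d0, d1, c2, hηM, hfar, hnear⟩ := hC ε hε hε2
    have z := integral_radialOp_mul_eq_zero lam d0 d1 c2 hηM hΦ he
    have c0 : Continuous η := continuous_iff_continuousAt.2 fun v => (d0 v).continuousAt
    have c1 : Continuous η₁ := continuous_iff_continuousAt.2 fun v => (d1 v).continuousAt
    have cop : Continuous (radialOp lam η η₁ η₂) := by unfold radialOp; fun_prop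
    have i1 : Integrable fun p => weight p * (F (dist₀ p) * Φ p) :=
      (cw.mul ((hF.comp cd).mul hΦ.continuous)).integrable_of_hasCompactSupport
        (hasCompactSupport_comp_dist₀ hFM).mul_right.mul_left
    have i2 : Integrable fun p => weight p * (radialOp lam η η₁ η₂ (dist₀ p) * Φ p) :=
      (cw.mul ((cop.comp cd).mul hΦ.continuous)).integrable_of_hasCompactSupport
        (hasCompactSupport_comp_dist₀ (M := max M (1 + 2 * ε ^ 2)) fun v hv => by
          rw [hfar v ((le_max_right _ _).trans hv),
            hFM v ((le_max_left _ _).trans hv)]).mul_right.mul_left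
    have e1 : ∫ p, weight p * (F (dist₀ p) * Φ p) = ∫ p, weight p *
        ((F (dist₀ p) - radialOp lam η η₁ η₂ (dist₀ p)) * Φ p) := by
      rw [← sub_zero (∫ p, weight p * (F (dist₀ p) * Φ p)), ← z, ← integral_sub i1 i2]
      refine integral_congr_ae (Eventually.of_forall fun p => ?_)
      simp only; ring
    have e2 : ∫ p, weight p * ((F (dist₀ p) - radialOp lam η η₁ η₂ (dist₀ p)) * Φ p) =
        ∫ p in Metric.closedBall 0 (6 * ε), weight p *
          ((F (dist₀ p) - radialOp lam η η₁ η₂ (dist₀ p)) * Φ p) := by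
      refine (setIntegral_eq_integral_of_forall_compl_eq_zero fun p hp => ?_).symm
      have : ¬ dist₀ p ≤ 1 + 2 * ε ^ 2 := fun h => hp (by
        rw [mem_closedBall_zero_iff]; exact norm_le_of_dist₀_le hε hε2 h)
      rw [hfar _ (not_le.1 this).le, sub_self, zero_mul, mul_zero]
    rw [e1, e2]
    have hb : ∀ p ∈ Metric.closedBall (0 : ℂ × ℝ) (6 * ε), ‖weight p *
        ((F (dist₀ p) - radialOp lam η η₁ η₂ (dist₀ p)) * Φ p)‖ ≤ C / ε ^ 3 * δ := by
      intro p hp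
      have h2 : ‖weight p * Φ p‖ ≤ δ := by
        have := hr' (x := p) (lt_of_le_of_lt (Metric.mem_closedBall.1 hp) hεr)
        rw [dist_zero_right] at this
        exact this.le
      have h3 : ‖F (dist₀ p) - radialOp lam η η₁ η₂ (dist₀ p)‖ ≤ C / ε ^ 3 := by
        rcases le_total (dist₀ p) (1 + 2 * ε ^ 2) with h | h
        · exact hnear _ (by rw [← coshDist_na_eq]; exact one_le_coshDist _) h
        · rw [hfar _ h, sub_self, norm_zero]; positivity
      calc _ = ‖F (dist₀ p) - radialOp lam η η₁ η₂ (dist₀ p)‖ * ‖weight p * Φ p‖ := by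
            rw [← norm_mul]; congr 1; ring
        _ ≤ _ := mul_le_mul h3 h2 (norm_nonneg _) (by positivity)
    have hfin : volume (Metric.closedBall (0 : ℂ × ℝ) (6 * ε)) < ⊤ :=
      measure_closedBall_lt_top
    refine (norm_setIntegral_le_of_norm_le_const hfin hb).trans (le_of_eq ?_)
    have hrank : Module.finrank ℝ (ℂ × ℝ) = 3 := by simp [Module.finrank_prod]
    rw [Measure.real, Measure.addHaar_closedBall _ _ (by positivity), hrank, ENNReal.toReal_mul,
      ENNReal.toReal_ofReal (by positivity), ← hV]
    field_simp
    ring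
  have hV0 : 0 ≤ V := ENNReal.toReal_nonneg
  refine norm_le_zero_iff.1 (le_of_forall_pos_le_add fun δ hδ => ?_)
  have hpos : 0 < 216 * C * V + 1 := by positivity
  refine (key (δ / (216 * C * V + 1)) (by positivity)).trans ?_
  rw [zero_add, mul_div_assoc', div_le_iff₀ hpos]
  nlinarith

/-! ### Functions on the group in Iwasawa coordinates, and the eigenvalue principle. -/

theorem integral_hypVolume_eq {f : ℂ × ℝ → ℂ} :
    ∫ p, f p ∂hypVolume = ∫ p, weight p * f p := by
  rw [hypVolume, integral_withDensity_eq_integral_toReal_smul (by fun_prop) (by simp)]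
  simp only [ENNReal.toReal_ofReal (Real.exp_pos _).le, Complex.real_smul, weight]

/-- The function `f` in Iwasawa coordinates. -/
def inCoord (f : G₀ → ℂ) (p : ℂ × ℝ) : ℂ := f (n p.1 * a p.2)

theorem deriv_line {Φ : ℂ × ℝ → ℂ} (hΦ : ContDiff ℝ 1 Φ) (p v : ℂ × ℝ) (s : ℝ) :
    deriv (fun s : ℝ => Φ (p + s • v)) s = dirDeriv v Φ (p + s • v) := by
  have h1 : HasDerivAt (fun s : ℝ => p + s • v) v s := by
    simpa using ((hasDerivAt_id s).smul_const v).const_add p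
  exact ((hΦ.differentiable (by norm_num) (p + s • v)).hasFDerivAt.comp_hasDerivAt s h1).deriv

theorem iteratedDeriv_line {Φ : ℂ × ℝ → ℂ} (hΦ : ContDiff ℝ 2 Φ) (p v : ℂ × ℝ) (s : ℝ) :
    iteratedDeriv 2 (fun s : ℝ => Φ (p + s • v)) s = dirDeriv v (dirDeriv v Φ) (p + s • v) := by
  rw [iteratedDeriv_succ, iteratedDeriv_one,
    funext (deriv_line (hΦ.of_le one_le_two) p v),
    deriv_line (contDiff_dirDeriv hΦ (by norm_num [one_add_one_eq_two]))]

theorem laplacian_eq_lap {f : G₀ → ℂ} (hf : ContDiff ℝ 2 (inCoord f)) (p : ℂ × ℝ) :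
    laplacian f p.1.re p.1.im p.2 = lap (inCoord f) p := by
  have e1 : (fun x' => coord f x' p.1.im p.2) =
      fun s : ℝ => inCoord f ((⟨0, p.1.im⟩, p.2) + s • ((1, 0) : ℂ × ℝ)) := by
    funext s
    rw [coord, inCoord]
    congr 3
    · apply Complex.ext <;> simp
    · simp
  have e2 : (fun y' => coord f p.1.re y' p.2) =
      fun s : ℝ => inCoord f ((⟨p.1.re, 0⟩, p.2) + s • ((Complex.I, 0) : ℂ × ℝ)) := by
    funext s
    rw [coord, inCoord]
    congr 3
    · apply Complex.ext <;> simp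
    · simp
  have e3 : (fun t' => coord f p.1.re p.1.im t') =
      fun s : ℝ => inCoord f ((p.1, 0) + s • ((0, 1) : ℂ × ℝ)) := by
    funext s
    rw [coord, inCoord]
    congr 3
    · apply Complex.ext <;> simp
    · simp
  rw [laplacian, e1, e2, e3, iteratedDeriv_line hf, iteratedDeriv_line hf, iteratedDeriv_line hf,
    deriv_line (hf.of_le one_le_two), lap]
  have q1 : ((⟨0, p.1.im⟩, p.2) + p.1.re • ((1, 0) : ℂ × ℝ)) = p :=
    Prod.ext (Complex.ext (by simp) (by simp)) (by simp)
  have q2 : ((⟨p.1.re, 0⟩, p.2) + p.1.im • ((Complex.I, 0) : ℂ × ℝ)) = p :=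
    Prod.ext (Complex.ext (by simp) (by simp)) (by simp)
  have q3 : ((p.1, 0) + p.2 • ((0, 1) : ℂ × ℝ)) = p := by
    ext <;> simp
  rw [q1, q2, q3]

theorem contDiff_inCoord {f : G₀ → ℂ} {k : WithTop ℕ∞}
    (hf : ContDiff ℝ k fun p : ℝ × ℝ × ℝ => coord f p.1 p.2.1 p.2.2) :
    ContDiff ℝ k (inCoord f) := by
  have h1 : ContDiff ℝ k fun p : ℂ × ℝ => p.1.re := Complex.reCLM.contDiff.comp contDiff_fst
  have h2 : ContDiff ℝ k fun p : ℂ × ℝ => p.1.im := Complex.imCLM.contDiff.comp contDiff_fst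
  have h3 : inCoord f = (fun p : ℝ × ℝ × ℝ => coord f p.1 p.2.1 p.2.2) ∘
      fun p : ℂ × ℝ => (p.1.re, p.1.im, p.2) := rfl
  rw [h3]
  exact hf.comp (h1.prodMk (h2.prodMk contDiff_snd))

/-- `f` is, in Iwasawa coordinates, a twice differentiable eigenfunction of the Laplace operator
with spectral parameter `lam`. -/
structure IsEigenfunction (lam : ℝ) (Φ : ℂ × ℝ → ℂ) : Prop where
  contDiff : ContDiff ℝ 2 Φ
  eq_zero : ∀ p, lap Φ p + (1 + (lam : ℂ) ^ 2) * Φ p = 0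

theorem isEigenfunction_of_laplacian {f : G₀ → ℂ} {lam : ℝ}
    (hf : ContDiff ℝ ∞ fun p : ℝ × ℝ × ℝ => coord f p.1 p.2.1 p.2.2)
    (he : ∀ x y t : ℝ, laplacian f x y t + (1 + (lam : ℂ) ^ 2) * coord f x y t = 0) :
    IsEigenfunction lam (inCoord f) := by
  have h1 : ContDiff ℝ 2 (inCoord f) := contDiff_inCoord (by exact_mod_cast contDiff_infty.1 hf 2)
  exact ⟨h1, fun p => by rw [← laplacian_eq_lap h1]; exact he _ _ _⟩

theorem dirDeriv_smul_dir (c : ℝ) (v : ℂ × ℝ) (Φ : ℂ × ℝ → ℂ) (p : ℂ × ℝ) :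
    dirDeriv (c • v) Φ p = c * dirDeriv v Φ p := by
  rw [dirDeriv, map_smul, Complex.real_smul, dirDeriv]

theorem dirDeriv_const_mul (c : ℂ) {Φ : ℂ × ℝ → ℂ} (hΦ : ContDiff ℝ 1 Φ) (v : ℂ × ℝ) :
    dirDeriv v (fun p => c * Φ p) = fun p => c * dirDeriv v Φ p := by
  funext p
  rw [dirDeriv, fderiv_const_mul (hΦ.differentiable (by norm_num) p)]
  rfl

theorem dirDeriv_sub {Φ Ψ : ℂ × ℝ → ℂ} (hΦ : ContDiff ℝ 1 Φ) (hΨ : ContDiff ℝ 1 Ψ) (v : ℂ × ℝ) :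
    dirDeriv v (fun p => Φ p - Ψ p) = fun p => dirDeriv v Φ p - dirDeriv v Ψ p := by
  funext p
  rw [dirDeriv, fderiv_fun_sub (hΦ.differentiable (by norm_num) p)
    (hΨ.differentiable (by norm_num) p)]
  rfl

theorem IsEigenfunction.sub_const_mul {lam : ℝ} {Φ Ψ : ℂ × ℝ → ℂ} (hΦ : IsEigenfunction lam Φ)
    (hΨ : IsEigenfunction lam Ψ) (c : ℂ) : IsEigenfunction lam fun p => Φ p - c * Ψ p := by
  have a1 := hΦ.contDiff
  have b1 := hΨ.contDiff
  have a0 := a1.of_le one_le_two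
  have b0 := b1.of_le one_le_two
  refine ⟨a1.sub (contDiff_const.mul b1), fun p => ?_⟩
  have a2 : ∀ v, ContDiff ℝ 1 (dirDeriv v Φ) := fun v =>
    contDiff_dirDeriv a1 (by norm_num [one_add_one_eq_two])
  have b2 : ∀ v, ContDiff ℝ 1 (dirDeriv v Ψ) := fun v =>
    contDiff_dirDeriv b1 (by norm_num [one_add_one_eq_two])
  have d1 : ∀ v, dirDeriv v (fun p => Φ p - c * Ψ p) =
      fun p => dirDeriv v Φ p - c * dirDeriv v Ψ p := fun v => by
    rw [dirDeriv_sub a0 (contDiff_const.mul b0), dirDeriv_const_mul c b0]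
  have d2 : ∀ v, dirDeriv v (fun p => dirDeriv v Φ p - c * dirDeriv v Ψ p) =
      fun p => dirDeriv v (dirDeriv v Φ) p - c * dirDeriv v (dirDeriv v Ψ) p := fun v => by
    rw [dirDeriv_sub (a2 v) (contDiff_const.mul (b2 v)), dirDeriv_const_mul c (b2 v)]
  have e1 := hΦ.eq_zero p
  have e2 := hΨ.eq_zero p
  rw [lap] at e1 e2 ⊢
  simp only [d1, d2]
  linear_combination e1 - c * e2

/-- With s = 1 + iλ one has s² - 2s = -(1 + λ²). The integral of a bi-invariant kernel against this
function is its spherical transform at λ. -/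
theorem isEigenfunction_exp (lam : ℝ) : IsEigenfunction lam fun p =>
    Complex.exp ((1 + Complex.I * (lam : ℂ)) * (p.2 : ℂ)) := by
  set s : ℂ := 1 + Complex.I * (lam : ℂ) with hs
  have c : ContDiff ℝ 2 fun p : ℂ × ℝ => Complex.exp (s * (p.2 : ℂ)) := by
    have h1 : ContDiff ℝ 2 fun p : ℂ × ℝ => (p.2 : ℂ) := Complex.ofRealCLM.contDiff.comp contDiff_snd
    exact (contDiff_const.mul h1).cexp
  refine ⟨c, fun p => ?_⟩
  have d : ∀ v : ℂ × ℝ, dirDeriv v (fun p : ℂ × ℝ => Complex.exp (s * (p.2 : ℂ))) =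
      fun p => (v.2 * s) * Complex.exp (s * (p.2 : ℂ)) := fun v => by
    funext q
    refine dirDeriv_eq (c.differentiable (by norm_num) q) ?_
    have h1 : HasDerivAt (fun r : ℝ => (((q + r • v).2 : ℝ) : ℂ)) ((v.2 : ℝ) : ℂ) 0 := by
      have := (((hasDerivAt_id (0 : ℝ)).mul_const v.2).const_add q.2).ofReal_comp
      simpa using this
    refine (h1.const_mul s).cexp.congr_deriv ?_
    simp
    ring
  have c1 := c.of_le (one_le_two)
  rw [lap]
  simp only [d, dirDeriv_const_mul _ c1]
  simp only [hs, Complex.ofReal_zero, Complex.ofReal_one]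
  linear_combination ((lam : ℂ) ^ 2 * Complex.exp ((1 + Complex.I * (lam : ℂ)) * (p.2 : ℂ))) *
    Complex.I_sq

/-- The substitution is left translation by n(z₀) a(t₀), an isometry. Each horizontal derivative
gains e^{t₀}, which matches the factor e^{2t} in the Laplace operator. -/
theorem IsEigenfunction.translate {lam : ℝ} {Φ : ℂ × ℝ → ℂ} (hΦ : IsEigenfunction lam Φ) (z₀ : ℂ)
    (t₀ : ℝ) : IsEigenfunction lam fun p => Φ (z₀ + (Real.exp t₀ : ℂ) * p.1, t₀ + p.2) := by
  set A : ℂ × ℝ → ℂ × ℝ := fun p => (z₀ + (Real.exp t₀ : ℂ) * p.1, t₀ + p.2) with hA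
  have cA : ∀ {k : WithTop ℕ∞}, ContDiff ℝ k A :=
    (contDiff_const.add (contDiff_const.mul contDiff_fst)).prodMk (contDiff_const.add contDiff_snd)
  have d : ∀ {Ψ : ℂ × ℝ → ℂ}, ContDiff ℝ 1 Ψ → ∀ v : ℂ × ℝ, dirDeriv v (fun p => Ψ (A p)) =
      fun p => dirDeriv ((Real.exp t₀ : ℂ) * v.1, v.2) Ψ (A p) := fun {Ψ} hΨ v => by
    funext p
    refine dirDeriv_eq ((hΨ.comp cA).differentiable (by norm_num) p) ?_
    have h1 : (fun s : ℝ => Ψ (A (p + s • v))) =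
        fun s : ℝ => Ψ (A p + s • ((Real.exp t₀ : ℂ) * v.1, v.2)) := by
      funext s
      congr 1
      simp only [hA]
      ext <;> simp <;> ring
    rw [h1]
    have := hasDerivAt_dirDeriv (v := ((Real.exp t₀ : ℂ) * v.1, v.2))
      (hΨ.differentiable (by norm_num) (A p))
    simpa using this
  have a1 := hΦ.contDiff
  have a0 := a1.of_le one_le_two
  have a2 : ∀ v, ContDiff ℝ 1 (dirDeriv v Φ) := fun v =>
    contDiff_dirDeriv a1 (by norm_num [one_add_one_eq_two])
  have v1 : (((Real.exp t₀ : ℂ) * ((1, 0) : ℂ × ℝ).1, ((1, 0) : ℂ × ℝ).2) : ℂ × ℝ) =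
      Real.exp t₀ • ((1, 0) : ℂ × ℝ) := by ext <;> simp
  have v2 : (((Real.exp t₀ : ℂ) * ((Complex.I, 0) : ℂ × ℝ).1, ((Complex.I, 0) : ℂ × ℝ).2) : ℂ × ℝ) =
      Real.exp t₀ • ((Complex.I, 0) : ℂ × ℝ) := by ext <;> simp
  have v3 : (((Real.exp t₀ : ℂ) * ((0, 1) : ℂ × ℝ).1, ((0, 1) : ℂ × ℝ).2) : ℂ × ℝ) =
      ((0, 1) : ℂ × ℝ) := by ext <;> simp
  refine ⟨a1.comp cA, fun p => ?_⟩
  have e := hΦ.eq_zero (A p)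
  have hd : ∀ v, dirDeriv v (fun p => Φ (A p)) =
      fun p => dirDeriv ((Real.exp t₀ : ℂ) * v.1, v.2) Φ (A p) := d a0
  have hdd : ∀ v w, dirDeriv v (fun p => dirDeriv w Φ (A p)) =
      fun p => dirDeriv ((Real.exp t₀ : ℂ) * v.1, v.2) (dirDeriv w Φ) (A p) :=
    fun v w => d (a2 w) v
  have hs : ∀ v w, dirDeriv v (fun p => Real.exp t₀ * dirDeriv w Φ (A p)) =
      fun p => Real.exp t₀ * dirDeriv v (fun p => dirDeriv w Φ (A p)) p := fun v w =>
    dirDeriv_const_mul _ ((a2 w).comp cA) v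
  change lap (fun p => Φ (A p)) p + _ * Φ (A p) = 0
  rw [lap] at e ⊢
  simp only [hd, v1, v2, v3, dirDeriv_smul_dir, hs, hdd]
  have ex : (Real.exp (2 * (A p).2) : ℂ) =
      (Real.exp (2 * p.2) : ℂ) * ((Real.exp t₀ : ℂ) * (Real.exp t₀ : ℂ)) := by
    rw [← Complex.ofReal_mul, ← Complex.ofReal_mul, ← Real.exp_add, ← Real.exp_add]
    congr 2
    simp only [hA]; ring
  rw [ex] at e
  linear_combination e

/-- Bi-invariant integral operators act on eigenfunctions of the Laplace operator by the spherical
transform of the kernel. -/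
theorem integral_mul_translate_eq {k f : G₀ → ℂ} {lam : ℝ} (hk : Continuous k)
    (hkc : HasCompactSupport k) (hb : IsBiinvariant k) (hf : Continuous f)
    (hfK : ∀ g, ∀ u ∈ K₀, f (g * u) = f g) (he : IsEigenfunction lam (inCoord f)) (x : G₀) :
    ∫ g, k g * f (x * g) ∂haarG₀ = sphericalTransform k lam * f x := by
  obtain ⟨M, hM, hkM⟩ := exists_coshDist_bound hkc
  set z₀ := iwasawaN x
  set t₀ := iwasawa x
  set κ := (n z₀ * a t₀)⁻¹ * x with hκ
  have hκK : κ ∈ K₀ := iwasawa_K_mem x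
  have hx : x = n z₀ * a t₀ * κ := by rw [hκ, mul_inv_cancel_left]
  -- The SU(2) component of x is absorbed by left invariance of the measure and of k, so x may be
  -- taken in NA.
  have e1 : ∫ g, k g * f (x * g) ∂haarG₀ = ∫ g, k g * f (n z₀ * a t₀ * g) ∂haarG₀ := by
    rw [← integral_mul_left_eq_self (fun g => k g * f (n z₀ * a t₀ * g)) κ]
    refine integral_congr_ae (Eventually.of_forall fun g => ?_)
    simp only
    rw [hb.mul_left g hκK, ← mul_assoc, ← hx]
  have hfx : f (n z₀ * a t₀) = f x := by
    conv_rhs => rw [hx]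
    rw [hfK _ _ hκK]
  have hty : ∀ p : ℂ × ℝ, f (n z₀ * a t₀ * (n p.1 * a p.2)) =
      inCoord f (z₀ + (Real.exp t₀ : ℂ) * p.1, t₀ + p.2) := fun p => by
    rw [inCoord, ← n_mul_n, ← a_mul_a, mul_assoc (n z₀) (a t₀), ← mul_assoc (a t₀), a_mul_n]
    simp only [mul_assoc]
  -- Subtracting f(x) e^{(1+iλ)t} leaves an eigenfunction that vanishes at the base point, so k
  -- integrates it to zero. The exponential contributes the spherical transform.
  have hE := (he.translate z₀ t₀).sub_const_mul (isEigenfunction_exp lam) (f x)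
  have hz := integral_comp_dist₀_mul_eq_zero lam (continuous_radial hk) hM
    (fun v hv => radial_eq_zero hkM hv) hE.contDiff hE.eq_zero (by
      simp only [Prod.fst_zero, Prod.snd_zero, mul_zero, add_zero, Complex.ofReal_zero,
        Complex.exp_zero, mul_one]
      rw [inCoord, hfx, sub_self])
  have hrad : ∀ p : ℂ × ℝ, radial k (dist₀ p) = k (n p.1 * a p.2) := fun p => by
    rw [← coshDist_na_eq, hb.radial_coshDist]
  rw [← integral_hypVolume_eq] at hz
  simp only [hrad, ← hty, mul_sub] at hz
  have ck : Continuous fun p : ℂ × ℝ => k (n p.1 * a p.2) := hk.comp isClosedEmbedding_na.continuous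
  have ik : ∀ {g : ℂ × ℝ → ℂ}, Continuous g →
      Integrable (fun p : ℂ × ℝ => k (n p.1 * a p.2) * g p) hypVolume := fun hg =>
    (ck.mul hg).integrable_of_hasCompactSupport (hasCompactSupport_na hkc).mul_right
  rw [integral_sub (ik (g := fun p => f (n z₀ * a t₀ * (n p.1 * a p.2)))
    (hf.comp (continuous_const.mul isClosedEmbedding_na.continuous)))
    (ik (by fun_prop)), sub_eq_zero] at hz
  rw [e1, integral_haarG₀_of_right_invariant (f := fun g => k g * f (n z₀ * a t₀ * g))
    (hk.mul (hf.comp (continuous_const.mul continuous_id)))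
    (fun g u hu => by rw [hb.mul_right g hu, ← mul_assoc, hfK _ _ hu]), hz,
    sphericalTransform_eq hk hkc hb, ← integral_mul_const]
  refine integral_congr_ae (Eventually.of_forall fun p => ?_)
  simp only; ring

end HypThree

/-! ### Finite adeles of a number field -/

namespace FiniteAdele

open Filter Topology

variable {E : Type*} [Field E] [NumberField E]

theorem countable_numberField (E : Type*) [Field E] [NumberField E] : Countable E :=
  (Module.finBasis ℚ E).equivFun.toEquiv.countable_iff.2 inferInstance

theorem countable_ringOfIntegers (E : Type*) [Field E] [NumberField E] : Countable (𝓞 E) :=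
  have := countable_numberField E
  (RingOfIntegers.coe_injective (K := E)).countable

theorem countable_heightOneSpectrum (E : Type*) [Field E] [NumberField E] :
    Countable (HeightOneSpectrum (𝓞 E)) := by
  have := countable_ringOfIntegers E
  have h1 : Function.Surjective fun s : Finset (𝓞 E) => Ideal.span (s : Set (𝓞 E)) := fun I =>
    (IsNoetherian.noetherian I : I.FG)
  have h2 : Countable (Ideal (𝓞 E)) := h1.countable
  exact Function.Injective.countable (f := HeightOneSpectrum.asIdeal)
    fun v w h => HeightOneSpectrum.ext h

/-- The value group is countable, so the uniformity is countably generated, and the countable field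
E is dense. -/
theorem secondCountable_adicCompletion (v : HeightOneSpectrum (𝓞 E)) :
    SecondCountableTopology (v.adicCompletion E) := by
  have := countable_numberField E
  have h0 : Countable (WithZero (Multiplicative ℤ)) :=
    inferInstanceAs (Countable (Option ℤ))
  have h1 : Countable (MonoidWithZeroHom.ValueGroup₀
      (.ofClass (Valued.v : Valuation (v.adicCompletion E) (WithZero (Multiplicative ℤ))))) :=
    MonoidWithZeroHom.ValueGroup₀.embedding_strictMono.injective.countable
  have h2 := Units.val_injective.countable (β := MonoidWithZeroHom.ValueGroup₀
      (.ofClass (Valued.v : Valuation (v.adicCompletion E) (WithZero (Multiplicative ℤ)))))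
  have h3 : (𝓝 (0 : v.adicCompletion E)).IsCountablyGenerated :=
    (Valued.hasBasis_nhds_zero (v.adicCompletion E) (WithZero (Multiplicative ℤ))).isCountablyGenerated
  have h4 : (uniformity (v.adicCompletion E)).IsCountablyGenerated :=
    IsUniformAddGroup.uniformity_countably_generated
  have h5 : TopologicalSpace.SeparableSpace (v.adicCompletion E) :=
    (HeightOneSpectrum.denseRange_algebraMap E v).separableSpace'
  exact UniformSpace.secondCountable_of_separable _

/-- The integral finite adeles. -/
def integral (E : Type*) [Field E] [NumberField E] : Set (FiniteAdeleRing (𝓞 E) E) :=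
  {x | ∀ v, x v ∈ v.adicCompletionIntegers E}

theorem isOpen_adicCompletionIntegers (v : HeightOneSpectrum (𝓞 E)) :
    IsOpen (v.adicCompletionIntegers E : Set (v.adicCompletion E)) :=
  Valued.isOpen_valuationSubring _

theorem isOpen_integral : IsOpen (integral E) :=
  RestrictedProduct.isOpen_forall_mem fun v => isOpen_adicCompletionIntegers v

theorem secondCountable_integral : SecondCountableTopology (integral E) := by
  have := countable_heightOneSpectrum E
  have h1 : ∀ v : HeightOneSpectrum (𝓞 E), SecondCountableTopology
      (v.adicCompletionIntegers E : Set (v.adicCompletion E)) :=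
    fun v => by
      have := secondCountable_adicCompletion v
      infer_instance
  have h2 := RestrictedProduct.isOpenEmbedding_structureMap
    (R := fun v : HeightOneSpectrum (𝓞 E) => v.adicCompletion E)
    (A := fun v => (v.adicCompletionIntegers E : Set (v.adicCompletion E)))
    (fun v => isOpen_adicCompletionIntegers v)
  have h3 := RestrictedProduct.range_structureMap (ι := HeightOneSpectrum (𝓞 E))
    (R := fun v : HeightOneSpectrum (𝓞 E) => v.adicCompletion E)
    (A := fun v => (v.adicCompletionIntegers E : Set (v.adicCompletion E))) (𝓕 := cofinite)
  have h4 := h2.isEmbedding.toHomeomorph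
  rw [h3] at h4
  exact h4.symm.secondCountableTopology

theorem mul_mem_integral {x y : FiniteAdeleRing (𝓞 E) E} (hx : x ∈ integral E)
    (hy : y ∈ integral E) : x * y ∈ integral E := fun v => mul_mem (hx v) (hy v)

theorem algebraMap_mem_integral (d : 𝓞 E) :
    algebraMap E (FiniteAdeleRing (𝓞 E) E) d ∈ integral E := fun v =>
  HeightOneSpectrum.coe_mem_adicCompletionIntegers v d

theorem mem_range_of_mem_integral {x : E}
    (hx : algebraMap E (FiniteAdeleRing (𝓞 E) E) x ∈ integral E) : ∃ y : 𝓞 E, (y : E) = x := by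
  have := HeightOneSpectrum.mem_integers_of_valuation_le_one (R := 𝓞 E) E x fun v => by
    have h := hx v
    rw [HeightOneSpectrum.mem_adicCompletionIntegers] at h
    rwa [← HeightOneSpectrum.valuedAdicCompletion_eq_valuation']
  exact this

/-- Every finite adele has a denominator. -/
theorem exists_denominator (x : FiniteAdeleRing (𝓞 E) E) :
    ∃ d : 𝓞 E, d ≠ 0 ∧ algebraMap E (FiniteAdeleRing (𝓞 E) E) d * x ∈ integral E := by
  have hf : {v | x v ∉ v.adicCompletionIntegers E}.Finite := x.2
  choose b hb hbx using fun v : HeightOneSpectrum (𝓞 E) =>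
    HeightOneSpectrum.adicCompletion.mul_nonZeroDivisor_mem_adicCompletionIntegers v (x v)
  refine ⟨∏ v ∈ hf.toFinset, b v, Finset.prod_ne_zero_iff.2 fun v _ =>
    nonZeroDivisors.ne_zero (hb v), fun v => ?_⟩
  change ((((∏ v ∈ hf.toFinset, b v : 𝓞 E) : E) : v.adicCompletion E)) * x v ∈ _
  by_cases hv : x v ∈ v.adicCompletionIntegers E
  · exact mul_mem (HeightOneSpectrum.coe_mem_adicCompletionIntegers v _) hv
  · have hm : v ∈ hf.toFinset := hf.mem_toFinset.2 hv
    obtain ⟨c, hc⟩ := Finset.dvd_prod_of_mem b hm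
    rw [hc]
    have e : (((b v * c : 𝓞 E) : E) : v.adicCompletion E) * x v =
        ((c : E) : v.adicCompletion E) * (x v * ((b v : E) : v.adicCompletion E)) := by
      rw [show ((b v * c : 𝓞 E) : E) = (b v : E) * (c : E) from rfl,
        HeightOneSpectrum.adicCompletion.coe_mul]
      ring
    rw [e]
    exact mul_mem (HeightOneSpectrum.coe_mem_adicCompletionIntegers v _) (hbx v)

/-- The finite adeles with denominator `d`. -/
def withDenominator (d : 𝓞 E) : Set (FiniteAdeleRing (𝓞 E) E) :=
  {x | algebraMap E (FiniteAdeleRing (𝓞 E) E) d * x ∈ integral E}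

theorem isOpen_withDenominator (d : 𝓞 E) : IsOpen (withDenominator d) :=
  isOpen_integral.preimage (continuous_const.mul continuous_id)

theorem iUnion_withDenominator :
    ⋃ d : {d : 𝓞 E // d ≠ 0}, withDenominator (E := E) d = Set.univ :=
  Set.eq_univ_of_forall fun x => by
    obtain ⟨d, hd, hx⟩ := exists_denominator x
    exact Set.mem_iUnion.2 ⟨⟨d, hd⟩, hx⟩

/-- The open sets of adeles with a given denominator d form a countable cover, and multiplication by
d embeds each into the integral adeles. This is used for Borel measurability on products and for
σ-finiteness of Haar measure. -/
instance : SecondCountableTopology (FiniteAdeleRing (𝓞 E) E) := by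
  have := countable_ringOfIntegers E
  have hsc := secondCountable_integral (E := E)
  have h1 : ∀ d : {d : 𝓞 E // d ≠ 0}, SecondCountableTopology (withDenominator (E := E) d) := by
    intro d
    have hd : ((d : 𝓞 E) : E) ≠ 0 := RingOfIntegers.coe_ne_zero_iff.2 d.2
    have h2 : Topology.IsInducing fun x : FiniteAdeleRing (𝓞 E) E =>
        algebraMap E (FiniteAdeleRing (𝓞 E) E) (d : 𝓞 E) * x :=
      (Function.LeftInverse.isEmbedding
        (f := fun x => algebraMap E (FiniteAdeleRing (𝓞 E) E) ((d : 𝓞 E) : E)⁻¹ * x)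
        (fun x => by
          simp only
          rw [← mul_assoc, ← map_mul, inv_mul_cancel₀ hd, map_one, one_mul])
        (continuous_const_mul _) (continuous_const_mul _)).isInducing
    have h3 : Topology.IsInducing fun x : withDenominator (E := E) d =>
        (⟨algebraMap E (FiniteAdeleRing (𝓞 E) E) (d : 𝓞 E) * x, x.2⟩ : integral E) :=
      Topology.IsInducing.subtypeVal.of_comp_iff.1 (h2.comp Topology.IsInducing.subtypeVal)
    exact h3.secondCountableTopology
  exact TopologicalSpace.secondCountableTopology_of_countable_cover
    (fun d : {d : 𝓞 E // d ≠ 0} => isOpen_withDenominator (E := E) d) iUnion_withDenominator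

instance : T2Space (FiniteAdeleRing (𝓞 E) E) :=
  inferInstanceAs (T2Space (RestrictedProduct
    (fun v : HeightOneSpectrum (𝓞 E) => v.adicCompletion E)
    (fun v => (v.adicCompletionIntegers E : Set (v.adicCompletion E))) cofinite))

/-- The elements of a compact set of finite adeles have a common denominator. -/
theorem exists_common_denominator {Ω : Set (FiniteAdeleRing (𝓞 E) E)} (hΩ : IsCompact Ω) :
    ∃ d : 𝓞 E, d ≠ 0 ∧ Ω ⊆ withDenominator d := by
  obtain ⟨t, ht⟩ := hΩ.elim_finite_subcover (fun d : {d : 𝓞 E // d ≠ 0} =>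
    withDenominator (E := E) d) (fun d => isOpen_withDenominator _)
    (by rw [iUnion_withDenominator]; exact Set.subset_univ _)
  refine ⟨∏ d ∈ t, (d : 𝓞 E), Finset.prod_ne_zero_iff.2 fun d _ => d.2, fun x hx => ?_⟩
  obtain ⟨d, hd, hxd⟩ := Set.mem_iUnion₂.1 (ht hx)
  obtain ⟨c, hc⟩ := Finset.dvd_prod_of_mem (fun d : {d : 𝓞 E // d ≠ 0} => (d : 𝓞 E)) hd
  rw [withDenominator, Set.mem_ofPred_eq, hc, mul_comm,
    show (((d : 𝓞 E) * c : 𝓞 E) : E) = (c : E) * ((d : 𝓞 E) : E) from mul_comm _ _, map_mul,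
    mul_comm, mul_assoc]
  exact mul_mem_integral (algebraMap_mem_integral c) hxd

end FiniteAdele

/-! ### Topology of the groups of elements of reduced norm one -/

namespace Quat

section Topology

variable {R : Type*} [CommRing R] [TopologicalSpace R] {a b : R}

theorem isInducing_equivProd : Topology.IsInducing (QuaternionAlgebra.equivProd a 0 b) := ⟨rfl⟩

theorem continuous_re : Continuous fun q : ℍ[R,a,b] => q.re :=
  continuous_fst.comp isInducing_equivProd.continuous
theorem continuous_imI : Continuous fun q : ℍ[R,a,b] => q.imI :=
  (continuous_fst.comp continuous_snd).comp isInducing_equivProd.continuous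
theorem continuous_imJ : Continuous fun q : ℍ[R,a,b] => q.imJ :=
  (continuous_fst.comp (continuous_snd.comp continuous_snd)).comp isInducing_equivProd.continuous
theorem continuous_imK : Continuous fun q : ℍ[R,a,b] => q.imK :=
  (continuous_snd.comp (continuous_snd.comp continuous_snd)).comp isInducing_equivProd.continuous

theorem continuous_iff_components {X : Type*} [TopologicalSpace X] {f : X → ℍ[R,a,b]} :
    Continuous f ↔ Continuous (fun x => (f x).re) ∧ Continuous (fun x => (f x).imI) ∧
      Continuous (fun x => (f x).imJ) ∧ Continuous (fun x => (f x).imK) :=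
  ⟨fun h => ⟨continuous_re.comp h, continuous_imI.comp h, continuous_imJ.comp h,
    continuous_imK.comp h⟩, fun h => isInducing_equivProd.continuous_iff.2
      (h.1.prodMk (h.2.1.prodMk (h.2.2.1.prodMk h.2.2.2)))⟩

instance [SecondCountableTopology R] : SecondCountableTopology ℍ[R,a,b] :=
  isInducing_equivProd.secondCountableTopology

instance [T2Space R] : T2Space ℍ[R,a,b] :=
  (Topology.IsEmbedding.mk isInducing_equivProd (Equiv.injective _)).t2Space

instance [IsTopologicalRing R] : ContinuousMul ℍ[R,a,b] := by
  refine ⟨continuous_iff_components.2 ?_⟩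
  have h1 : ∀ {f : ℍ[R,a,b] → R}, Continuous f →
      Continuous fun p : ℍ[R,a,b] × ℍ[R,a,b] => f p.1 := fun h => h.comp continuous_fst
  have h2 : ∀ {f : ℍ[R,a,b] → R}, Continuous f →
      Continuous fun p : ℍ[R,a,b] × ℍ[R,a,b] => f p.2 := fun h => h.comp continuous_snd
  have r1 := h1 (continuous_re (a := a) (b := b))
  have i1 := h1 (continuous_imI (a := a) (b := b))
  have j1 := h1 (continuous_imJ (a := a) (b := b))
  have k1 := h1 (continuous_imK (a := a) (b := b))
  have r2 := h2 (continuous_re (a := a) (b := b))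
  have i2 := h2 (continuous_imI (a := a) (b := b))
  have j2 := h2 (continuous_imJ (a := a) (b := b))
  have k2 := h2 (continuous_imK (a := a) (b := b))
  simp only [QuaternionAlgebra.re_mul, QuaternionAlgebra.imI_mul, QuaternionAlgebra.imJ_mul,
    QuaternionAlgebra.imK_mul]
  refine ⟨?_, ?_, ?_, ?_⟩ <;> fun_prop

instance [IsTopologicalRing R] : ContinuousStar ℍ[R,a,b] := by
  refine ⟨continuous_iff_components.2 ?_⟩
  have r := continuous_re (a := a) (b := b)
  have i := continuous_imI (a := a) (b := b)
  have j := continuous_imJ (a := a) (b := b)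
  have k := continuous_imK (a := a) (b := b)
  simp only [QuaternionAlgebra.re_star, QuaternionAlgebra.imI_star, QuaternionAlgebra.imJ_star,
    QuaternionAlgebra.imK_star]
  refine ⟨?_, ?_, ?_, ?_⟩ <;> fun_prop

instance [IsTopologicalRing R] : IsTopologicalGroup (NormOne R a b) where
  continuous_mul := ((continuous_subtype_val.comp continuous_fst).mul
    (continuous_subtype_val.comp continuous_snd)).subtype_mk _
  continuous_inv := (continuous_subtype_val.star).subtype_mk _

end Topology

end Quat

/-! ### Reduced norms and traces -/

namespace Quat

theorem norm_eq_one {R : Type*} [CommRing R] {a b : R} (q : NormOne R a b) :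
    (q : ℍ[R,a,b]).re ^ 2 - a * (q : ℍ[R,a,b]).imI ^ 2 - b * (q : ℍ[R,a,b]).imJ ^ 2 +
      a * b * (q : ℍ[R,a,b]).imK ^ 2 = 1 := by
  have h := congrArg QuaternionAlgebra.re (Unitary.mul_star_self_of_mem q.2)
  simp only [QuaternionAlgebra.re_mul, QuaternionAlgebra.re_star, QuaternionAlgebra.imI_star,
    QuaternionAlgebra.imJ_star, QuaternionAlgebra.imK_star, QuaternionAlgebra.re_one] at h
  linear_combination h

/-- If a = s² then (s + i)(s - i) = s² - a = 0 exhibits zero divisors, and likewise with j for b. -/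
theorem nonneg_not_isDivision {C : Type*} [Field C] {a b s : C} (hs : s * s = a ∨ s * s = b) :
    ¬ IsDivision C a b := by
  intro h
  have key : ∀ x y : ℍ[C,a,b], x ≠ 0 → y ≠ 0 → x * y = 0 → False := fun x y hx hy hxy =>
    hy ((h x hx).mul_right_eq_zero.1 hxy)
  rcases hs with hs | hs
  · refine key ⟨s, 1, 0, 0⟩ ⟨s, -1, 0, 0⟩ (fun h0 => one_ne_zero
      (congrArg QuaternionAlgebra.imI h0)) (fun h0 => neg_ne_zero.2 one_ne_zero
      (congrArg QuaternionAlgebra.imI h0)) ?_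
    ext <;> simp [hs]
  · refine key ⟨s, 0, 1, 0⟩ ⟨s, 0, -1, 0⟩ (fun h0 => one_ne_zero
      (congrArg QuaternionAlgebra.imJ h0)) (fun h0 => neg_ne_zero.2 one_ne_zero
      (congrArg QuaternionAlgebra.imJ h0)) ?_
    ext <;> simp [hs]

/-- The quaternion algebra `(a, b / ℝ)` can be a division algebra only for negative `a`, `b`. -/
theorem IsDivision.neg {C : Type*} [Field C] (e : C ≃+* ℝ) {a b : C} (h : IsDivision C a b) :
    e a < 0 ∧ e b < 0 := by
  constructor
  · by_contra hn
    refine nonneg_not_isDivision (s := e.symm √(e a)) (Or.inl ?_) h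
    rw [← map_mul, Real.mul_self_sqrt (not_lt.1 hn), e.symm_apply_apply]
  · by_contra hn
    refine nonneg_not_isDivision (s := e.symm √(e b)) (Or.inr ?_) h
    rw [← map_mul, Real.mul_self_sqrt (not_lt.1 hn), e.symm_apply_apply]

/-- For negative a and b the reduced norm x² - ay² - bz² + abw² is positive definite, so its level
set at 1 is bounded. -/
theorem exists_bound_of_neg {a b : ℝ} (ha : a < 0) (hb : b < 0) :
    ∃ B : ℝ, ∀ q : NormOne ℝ a b, |(q : ℍ[ℝ,a,b]).re| ≤ B ∧ |(q : ℍ[ℝ,a,b]).imI| ≤ B ∧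
      |(q : ℍ[ℝ,a,b]).imJ| ≤ B ∧ |(q : ℍ[ℝ,a,b]).imK| ≤ B := by
  set B := 1 + 1 / (-a) + 1 / (-b) + 1 / (a * b) with hB
  have hab : 0 < a * b := mul_pos_of_neg_of_neg ha hb
  have i1 : 0 < 1 / (-a) := one_div_pos.2 (neg_pos.2 ha)
  have i2 : 0 < 1 / (-b) := one_div_pos.2 (neg_pos.2 hb)
  have i3 : 0 < 1 / (a * b) := one_div_pos.2 hab
  have key : ∀ c x : ℝ, 0 < c → c * x ^ 2 ≤ 1 → 1 / c ≤ B → 1 ≤ B → |x| ≤ B :=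
    fun c x hc hx hcB h1 => by
      have h2 : x ^ 2 ≤ B := by
        have : x ^ 2 ≤ 1 / c := by rw [le_div_iff₀ hc]; linarith
        linarith
      exact abs_le_of_sq_le_sq (by nlinarith) (by linarith)
  refine ⟨B, fun q => ?_⟩
  have h := norm_eq_one q
  have e1 : 0 ≤ (-a) * (q : ℍ[ℝ,a,b]).imI ^ 2 := mul_nonneg (neg_pos.2 ha).le (sq_nonneg _)
  have e2 : 0 ≤ (-b) * (q : ℍ[ℝ,a,b]).imJ ^ 2 := mul_nonneg (neg_pos.2 hb).le (sq_nonneg _)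
  have e3 : 0 ≤ (a * b) * (q : ℍ[ℝ,a,b]).imK ^ 2 := mul_nonneg hab.le (sq_nonneg _)
  have e0 := sq_nonneg (q : ℍ[ℝ,a,b]).re
  exact ⟨key 1 _ one_pos (by linarith) (by linarith) (by linarith),
    key (-a) _ (neg_pos.2 ha) (by linarith) (by linarith) (by linarith),
    key (-b) _ (neg_pos.2 hb) (by linarith) (by linarith) (by linarith),
    key (a * b) _ hab (by linarith) (by linarith) (by linarith)⟩

/-- A splitting carries quaternion conjugation to the adjugate, and M + adj M = tr M. Thus matrix
trace corresponds to reduced trace. -/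
theorem trace_symm {C : Type*} [Field C] {a b : C} (f : C →+* ℂ)
    (θ : Matrix (Fin 2) (Fin 2) ℂ ≃+* ℍ[C,a,b]) (ha : a ≠ 0) (hb : b ≠ 0)
    (hθ : ∀ c : C, θ.symm (algebraMap C ℍ[C,a,b] c) = Matrix.scalar (Fin 2) (f c))
    (q : ℍ[C,a,b]) : (θ.symm q).trace = 2 * f q.re := by
  have h1 : θ.symm q + (θ.symm q).adjugate = Matrix.scalar (Fin 2) (f (2 * q.re)) := by
    rw [← symm_star f θ ha hb hθ, ← map_add, ← hθ]
    congr 1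
    ext <;> simp [two_mul]
  have h2 := congrFun (congrFun h1 0) 0
  rw [Matrix.trace_fin_two]
  simpa [Matrix.adjugate_fin_two, map_ofNat] using h2

end Quat

/-! ### Discreteness of 𝐆(F) in G_{v₀} × 𝐆(𝔸_f). -/

theorem extensionEmbedding_algebraMap {E : Type*} [Field E] (w : InfinitePlace E) (x : E) :
    InfinitePlace.Completion.extensionEmbedding w (algebraMap E w.Completion x) = w.embedding x :=
  InfinitePlace.Completion.extensionEmbedding_coe w _

/-- There are only finitely many elements of a number field with bounded denominator and bounded
conjugates. -/
theorem FiniteAdele.finite_setOf_le {E : Type*} [Field E] [NumberField E]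
    (B : InfinitePlace E → ℝ) {d : 𝓞 E} (hd : d ≠ 0) :
    {x : E | algebraMap E (FiniteAdeleRing (𝓞 E) E) x ∈ FiniteAdele.withDenominator d ∧
      ∀ w : InfinitePlace E, w x ≤ B w}.Finite := by
  have hd' : (d : E) ≠ 0 := RingOfIntegers.coe_ne_zero_iff.2 hd
  refine Set.Finite.of_finite_image (f := fun x => (d : E) * x) ?_
    (mul_right_injective₀ hd').injOn
  refine (Embeddings.finite_of_norm_le E ℂ (∑ w : InfinitePlace E, w d * |B w|)).subset ?_
  rintro _ ⟨x, ⟨h1, h2⟩, rfl⟩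
  constructor
  · rw [FiniteAdele.withDenominator, Set.mem_ofPred_eq, ← map_mul] at h1
    obtain ⟨y, hy⟩ := FiniteAdele.mem_range_of_mem_integral h1
    simp only [← hy]
    exact RingOfIntegers.isIntegral_coe y
  · intro φ
    have h3 : ‖φ ((d : E) * x)‖ = InfinitePlace.mk φ d * InfinitePlace.mk φ x := by
      rw [← InfinitePlace.apply φ, map_mul]
    rw [h3]
    refine le_trans ?_ (Finset.single_le_sum (f := fun w : InfinitePlace E => w d * |B w|)
      (fun w _ => mul_nonneg (apply_nonneg w _) (abs_nonneg _))
      (Finset.mem_univ (InfinitePlace.mk φ)))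
    exact mul_le_mul_of_nonneg_left ((h2 _).trans (le_abs_self _)) (apply_nonneg _ _)

namespace ArithmeticDatum

open Quat HypThree

variable {F E : Type*} [Field F] [NumberField F] [Field E] [NumberField E] [Algebra F E]
  (𝒟 : ArithmeticDatum F E)

/-- The coordinates at `w₀` of the elements of `𝐆(F)` in a compact subset of `G_{v₀}` are
bounded. -/
theorem exists_bound_w₀ {Ω : Set G₀} (hΩ : IsCompact Ω) : ∃ B : ℝ, ∀ γ : 𝒟.GF, 𝒟.toG₀ γ ∈ Ω →
    𝒟.w₀ (γ : ℍ[E,𝒟.aE,𝒟.bE]).re ≤ B ∧ 𝒟.w₀ (γ : ℍ[E,𝒟.aE,𝒟.bE]).imI ≤ B ∧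
      𝒟.w₀ (γ : ℍ[E,𝒟.aE,𝒟.bE]).imJ ≤ B ∧ 𝒟.w₀ (γ : ℍ[E,𝒟.aE,𝒟.bE]).imK ≤ B := by
  have ha : 𝒟.aE ≠ 0 := (map_ne_zero _).2 𝒟.a_ne_zero
  have hb : 𝒟.bE ≠ 0 := (map_ne_zero _).2 𝒟.b_ne_zero
  have hnf : ∀ x : E, ‖InfinitePlace.Completion.extensionEmbedding 𝒟.w₀ (algebraMap E 𝒟.w₀.Completion x)‖ = 𝒟.w₀ x := fun x => by
    rw [extensionEmbedding_algebraMap, InfinitePlace.norm_embedding_eq]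
  have htr := trace_symm _ 𝒟.splitting ((map_ne_zero _).2 ha) ((map_ne_zero _).2 hb) 𝒟.splitting_scalar
  have hγ : ∀ γ : 𝒟.GF, ((𝒟.toG₀ γ : G₀) : Matrix (Fin 2) (Fin 2) ℂ) =
      𝒟.splitting.symm (Quat.map (algebraMap E 𝒟.w₀.Completion) rfl rfl (γ : ℍ[E,𝒟.aE,𝒟.bE])) := fun γ => rfl
  have hbd : ∀ X : Matrix (Fin 2) (Fin 2) ℂ, ∃ B : ℝ, ∀ g ∈ Ω,
      ‖((g : Matrix (Fin 2) (Fin 2) ℂ) * X).trace‖ ≤ B := fun X =>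
    hΩ.exists_bound_of_continuousOn (Continuous.continuousOn
      ((continuous_subtype_val.matrix_mul continuous_const).matrix_trace))
  -- Reduced traces of γq are matrix traces in M₂(ℂ), hence bounded over the compact set Ω.
  have hco : ∀ q : ℍ[E,𝒟.aE,𝒟.bE], ∃ B : ℝ, ∀ γ : 𝒟.GF, 𝒟.toG₀ γ ∈ Ω →
      𝒟.w₀ ((γ : ℍ[E,𝒟.aE,𝒟.bE]) * q).re ≤ B := fun q => by
    obtain ⟨B, hB⟩ := hbd (𝒟.splitting.symm (Quat.map (algebraMap E 𝒟.w₀.Completion) rfl rfl q))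
    refine ⟨B, fun γ hγΩ => ?_⟩
    have h1 := hB _ hγΩ
    rw [hγ, ← map_mul, ← map_mul, htr, norm_mul] at h1
    have h2 : ‖InfinitePlace.Completion.extensionEmbedding 𝒟.w₀ (Quat.map (algebraMap E 𝒟.w₀.Completion) rfl rfl ((γ : ℍ[E,𝒟.aE,𝒟.bE]) * q)).re‖ =
        𝒟.w₀ ((γ : ℍ[E,𝒟.aE,𝒟.bE]) * q).re := hnf _
    rw [h2, Complex.norm_two] at h1
    have := apply_nonneg 𝒟.w₀ ((γ : ℍ[E,𝒟.aE,𝒟.bE]) * q).re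
    linarith
  have hdiv : ∀ c : E, c ≠ 0 → ∀ x : E, ∀ B : ℝ, 𝒟.w₀ (c * x) ≤ B → 𝒟.w₀ x ≤ B / 𝒟.w₀ c :=
    fun c hc x B h => by
      rw [le_div_iff₀ (InfinitePlace.pos_iff.2 hc), mul_comm, ← map_mul]; exact h
  obtain ⟨B₀, h₀⟩ := hco ⟨1, 0, 0, 0⟩
  obtain ⟨B₁, h₁⟩ := hco ⟨0, 1, 0, 0⟩
  obtain ⟨B₂, h₂⟩ := hco ⟨0, 0, 1, 0⟩
  obtain ⟨B₃, h₃⟩ := hco ⟨0, 0, 0, 1⟩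
  -- The real parts of γ, γi, γj and γk are re, a·imI, b·imJ and -ab·imK, which explains the
  -- divisors.
  refine ⟨max (max B₀ (B₁ / 𝒟.w₀ 𝒟.aE)) (max (B₂ / 𝒟.w₀ 𝒟.bE) (B₃ / 𝒟.w₀ (-(𝒟.aE * 𝒟.bE)))),
    fun γ hγΩ => ⟨?_, ?_, ?_, ?_⟩⟩
  · refine le_trans ?_ ((le_max_left _ _).trans (le_max_left _ _))
    have := h₀ γ hγΩ
    simpa using this
  · refine le_trans ?_ ((le_max_right _ _).trans (le_max_left _ _))
    refine hdiv _ ha _ _ ?_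
    have := h₁ γ hγΩ
    simpa using this
  · refine le_trans ?_ ((le_max_left _ _).trans (le_max_right _ _))
    refine hdiv _ hb _ _ ?_
    have := h₂ γ hγΩ
    simpa using this
  · refine le_trans ?_ ((le_max_right _ _).trans (le_max_right _ _))
    refine hdiv _ (neg_ne_zero.2 (mul_ne_zero ha hb)) _ _ ?_
    have := h₃ γ hγΩ
    simpa [mul_assoc] using this

/-- The Galois group of the quadratic extension permutes the places above v₀ transitively, so a
second one would also be complex. -/
theorem comap_ne_of_ne [IsTotallyReal F] {w : InfinitePlace E} (hw : w ≠ 𝒟.w₀) :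
    w.comap (algebraMap F E) ≠ 𝒟.w₀.comap (algebraMap F E) := by
  intro h
  have : Algebra.IsQuadraticExtension F E := ⟨𝒟.finrank_eq⟩
  have : FiniteDimensional F E := Module.finite_of_finrank_pos (by rw [𝒟.finrank_eq]; norm_num)
  obtain ⟨σ, hσ⟩ := InfinitePlace.exists_smul_eq_of_comap_eq h.symm
  exact hw (𝒟.eq_w₀ w (by rw [← hσ, InfinitePlace.isComplex_smul_iff]; exact 𝒟.isComplex_w₀))

/-- The coordinates of the elements of `𝐆(F)` at the real places of `E` are bounded. -/
theorem exists_bound_real [IsTotallyReal F] {w : InfinitePlace E} (hw : w ≠ 𝒟.w₀) :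
    ∃ B : ℝ, ∀ γ : 𝒟.GF,
    w (γ : ℍ[E,𝒟.aE,𝒟.bE]).re ≤ B ∧ w (γ : ℍ[E,𝒟.aE,𝒟.bE]).imI ≤ B ∧
      w (γ : ℍ[E,𝒟.aE,𝒟.bE]).imJ ≤ B ∧ w (γ : ℍ[E,𝒟.aE,𝒟.bE]).imK ≤ B := by
  have hr : w.IsReal := InfinitePlace.not_isComplex_iff_isReal.1 fun h => hw (𝒟.eq_w₀ w h)
  set v := w.comap (algebraMap F E) with hv
  have hvr : v.IsReal := IsTotallyReal.isReal v
  set σ := InfinitePlace.embedding_of_isReal hr with hσ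
  -- Below w the algebra D is ramified, so the norm form of B at the real place w is definite and
  -- the bound holds for all γ.
  have hdiv := (𝒟.ramified_iff v).2 (𝒟.comap_ne_of_ne hw)
  obtain ⟨h1, h2⟩ := hdiv.neg (InfinitePlace.Completion.ringEquivRealOfIsReal hvr)
  have hcmp : ∀ x : F, InfinitePlace.Completion.ringEquivRealOfIsReal hvr
      (algebraMap F v.Completion x) = σ (algebraMap F E x) := fun x => by
    have e1 : InfinitePlace.Completion.ringEquivRealOfIsReal hvr (algebraMap F v.Completion x) =
        InfinitePlace.embedding_of_isReal hvr x :=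
      InfinitePlace.Completion.extensionEmbeddingOfIsReal_coe hvr _
    rw [e1]
    apply Complex.ofReal_injective
    rw [InfinitePlace.embedding_of_isReal_apply, InfinitePlace.embedding_of_isReal_apply, hv,
      InfinitePlace.comap_embedding_of_isReal _ hvr]
    rfl
  rw [hcmp] at h1 h2
  obtain ⟨B, hB⟩ := exists_bound_of_neg h1 h2
  refine ⟨B, fun γ => ?_⟩
  have := hB (mapNormOne σ rfl rfl γ)
  simp only [← InfinitePlace.norm_embedding_of_isReal hr, Real.norm_eq_abs]
  exact this

/-- `𝐆(F)` is discrete in `G_{v₀} × 𝐆(𝔸_f)`. -/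
theorem finite_setOf_mem [IsTotallyReal F] {Ω₀ : Set G₀} (h₀ : IsCompact Ω₀) {Ω : Set 𝒟.Gfin}
    (hΩ : IsCompact Ω) : {γ : 𝒟.GF | 𝒟.toG₀ γ ∈ Ω₀ ∧ 𝒟.toFin γ ∈ Ω}.Finite := by
  set Γ := {γ : 𝒟.GF | 𝒟.toG₀ γ ∈ Ω₀ ∧ 𝒟.toFin γ ∈ Ω}
  -- At w₀ the bound comes from Ω₀; at every other place of E it is automatic.
  have hB : ∀ w : InfinitePlace E, ∃ B : ℝ, ∀ γ ∈ Γ,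
      w (γ : ℍ[E,𝒟.aE,𝒟.bE]).re ≤ B ∧ w (γ : ℍ[E,𝒟.aE,𝒟.bE]).imI ≤ B ∧
      w (γ : ℍ[E,𝒟.aE,𝒟.bE]).imJ ≤ B ∧ w (γ : ℍ[E,𝒟.aE,𝒟.bE]).imK ≤ B := fun w => by
    by_cases hw : w = 𝒟.w₀
    · obtain ⟨B, hB⟩ := 𝒟.exists_bound_w₀ h₀
      exact ⟨B, fun γ hγ => by rw [hw]; exact hB γ hγ.1⟩
    · obtain ⟨B, hB⟩ := 𝒟.exists_bound_real hw
      exact ⟨B, fun γ _ => hB γ⟩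
  choose B hB using hB
  have c₀ : Continuous fun u : 𝒟.Gfin => (u : ℍ[FiniteAdeleRing (𝓞 E) E,
      algebraMap E (FiniteAdeleRing (𝓞 E) E) 𝒟.aE,
      algebraMap E (FiniteAdeleRing (𝓞 E) E) 𝒟.bE]).re := continuous_re.comp continuous_subtype_val
  obtain ⟨d₀, n₀, m₀⟩ := FiniteAdele.exists_common_denominator (hΩ.image c₀)
  have c₁ : Continuous fun u : 𝒟.Gfin => (u : ℍ[FiniteAdeleRing (𝓞 E) E,
      algebraMap E (FiniteAdeleRing (𝓞 E) E) 𝒟.aE,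
      algebraMap E (FiniteAdeleRing (𝓞 E) E) 𝒟.bE]).imI := continuous_imI.comp continuous_subtype_val
  obtain ⟨d₁, n₁, m₁⟩ := FiniteAdele.exists_common_denominator (hΩ.image c₁)
  have c₂ : Continuous fun u : 𝒟.Gfin => (u : ℍ[FiniteAdeleRing (𝓞 E) E,
      algebraMap E (FiniteAdeleRing (𝓞 E) E) 𝒟.aE,
      algebraMap E (FiniteAdeleRing (𝓞 E) E) 𝒟.bE]).imJ := continuous_imJ.comp continuous_subtype_val
  obtain ⟨d₂, n₂, m₂⟩ := FiniteAdele.exists_common_denominator (hΩ.image c₂)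
  have c₃ : Continuous fun u : 𝒟.Gfin => (u : ℍ[FiniteAdeleRing (𝓞 E) E,
      algebraMap E (FiniteAdeleRing (𝓞 E) E) 𝒟.aE,
      algebraMap E (FiniteAdeleRing (𝓞 E) E) 𝒟.bE]).imK := continuous_imK.comp continuous_subtype_val
  obtain ⟨d₃, n₃, m₃⟩ := FiniteAdele.exists_common_denominator (hΩ.image c₃)
  refine Set.Finite.of_injOn (f := fun γ : 𝒟.GF => ((γ : ℍ[E,𝒟.aE,𝒟.bE]).re,
    (γ : ℍ[E,𝒟.aE,𝒟.bE]).imI, (γ : ℍ[E,𝒟.aE,𝒟.bE]).imJ, (γ : ℍ[E,𝒟.aE,𝒟.bE]).imK))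
    (t := _ ×ˢ _ ×ˢ _ ×ˢ _) (fun γ hγ => ⟨?_, ?_, ?_, ?_⟩) (fun γ _ γ' _ h => ?_)
    ((FiniteAdele.finite_setOf_le B n₀).prod ((FiniteAdele.finite_setOf_le B n₁).prod ((FiniteAdele.finite_setOf_le B n₂).prod (FiniteAdele.finite_setOf_le B n₃))))
  · exact ⟨m₀ (Set.mem_image_of_mem _ hγ.2), fun w => (hB w γ hγ).1⟩
  · exact ⟨m₁ (Set.mem_image_of_mem _ hγ.2), fun w => (hB w γ hγ).2.1⟩
  · exact ⟨m₂ (Set.mem_image_of_mem _ hγ.2), fun w => (hB w γ hγ).2.2.1⟩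
  · exact ⟨m₃ (Set.mem_image_of_mem _ hγ.2), fun w => (hB w γ hγ).2.2.2⟩
  · simp only [Prod.mk.injEq] at h
    exact Subtype.ext (QuaternionAlgebra.ext h.1 h.2.1 h.2.2.1 h.2.2.2)

instance : Countable 𝒟.GF := by
  have := FiniteAdele.countable_numberField E
  exact Function.Injective.countable (f := fun γ : 𝒟.GF => ((γ : ℍ[E,𝒟.aE,𝒟.bE]).re,
    (γ : ℍ[E,𝒟.aE,𝒟.bE]).imI, (γ : ℍ[E,𝒟.aE,𝒟.bE]).imJ, (γ : ℍ[E,𝒟.aE,𝒟.bE]).imK))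
    fun γ γ' h => by
      simp only [Prod.mk.injEq] at h
      exact Subtype.ext (QuaternionAlgebra.ext h.1 h.2.1 h.2.2.1 h.2.2.2)

end ArithmeticDatum

/-! ### Unfolding over a discrete group of measure preserving transformations -/

namespace Unfolding

open Filter
open scoped ENNReal

variable {Γ P : Type*} [Group Γ] [MeasurableSpace P]

/-- `s` is a fundamental domain for the measure preserving action `act` of `Γ` on `P`, where the
elements of `Z` act trivially up to a symmetry of `s`. -/
structure IsDomain (act : Γ → P → P) (ν : Measure P) (s : Set P) (Z : Set Γ) : Prop where
  one : ∀ p, act 1 p = p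
  mul : ∀ γ γ' p, act (γ * γ') p = act γ (act γ' p)
  measurePreserving : ∀ γ, MeasurePreserving (act γ) ν ν
  measurableSet : MeasurableSet s
  mem_iff : ∀ γ ∈ Z, ∀ p, act γ p ∈ s ↔ p ∈ s
  covers : ∀ᵐ p ∂ν, ∃ γ, act γ p ∈ s
  disjoint : ∀ γ ∉ Z, ν {p | p ∈ s ∧ act γ p ∈ s} = 0
  finite : Z.Finite
  one_mem : 1 ∈ Z

variable {act : Γ → P → P} {ν : Measure P} {s : Set P} {Z : Set Γ} [Countable Γ]

/-- Almost every orbit meets s, and off a null set γp and γ'p lie both in s only if γ'γ⁻¹ ∈ Z. The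
elements of Z preserve s, so the count is exactly |Z|. -/
theorem IsDomain.ae_tsum_indicator (h : IsDomain act ν s Z) :
    ∀ᵐ p ∂ν, ∑' γ, s.indicator (1 : P → ℝ≥0∞) (act γ p) = Z.ncard := by
  have h1 : ∀ᵐ p ∂ν, ∀ γ γ' : Γ, γ' * γ⁻¹ ∉ Z → ¬ (act γ p ∈ s ∧ act γ' p ∈ s) := by
    refine ae_all_iff.2 fun γ => ae_all_iff.2 fun γ' => ?_
    by_cases hγ : γ' * γ⁻¹ ∈ Z
    · exact Eventually.of_forall fun p hn => absurd hγ hn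
    · have h2 := (h.measurePreserving γ).quasiMeasurePreserving.preimage_null (h.disjoint _ hγ)
      have h3 : ∀ᵐ p ∂ν, ¬ (act γ p ∈ s ∧ act γ' p ∈ s) := by
        rw [ae_iff]
        refine measure_mono_null (fun p hp => ?_) h2
        have hp' := not_not.1 hp
        refine ⟨hp'.1, ?_⟩
        rw [← h.mul, inv_mul_cancel_right]
        exact hp'.2
      filter_upwards [h3] with p hp _ using hp
  filter_upwards [h.covers, h1] with p ⟨γ₀, h₀⟩ hp
  have e : ∀ γ, s.indicator (1 : P → ℝ≥0∞) (act (γ * γ₀) p) = Z.indicator (fun _ => 1) γ := by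
    intro γ
    by_cases hγ : γ ∈ Z
    · rw [Set.indicator_of_mem hγ, h.mul, Set.indicator_of_mem ((h.mem_iff γ hγ _).2 h₀)]
      rfl
    · rw [Set.indicator_of_notMem hγ, Set.indicator_of_notMem]
      exact fun hm => hp γ₀ (γ * γ₀) (by rwa [mul_inv_cancel_right]) ⟨h₀, hm⟩
  rw [← (Equiv.mulRight γ₀).tsum_eq]
  simp only [Equiv.coe_mulRight, e]
  rw [← tsum_subtype, ENNReal.tsum_set_one, ← h.finite.cast_ncard_eq]
  rfl

/-- The translates of s cover almost every point |Z| times. Stated as an equality of measures, this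
yields unfolding for nonnegative and for integrable functions alike. -/
theorem IsDomain.sum_map (h : IsDomain act ν s Z) :
    Measure.sum (fun γ => (ν.restrict s).map (act γ)) = (Z.ncard : ℝ≥0∞) • ν := by
  ext A hA
  have e : ∀ γ, (ν.restrict s).map (act γ) A =
      ∫⁻ p in A, s.indicator (1 : P → ℝ≥0∞) (act γ⁻¹ p) ∂ν := fun γ => by
    have h1 : (fun p => s.indicator (1 : P → ℝ≥0∞) (act γ⁻¹ p)) =
        (act γ⁻¹ ⁻¹' s).indicator 1 := rfl
    have hm := (h.measurePreserving γ).measurable hA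
    have hm' := (h.measurePreserving γ⁻¹).measurable h.measurableSet
    rw [Measure.map_apply (h.measurePreserving γ).measurable hA, Measure.restrict_apply hm, h1,
      lintegral_indicator_one hm', Measure.restrict_apply hm',
      ← (h.measurePreserving γ).measure_preimage (hm'.inter hA).nullMeasurableSet]
    congr 1
    ext p
    simp only [Set.mem_inter_iff, Set.mem_preimage]
    rw [← h.mul, inv_mul_cancel, h.one, and_comm]
  rw [Measure.sum_apply _ hA, Measure.smul_apply, smul_eq_mul]
  simp only [e]
  rw [← (Equiv.inv Γ).tsum_eq]
  simp only [Equiv.inv_apply, inv_inv]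
  rw [← lintegral_tsum (f := fun γ p => s.indicator (1 : P → ℝ≥0∞) (act γ p))
    fun γ => ((measurable_one.indicator h.measurableSet).comp
    (h.measurePreserving γ).measurable).aemeasurable,
    lintegral_congr_ae (ae_restrict_of_ae h.ae_tsum_indicator), setLIntegral_const]

omit [Countable Γ] in
theorem IsDomain.ncard_ne_zero (h : IsDomain act ν s Z) : Z.ncard ≠ 0 := fun h0 =>
  Set.notMem_empty (1 : Γ) (((Set.ncard_eq_zero h.finite).1 h0) ▸ h.one_mem)

theorem IsDomain.lintegral_eq (h : IsDomain act ν s Z) {f : P → ℝ≥0∞} (hf : Measurable f) :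
    ∫⁻ p in s, ∑' γ, f (act γ p) ∂ν = Z.ncard * ∫⁻ p, f p ∂ν := by
  rw [← smul_eq_mul, ← lintegral_smul_measure, ← h.sum_map, lintegral_sum_measure,
    lintegral_tsum (f := fun γ p => f (act γ p)) fun γ => (hf.comp (h.measurePreserving γ).measurable).aemeasurable]
  refine tsum_congr fun γ => ?_
  rw [lintegral_map hf (h.measurePreserving γ).measurable]

theorem IsDomain.integral_eq (h : IsDomain act ν s Z) {f : P → ℂ} (hf : Measurable f)
    (hfi : Integrable f ν) : ∫ p in s, ∑' γ, f (act γ p) ∂ν = Z.ncard * ∫ p, f p ∂ν := by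
  have hi : Integrable f (Measure.sum fun γ => (ν.restrict s).map (act γ)) := by
    rw [h.sum_map]
    exact hfi.smul_measure (ENNReal.natCast_ne_top _)
  have h1 := integral_sum_measure hi
  rw [h.sum_map, integral_smul_measure, ENNReal.toReal_natCast] at h1
  have h2 : (Z.ncard : ℂ) * ∫ p, f p ∂ν = ((Z.ncard : ℝ) • ∫ p, f p ∂ν) := by
    rw [Complex.real_smul, Complex.ofReal_natCast]
  rw [h2, h1, integral_tsum (f := fun γ p => f (act γ p))
    (fun γ => (hf.comp (h.measurePreserving γ).measurable).aestronglyMeasurable)]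
  · refine tsum_congr fun γ => ?_
    rw [integral_map (h.measurePreserving γ).measurable.aemeasurable hf.aestronglyMeasurable]
  · rw [← lintegral_tsum (f := fun γ p => ‖f (act γ p)‖ₑ) fun γ =>
      (hf.comp (h.measurePreserving γ).measurable).enorm.aemeasurable,
      h.lintegral_eq hf.enorm]
    exact ENNReal.mul_ne_top (ENNReal.natCast_ne_top _) hfi.2.ne

theorem norm_integral_mul_sq_le {α : Type*} [MeasurableSpace α] {m : Measure α} {f g : α → ℂ}
    (hf : Measurable f) (hg : Measurable g) (hg1 : ∫⁻ x, ‖g x‖ₑ ^ 2 ∂m = 1)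
    (hfi : Integrable (fun x => ‖f x‖ ^ 2) m) :
    ‖∫ x, f x * g x ∂m‖ ^ 2 ≤ ∫ x, ‖f x‖ ^ 2 ∂m := by
  have h1 : ‖∫ x, f x * g x ∂m‖ₑ ≤ (∫⁻ x, ‖f x‖ₑ ^ (2 : ℝ) ∂m) ^ (1 / (2 : ℝ)) := by
    refine (enorm_integral_le_lintegral_enorm _).trans ?_
    have h2 := ENNReal.lintegral_mul_le_Lp_mul_Lq m Real.HolderConjugate.two_two
      hf.enorm.aemeasurable hg.enorm.aemeasurable
    have h3 : ∫⁻ x, ‖g x‖ₑ ^ (2 : ℝ) ∂m = 1 := by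
      rw [← hg1]; simp only [← ENNReal.rpow_natCast]; norm_num
    rw [h3, ENNReal.one_rpow, mul_one] at h2
    simpa [enorm_mul] using h2
  have h4 : ‖∫ x, f x * g x ∂m‖ₑ ^ 2 ≤ ∫⁻ x, ‖f x‖ₑ ^ (2 : ℝ) ∂m := by
    calc ‖∫ x, f x * g x ∂m‖ₑ ^ 2 ≤ ((∫⁻ x, ‖f x‖ₑ ^ (2 : ℝ) ∂m) ^ (1 / (2 : ℝ))) ^ 2 := by gcongr
      _ = _ := by rw [← ENNReal.rpow_natCast, ← ENNReal.rpow_mul]; norm_num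
  have h5 : ∫⁻ x, ‖f x‖ₑ ^ (2 : ℝ) ∂m = ENNReal.ofReal (∫ x, ‖f x‖ ^ 2 ∂m) := by
    rw [ofReal_integral_eq_lintegral_ofReal hfi (Eventually.of_forall fun x => by positivity)]
    refine lintegral_congr fun x => ?_
    rw [ENNReal.ofReal_pow (norm_nonneg _), ofReal_norm]
    simp only [← ENNReal.rpow_natCast]; norm_num
  rw [h5, ← ofReal_norm, ← ENNReal.ofReal_pow (norm_nonneg _)] at h4
  exact (ENNReal.ofReal_le_ofReal_iff (integral_nonneg fun x => by positivity)).1 h4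

/-- The pretrace inequality: the square of the pairing of `g` with a normalized automorphic
function is bounded by the sum of the correlations of the translates of `g`. -/
theorem IsDomain.norm_integral_sq_le (h : IsDomain act ν s Z) {f g : P → ℂ} (hf : Measurable f)
    (hg : Measurable g) (hinv : ∀ γ p, f (act γ p) = f p) (hf1 : ∫⁻ p in s, ‖f p‖ₑ ^ 2 ∂ν = 1)
    (hgf : Integrable (fun p => g p * f p) ν)
    (hgg : ∀ γ, Integrable (fun p => g (act γ p) * conj (g p)) ν) (Δ : Finset Γ)
    (hΔ : ∀ γ ∉ Δ, ∀ p, g (act γ p) * conj (g p) = 0) :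
    ‖∫ p, g p * f p ∂ν‖ ^ 2 ≤ ∑ γ ∈ Δ, ‖∫ p, g (act γ p) * conj (g p) ∂ν‖ := by
  set Φ : P → ℂ := fun p => ∑' γ, g (act γ p) with hΦ
  have mΦ : Measurable Φ := Measurable.tsum fun γ => hg.comp (h.measurePreserving γ).measurable
  have hΦinv : ∀ γ p, Φ (act γ p) = Φ p := fun γ p => by
    simp only [hΦ, ← h.mul]
    exact (Equiv.mulRight γ).tsum_eq fun γ' => g (act γ' p)
  have hm : (1 : ℝ) ≤ Z.ncard := by exact_mod_cast Nat.one_le_iff_ne_zero.2 h.ncard_ne_zero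
  have e1 : (Z.ncard : ℂ) * ∫ p, g p * f p ∂ν = ∫ p in s, Φ p * f p ∂ν := by
    rw [← h.integral_eq (f := fun p => g p * f p) (hg.mul hf) hgf]
    simp only [hinv, tsum_mul_right, hΦ]
  -- Only γ ∈ Δ contribute, which makes this sum finite and its integral a finite sum of
  -- correlations.
  have hsum : ∀ p, Φ p * conj (g p) = ∑ γ ∈ Δ, g (act γ p) * conj (g p) := fun p => by
    rw [hΦ]
    simp only
    rw [← tsum_mul_right, tsum_eq_sum fun γ hγ => hΔ γ hγ p]
  have iΦ : Integrable (fun p => Φ p * conj (g p)) ν := by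
    simp only [hsum]
    exact integrable_finsetSum _ fun γ _ => hgg γ
  have mg : Measurable fun p => Φ p * conj (g p) := mΦ.mul (Complex.continuous_conj.measurable.comp hg)
  have hsq : ∀ p, ∑' γ, Φ (act γ p) * conj (g (act γ p)) = ((‖Φ p‖ ^ 2 : ℝ) : ℂ) := fun p => by
    simp only [hΦinv]
    rw [tsum_mul_left, ← Complex.conj_tsum, Complex.mul_conj, Complex.normSq_eq_norm_sq]
  -- Second unfolding: since Φ is invariant, |Φ|² is the orbit sum of Φ ḡ.
  have e2 : (Z.ncard : ℂ) * ∫ p, Φ p * conj (g p) ∂ν = ((∫ p in s, ‖Φ p‖ ^ 2 ∂ν : ℝ) : ℂ) := by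
    rw [← h.integral_eq mg iΦ, ← integral_complex_ofReal]
    simp only [hsq]
  have hi : Integrable (fun p => ‖Φ p‖ ^ 2) (ν.restrict s) := by
    refine ⟨(mΦ.norm.pow_const 2).aestronglyMeasurable, ?_⟩
    refine lt_of_le_of_lt (lintegral_mono fun p => ?_) (lt_top_iff_ne_top.2
      (h.lintegral_eq mg.enorm ▸
        ENNReal.mul_ne_top (ENNReal.natCast_ne_top _) iΦ.2.ne))
    have := hsq p
    calc ‖‖Φ p‖ ^ 2‖ₑ = ‖((‖Φ p‖ ^ 2 : ℝ) : ℂ)‖ₑ := by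
          rw [← ofReal_norm, ← ofReal_norm, Complex.norm_real]
      _ = ‖∑' γ, Φ (act γ p) * conj (g (act γ p))‖ₑ := by rw [hsq]
      _ ≤ _ := enorm_tsum_le_tsum_enorm
  have e3 := norm_integral_mul_sq_le mΦ hf hf1 hi
  have e4 : ‖∫ p, Φ p * conj (g p) ∂ν‖ ≤ ∑ γ ∈ Δ, ‖∫ p, g (act γ p) * conj (g p) ∂ν‖ := by
    simp only [hsum]
    rw [integral_finsetSum _ fun γ _ => hgg γ]
    exact norm_sum_le _ _
  have e5 : ∫ p in s, ‖Φ p‖ ^ 2 ∂ν = Z.ncard * ‖∫ p, Φ p * conj (g p) ∂ν‖ := by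
    have := congrArg norm e2
    rw [norm_mul, Complex.norm_natCast, Complex.norm_real, Real.norm_of_nonneg
      (integral_nonneg fun p => by positivity)] at this
    exact this.symm
  rw [← e1, e5, norm_mul, Complex.norm_natCast, mul_pow] at e3
  set X := ‖∫ p, g p * f p ∂ν‖
  -- With m = |Z|, Cauchy-Schwarz reads m²X² ≤ m |∫ Φ ḡ|. One m cancels, and the other is dropped
  -- because m ≥ 1.
  have hX : X ^ 2 ≤ (Z.ncard : ℝ) * X ^ 2 := le_mul_of_one_le_left (sq_nonneg _) hm
  have h6 : (Z.ncard : ℝ) * X ^ 2 ≤ ‖∫ p, Φ p * conj (g p) ∂ν‖ := by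
    have hpos : (0 : ℝ) < Z.ncard := by linarith
    refine le_of_mul_le_mul_left ?_ hpos
    calc (Z.ncard : ℝ) * (Z.ncard * X ^ 2) = (Z.ncard : ℝ) ^ 2 * X ^ 2 := by ring
      _ ≤ _ := e3
  exact hX.trans (h6.trans e4)

end Unfolding

/-! ### Test functions attached to a weighted surface in `SL(2, ℂ)` -/

namespace HypThree

/-- The function `y ↦ ∫ w(p) k(q(p)⁻¹ y) dp`. -/
def smear (k : G₀ → ℂ) (q : ℝ × ℝ → G₀) (w : ℝ × ℝ → ℂ) (y : G₀) : ℂ :=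
  ∫ p, w p * k ((q p)⁻¹ * y)

variable {k : G₀ → ℂ} {q : ℝ × ℝ → G₀} {w : ℝ × ℝ → ℂ}

theorem smear_eq_setIntegral (y : G₀) :
    smear k q w y = ∫ p in tsupport w, w p * k ((q p)⁻¹ * y) := by
  rw [smear, setIntegral_eq_integral_of_forall_compl_eq_zero]
  intro p hp
  rw [image_eq_zero_of_notMem_tsupport hp, zero_mul]

theorem continuous_smear (hk : Continuous k) (hq : Continuous q) (hw : Continuous w)
    (hwc : HasCompactSupport w) : Continuous (smear k q w) := by
  have h : Continuous (Function.uncurry fun (y : G₀) (p : ℝ × ℝ) => w p * k ((q p)⁻¹ * y)) :=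
    (hw.comp continuous_snd).mul
      (hk.comp (((hq.comp continuous_snd).inv).mul continuous_fst))
  have h1 := continuous_parametric_integral_of_continuous (μ := (volume : Measure (ℝ × ℝ))) h hwc
  have h2 : smear k q w = fun y => ∫ p in tsupport w, w p * k ((q p)⁻¹ * y) :=
    funext fun y => smear_eq_setIntegral y
  rw [h2]
  exact h1

/-- A compact set that contains `q(p) g` for `p` in the support of `w` and `g` in the support of
`k`. -/
def smearSupport (k : G₀ → ℂ) (q : ℝ × ℝ → G₀) (w : ℝ × ℝ → ℂ) : Set G₀ :=
  (fun x : (ℝ × ℝ) × G₀ => q x.1 * x.2) '' (tsupport w ×ˢ tsupport k)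

theorem isCompact_smearSupport (hkc : HasCompactSupport k) (hq : Continuous q)
    (hwc : HasCompactSupport w) : IsCompact (smearSupport k q w) :=
  (hwc.isCompact.prod hkc.isCompact).image ((hq.comp continuous_fst).mul continuous_snd)

theorem smear_integrand_eq_zero {p : ℝ × ℝ} {y : G₀}
    (h : p ∉ tsupport w ∨ y ∉ smearSupport k q w) : w p * k ((q p)⁻¹ * y) = 0 := by
  by_contra h0
  have h1 : p ∈ tsupport w := subset_tsupport _ (left_ne_zero_of_mul h0)
  have h2 : (q p)⁻¹ * y ∈ tsupport k := subset_tsupport _ (right_ne_zero_of_mul h0)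
  exact h.elim (fun h => h h1) fun h => h ⟨(p, (q p)⁻¹ * y), ⟨h1, h2⟩, mul_inv_cancel_left _ _⟩

theorem smear_eq_zero {y : G₀} (h : y ∉ smearSupport k q w) : smear k q w y = 0 := by
  rw [smear]
  simp only [smear_integrand_eq_zero (Or.inr h), integral_zero]

theorem hasCompactSupport_smear (hkc : HasCompactSupport k) (hq : Continuous q)
    (hwc : HasCompactSupport w) : HasCompactSupport (smear k q w) :=
  HasCompactSupport.intro (isCompact_smearSupport hkc hq hwc) fun _ => smear_eq_zero

theorem integral_smear_mul (hk : Continuous k) (hkc : HasCompactSupport k) (hq : Continuous q)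
    (hw : Continuous w) (hwc : HasCompactSupport w) {f : G₀ → ℂ} (hf : Continuous f) {c : ℂ}
    (hc : ∀ x, ∫ g, k g * f (x * g) ∂haarG₀ = c * f x) :
    ∫ y, smear k q w y * f y ∂haarG₀ = c * ∫ p, w p * f (q p) := by
  have h : Continuous (Function.uncurry fun (y : G₀) (p : ℝ × ℝ) =>
      w p * k ((q p)⁻¹ * y) * f y) :=
    ((hw.comp continuous_snd).mul (hk.comp (((hq.comp continuous_snd).inv).mul
      continuous_fst))).mul (hf.comp continuous_fst)
  have hs : HasCompactSupport (Function.uncurry fun (y : G₀) (p : ℝ × ℝ) =>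
      w p * k ((q p)⁻¹ * y) * f y) := by
    refine HasCompactSupport.intro ((isCompact_smearSupport hkc hq hwc).prod hwc.isCompact)
      fun x hx => ?_
    rw [Function.uncurry, smear_integrand_eq_zero, zero_mul]
    rw [Set.mem_prod] at hx
    tauto
  calc ∫ y, smear k q w y * f y ∂haarG₀
      = ∫ y, (∫ p, w p * k ((q p)⁻¹ * y) * f y) ∂haarG₀ := by
        simp only [smear, integral_mul_const]
    _ = ∫ p, (∫ y, w p * k ((q p)⁻¹ * y) * f y ∂haarG₀) :=
        integral_integral_swap_of_hasCompactSupport h hs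
    _ = ∫ p, c * (w p * f (q p)) := by
        refine integral_congr_ae (Filter.Eventually.of_forall fun p => ?_)
        simp only
        rw [← integral_mul_left_eq_self _ (q p)]
        simp only [inv_mul_cancel_left, mul_assoc]
        rw [integral_const_mul, hc]
        ring
    _ = c * ∫ p, w p * f (q p) := integral_const_mul _ _

/-- After Fubini, the substitution y ↦ δ⁻¹ q(p₁) y turns the inner integral into a value of k * k.
Symmetry k(g⁻¹) = k(g) and reality of k are what allow a convolution in place of k with its adjoint.
-/
theorem integral_smear_mul_conj_smear (hk : Continuous k) (hkc : HasCompactSupport k)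
    (hkinv : ∀ g, k g⁻¹ = k g) (hkr : ∀ g, conj (k g) = k g) (hq : Continuous q)
    (hw : Continuous w) (hwc : HasCompactSupport w) (δ : G₀) :
    ∫ y, smear k q w (δ * y) * conj (smear k q w y) ∂haarG₀ =
      ∫ p : (ℝ × ℝ) × (ℝ × ℝ), w p.1 * conj (w p.2) * conv k k ((q p.1)⁻¹ * δ * q p.2) := by
  set Ξ : G₀ → (ℝ × ℝ) × (ℝ × ℝ) → ℂ := fun y p =>
    (w p.1 * k ((q p.1)⁻¹ * (δ * y))) * (conj (w p.2) * k ((q p.2)⁻¹ * y)) with hΞ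
  have h : Continuous (Function.uncurry Ξ) := by
    have c1 : Continuous fun x : G₀ × ((ℝ × ℝ) × (ℝ × ℝ)) => k ((q x.2.1)⁻¹ * (δ * x.1)) :=
      hk.comp ((hq.comp (continuous_fst.comp continuous_snd)).inv.mul
        (continuous_const.mul continuous_fst))
    have c2 : Continuous fun x : G₀ × ((ℝ × ℝ) × (ℝ × ℝ)) => k ((q x.2.2)⁻¹ * x.1) :=
      hk.comp ((hq.comp (continuous_snd.comp continuous_snd)).inv.mul continuous_fst)
    exact ((hw.comp (continuous_fst.comp continuous_snd)).mul c1).mul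
      ((Complex.continuous_conj.comp (hw.comp (continuous_snd.comp continuous_snd))).mul c2)
  have hs : HasCompactSupport (Function.uncurry Ξ) := by
    refine HasCompactSupport.intro ((isCompact_smearSupport hkc hq hwc).prod
      (hwc.isCompact.prod hwc.isCompact)) fun x hx => ?_
    simp only [Function.uncurry, hΞ]
    by_contra h0
    have h1 : w x.2.1 ≠ 0 := left_ne_zero_of_mul (left_ne_zero_of_mul h0)
    have h2 := right_ne_zero_of_mul h0
    have h3 : w x.2.2 * k ((q x.2.2)⁻¹ * x.1) ≠ 0 := mul_ne_zero
      (fun h => left_ne_zero_of_mul h2 (by rw [h, map_zero])) (right_ne_zero_of_mul h2)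
    refine hx ⟨?_, subset_tsupport _ h1, ?_⟩
    · by_contra hn
      exact h3 (smear_integrand_eq_zero (Or.inr hn))
    · by_contra hn
      exact h3 (smear_integrand_eq_zero (Or.inl hn))
  calc ∫ y, smear k q w (δ * y) * conj (smear k q w y) ∂haarG₀
      = ∫ y, (∫ p, Ξ y p) ∂haarG₀ := by
        refine integral_congr_ae (Filter.Eventually.of_forall fun y => ?_)
        simp only [hΞ]
        rw [Measure.volume_eq_prod (ℝ × ℝ) (ℝ × ℝ), integral_prod_mul
          (fun p => w p * k ((q p)⁻¹ * (δ * y))) fun p => conj (w p) * k ((q p)⁻¹ * y),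
          smear, smear, ← integral_conj]
        simp only [map_mul, hkr]
    _ = ∫ p, (∫ y, Ξ y p ∂haarG₀) := integral_integral_swap_of_hasCompactSupport h hs
    _ = _ := by
        refine integral_congr_ae (Filter.Eventually.of_forall fun p => ?_)
        simp only [conv]
        rw [← integral_const_mul, ← integral_mul_left_eq_self _ (δ⁻¹ * q p.1)]
        refine integral_congr_ae (Filter.Eventually.of_forall fun y => ?_)
        simp only [hΞ]
        have e1 : (q p.1)⁻¹ * (δ * (δ⁻¹ * q p.1 * y)) = y := by group
        have e2 : (q p.2)⁻¹ * (δ⁻¹ * q p.1 * y) = (y⁻¹ * ((q p.1)⁻¹ * δ * q p.2))⁻¹ := by group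
        rw [e1, e2, hkinv]
        ring

/-- The weight of the cutoff function `b` on the coordinate plane. -/
def planeWeight (b : ℝ × ℝ → ℂ) (p : ℝ × ℝ) : ℂ := b p * (Real.exp (-p.2) : ℂ)

/-- The translate by `g₀` of the coordinate plane. -/
def planePoint (g₀ : G₀) (p : ℝ × ℝ) : G₀ := g₀ * n (p.1 : ℂ) * a p.2

theorem continuous_planePoint (g₀ : G₀) : Continuous (planePoint g₀) :=
  (continuous_const.mul (continuous_n.comp (Complex.continuous_ofReal.comp continuous_fst))).mul
    (continuous_a.comp continuous_snd)

theorem continuous_planeWeight {b : ℝ × ℝ → ℂ} (hb : Continuous b) : Continuous (planeWeight b) :=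
  hb.mul (Complex.continuous_ofReal.comp (Real.continuous_exp.comp continuous_snd.neg))

theorem hasCompactSupport_planeWeight {b : ℝ × ℝ → ℂ} (hb : HasCompactSupport b) :
    HasCompactSupport (planeWeight b) := hb.mul_right

theorem pairing_eq (g₀ : G₀) (f : G₀ → ℂ) (b : ℝ × ℝ → ℂ) :
    pairing g₀ f b = ∫ p, planeWeight b p * f (planePoint g₀ p) := by
  simp only [pairing, planeWeight, planePoint]
  exact integral_congr_ae (Filter.Eventually.of_forall fun p => by ring)

theorem integralI_eq (h : ℝ → ℝ) (b : ℝ × ℝ → ℂ) (lam : ℝ) (g₀ δ : G₀) :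
    integralI h b lam (g₀⁻¹ * δ * g₀) = ∫ p : (ℝ × ℝ) × (ℝ × ℝ),
      planeWeight b p.1 * conj (planeWeight b p.2) *
        conv (k0 h lam) (k0 h lam) ((planePoint g₀ p.1)⁻¹ * δ * planePoint g₀ p.2) := by
  refine integral_congr_ae (Filter.Eventually.of_forall fun p => ?_)
  have e : a (-p.1.2) * n (-(p.1.1 : ℂ)) * (g₀⁻¹ * δ * g₀) * n (p.2.1 : ℂ) * a p.2.2 =
      (planePoint g₀ p.1)⁻¹ * δ * planePoint g₀ p.2 := by
    simp only [planePoint, mul_inv_rev, n_inv, a_inv, mul_assoc]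
  simp only [planeWeight, kTest]
  rw [e, map_mul, Complex.conj_ofReal, sub_eq_add_neg, Real.exp_add, Complex.ofReal_mul]
  ring

theorem h0_neg (h : ℝ → ℝ) (lam s : ℝ) : h0 h lam (-s) = h0 h lam s := by
  simp only [h0, neg_neg, add_comm]

/-- The test function attached to the plane, the cutoff function and `k_λ⁰`. -/
def planeTest (h : ℝ → ℝ) (lam : ℝ) (g₀ : G₀) (b : ℝ × ℝ → ℂ) : G₀ → ℂ :=
  smear (k0 h lam) (planePoint g₀) (planeWeight b)

section

variable {h : ℝ → ℝ} (hh : IsPaleyWiener h) (lam : ℝ) (g₀ : G₀) {b : ℝ × ℝ → ℂ}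
  (hb : Continuous b) (hbc : HasCompactSupport b)

include hh hb hbc

theorem continuous_planeTest : Continuous (planeTest h lam g₀ b) :=
  continuous_smear (hasSphericalTransform_k0 hh lam).1 (continuous_planePoint g₀)
    (continuous_planeWeight hb) (hasCompactSupport_planeWeight hbc)

omit hb in
theorem hasCompactSupport_planeTest : HasCompactSupport (planeTest h lam g₀ b) :=
  hasCompactSupport_smear (hasSphericalTransform_k0 hh lam).2.1 (continuous_planePoint g₀)
    (hasCompactSupport_planeWeight hbc)

theorem integral_planeTest_mul {f : G₀ → ℂ} (hf : Continuous f)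
    (hfK : ∀ g, ∀ u ∈ K₀, f (g * u) = f g) (he : IsEigenfunction lam (inCoord f)) :
    ∫ y, planeTest h lam g₀ b y * f y ∂haarG₀ = h0 h lam lam * pairing g₀ f b := by
  obtain ⟨hk, hkc, hkb, hkt⟩ := hasSphericalTransform_k0 hh lam
  rw [pairing_eq, ← hkt]
  exact integral_smear_mul hk hkc (continuous_planePoint g₀) (continuous_planeWeight hb)
    (hasCompactSupport_planeWeight hbc) hf
    fun x => integral_mul_translate_eq hk hkc hkb hf hfK he x

theorem integral_planeTest_mul_conj (δ : G₀) :
    ∫ y, planeTest h lam g₀ b (δ * y) * conj (planeTest h lam g₀ b y) ∂haarG₀ =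
      integralI h b lam (g₀⁻¹ * δ * g₀) := by
  have hk := hasSphericalTransform_k0 hh lam
  rw [integralI_eq]
  exact integral_smear_mul_conj_smear hk.1 hk.2.1 (IsBiinvariant.apply_inv hk.2.2.1)
    (conj_eq_of_hasSphericalTransform hk (h0_neg h lam) fun s => Complex.conj_ofReal _)
    (continuous_planePoint g₀) (continuous_planeWeight hb) (hasCompactSupport_planeWeight hbc) δ

end

/-- The value is h(0) + h(-2λ) with h(-2λ) ≥ 0. This lower bound, uniform in λ, is why the constant
in the inequality can be one. -/
theorem one_le_norm_h0 {h : ℝ → ℝ} (h_nonneg : ∀ x, 0 ≤ h x) (h_zero : h 0 = 1) (lam : ℝ) :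
    1 ≤ ‖h0 h lam lam‖ := by
  rw [h0, sub_self, h_zero, Complex.norm_real, Real.norm_eq_abs]
  exact le_trans (by linarith [h_nonneg (-lam - lam)]) (le_abs_self _)

end HypThree

/-! ### The pretrace inequality for Hecke-Maass forms -/

namespace ArithmeticDatum

open HypThree Filter
open scoped Pointwise

variable {F E : Type*} [Field F] [NumberField F] [Field E] [NumberField E] [Algebra F E]
  (𝒟 : ArithmeticDatum F E) {μ : Measure 𝒟.Gfin} {ψ : 𝒟.GA → ℂ} {lam : ℝ}

/-- The action of `𝐆(F)` on `SL(2, ℂ) × 𝐆(𝔸_f)` by left translation. -/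
def translate (γ : 𝒟.GF) (p : G₀ × 𝒟.Gfin) : G₀ × 𝒟.Gfin := (𝒟.toG₀ γ * p.1, 𝒟.toFin γ * p.2)

theorem toG₀_one : 𝒟.toG₀ 1 = 1 := by rw [toG₀, map_one, map_one]

theorem toG₀_mul (γ γ' : 𝒟.GF) : 𝒟.toG₀ (γ * γ') = 𝒟.toG₀ γ * 𝒟.toG₀ γ' := by
  simp only [toG₀, map_mul]

theorem atV₀_mul (g g' : G₀) (u u' : 𝒟.Gfin) :
    𝒟.atV₀ (g * g') (u * u') = 𝒟.atV₀ g u * 𝒟.atV₀ g' u' := by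
  classical
  simp only [atV₀, map_mul, Prod.mk_mul_mk]
  congr 1
  convert Pi.mulSingle_mul (f := fun w => 𝒟.Ginf w) 𝒟.w₀ (𝒟.ι g) (𝒟.ι g')

theorem atV₀_one (u : 𝒟.Gfin) : 𝒟.atV₀ 1 u = (1, u) := by
  classical
  simp only [atV₀, map_one]
  congr 1
  convert Pi.mulSingle_one (M := fun w => 𝒟.Ginf w) 𝒟.w₀

theorem atV₀_mem_K {g : G₀} (hg : g ∈ K₀) : 𝒟.atV₀ g 1 ∈ 𝒟.K := by
  refine ⟨?_, one_mem _⟩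
  simp only [atV₀, Pi.mulSingle_eq_same, MulEquiv.symm_apply_apply]
  exact hg

variable {𝒟}

theorem IsHeckeMaassForm.apply_mul_K₀ (hψ : 𝒟.IsHeckeMaassForm μ ψ lam) (g : G₀) (u : 𝒟.Gfin)
    {k : G₀} (hk : k ∈ K₀) : ψ (𝒟.atV₀ (g * k) u) = ψ (𝒟.atV₀ g u) := by
  have h := 𝒟.atV₀_mul g k u 1
  rw [mul_one] at h
  rw [h, hψ.right_invariant _ _ (𝒟.atV₀_mem_K hk)]

/-- The diagonal γ also moves the infinite places other than w₀, where K contains the whole group.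
Right multiplication by κ undoes that motion without changing ψ. -/
theorem IsHeckeMaassForm.apply_translate (hψ : 𝒟.IsHeckeMaassForm μ ψ lam) (γ : 𝒟.GF)
    (p : G₀ × 𝒟.Gfin) :
    ψ (𝒟.atV₀ (𝒟.translate γ p).1 (𝒟.translate γ p).2) = ψ (𝒟.atV₀ p.1 p.2) := by
  classical
  set κ : 𝒟.GA := (Function.update (fun w => (𝒟.toInf w γ)⁻¹) 𝒟.w₀ 1, 1) with hκ
  have h1 : κ ∈ 𝒟.K := by
    refine ⟨?_, one_mem _⟩
    simp only [hκ, Function.update_self, map_one]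
    exact one_mem _
  have h2 : 𝒟.atV₀ (𝒟.translate γ p).1 (𝒟.translate γ p).2 =
      𝒟.diag γ * 𝒟.atV₀ p.1 p.2 * κ := by
    refine Prod.ext (funext fun w => ?_) (mul_one _).symm
    simp only [atV₀, diag, Prod.fst_mul, Pi.mul_apply, hκ, translate]
    by_cases hw : w = 𝒟.w₀
    · subst hw
      rw [Pi.mulSingle_eq_same, Pi.mulSingle_eq_same, Function.update_self, map_mul, mul_one, toG₀,
        MulEquiv.apply_symm_apply]
    · rw [Pi.mulSingle_eq_of_ne hw, Pi.mulSingle_eq_of_ne hw, Function.update_of_ne hw, mul_one,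
        mul_inv_cancel]
  rw [h2, hψ.right_invariant _ _ h1, hψ.left_invariant]

/-- Such γ lie in SU(2) and in K_f. If T(u) ≠ 0 then K_f u lies in the compact support of T, so γ is
confined to a compact set, and discreteness applies. -/
theorem finite_actsTrivially [IsTotallyReal F] {T : 𝒟.Gfin → ℂ} (hT : T ∈ 𝒟.heckeAlgebra)
    (hT0 : T ≠ 0) : {γ : 𝒟.GF | 𝒟.ActsTrivially γ}.Finite := by
  obtain ⟨u, hu⟩ := Function.ne_iff.1 hT0
  refine (𝒟.finite_setOf_mem (Ω₀ := (K₀ : Set G₀))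
    (isCompact_iff_compactSpace.2 (inferInstanceAs (CompactSpace K₀)))
    (hT.2.1.isCompact.image (continuous_mul_const u⁻¹))).subset fun γ hγ => ?_
  obtain ⟨h1, h2⟩ := hγ 1 1
  rw [mul_one, mul_one, inv_mem_iff] at h1 h2
  refine ⟨h1, 𝒟.toFin γ * u, subset_tsupport _ ?_, mul_inv_cancel_right _ _⟩
  have h3 := hT.2.2 _ h2 1 (one_mem _) u
  rw [mul_one] at h3
  rw [Function.mem_support, h3]
  exact hu

/-- The support of a nonzero T is a compact neighbourhood of a point, which makes 𝐆(𝔸_f) locally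
compact. -/
theorem sigmaFinite_of_mem_heckeAlgebra [μ.IsHaarMeasure] {T : 𝒟.Gfin → ℂ}
    (hT : T ∈ 𝒟.heckeAlgebra) (hT0 : T ≠ 0) : SigmaFinite μ := by
  obtain ⟨u, hu⟩ := Function.ne_iff.1 hT0
  have hn : tsupport T ∈ nhds u := mem_of_superset
    (hT.1.continuous.isOpen_preimage _ isOpen_compl_singleton |>.mem_nhds hu)
    (subset_tsupport _)
  have : LocallyCompactSpace 𝒟.Gfin := hT.2.1.isCompact.locallyCompactSpace_of_mem_nhds_of_group hn
  have : SecondCountableTopology 𝒟.Gfin := TopologicalSpace.Subtype.secondCountableTopology _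
  infer_instance

theorem IsFundDomain.isDomain [IsTotallyReal F] [μ.IsHaarMeasure] [SigmaFinite μ]
    {s : Set (G₀ × 𝒟.Gfin)} (hs : 𝒟.IsFundDomain μ s)
    (hZ : {γ : 𝒟.GF | 𝒟.ActsTrivially γ}.Finite) :
    Unfolding.IsDomain 𝒟.translate (haarG₀.prod μ) s {γ : 𝒟.GF | 𝒟.ActsTrivially γ} where
  one p := by simp [translate, toG₀_one]
  mul γ γ' p := by simp [translate, toG₀_mul, mul_assoc]
  measurePreserving γ := (measurePreserving_mul_left haarG₀ (𝒟.toG₀ γ)).prod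
    (measurePreserving_mul_left μ (𝒟.toFin γ))
  measurableSet := hs.measurableSet
  -- The points γp and p differ by a right translation in SU(2) × K_f, under which s is stable.
  mem_iff γ hγ p := by
    obtain ⟨h1, h2⟩ := hγ p.1 p.2
    constructor
    · intro h
      have := hs.right_invariant _ h _ h1 _ h2
      simpa only [translate, mul_inv_cancel_left, mul_assoc, mul_inv_rev, inv_mul_cancel_left] using this
    · intro h
      have := hs.right_invariant _ h _ (inv_mem h1) _ (inv_mem h2)
      simpa [translate, mul_assoc] using this
  covers := hs.covers
  disjoint γ hγ := hs.disjoint γ hγ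
  finite := hZ
  one_mem := fun g u => by simp [toG₀_one, one_mem]

theorem hconv_adjoint [μ.IsHaarMeasure] (T : 𝒟.Gfin → ℂ) (δ : 𝒟.Gfin) :
    𝒟.hconv μ T (𝒟.adjoint T) δ = ∫ u, T (δ * u) * conj (T u) ∂μ := by
  rw [hconv, ← integral_mul_left_eq_self _ δ]
  refine integral_congr_ae (Eventually.of_forall fun u => ?_)
  simp only [adjoint]
  congr 3
  group

theorem IsHeckeMaassForm.act_atV₀ (T : 𝒟.Gfin → ℂ) (g : G₀) :
    𝒟.act μ T ψ (𝒟.atV₀ g 1) = ∫ u, T u * ψ (𝒟.atV₀ g u) ∂μ := by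
  rw [act]
  refine integral_congr_ae (Eventually.of_forall fun u => ?_)
  simp only
  rw [← atV₀_one, ← atV₀_mul, mul_one, one_mul]

section

variable {h : ℝ → ℝ} (hh : IsPaleyWiener h) (hψ : 𝒟.IsHeckeMaassForm μ ψ lam) {b : ℝ × ℝ → ℂ}
  (hb : Continuous b) (hbc : HasCompactSupport b) (g₀ : G₀) {T : 𝒟.Gfin → ℂ}
  (hT : T ∈ 𝒟.heckeAlgebra)

theorem continuous_planeTest_mul (lam : ℝ) (hh : IsPaleyWiener h) (hb : Continuous b)
    (hbc : HasCompactSupport b) (hT : T ∈ 𝒟.heckeAlgebra) :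
    Continuous fun p : G₀ × 𝒟.Gfin => planeTest h lam g₀ b p.1 * T p.2 :=
  ((continuous_planeTest hh lam g₀ hb hbc).comp continuous_fst).mul
    (hT.1.continuous.comp continuous_snd)

theorem hasCompactSupport_planeTest_mul (lam : ℝ) (hh : IsPaleyWiener h)
    (hbc : HasCompactSupport b) (hT : T ∈ 𝒟.heckeAlgebra) :
    HasCompactSupport fun p : G₀ × 𝒟.Gfin => planeTest h lam g₀ b p.1 * T p.2 := by
  refine HasCompactSupport.intro
    ((hasCompactSupport_planeTest hh lam g₀ hbc).isCompact.prod hT.2.1.isCompact) fun p hp => ?_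
  by_contra h0
  exact hp ⟨subset_tsupport _ (left_ne_zero_of_mul h0), subset_tsupport _ (right_ne_zero_of_mul h0)⟩

include hh hψ hb hbc hT in
-- For fixed u the eigenvalue principle on ℍ³ extracts h_λ⁰(λ) and leaves a plane integral of ψ(·,
-- u). Integrating over u against T then produces the Hecke operator.
theorem IsHeckeMaassForm.integral_planeTest_mul_eq [μ.IsHaarMeasure] [SigmaFinite μ] :
    ∫ p, planeTest h lam g₀ b p.1 * T p.2 * ψ (𝒟.atV₀ p.1 p.2) ∂(haarG₀.prod μ) =
      h0 h lam lam * pairing g₀ (fun g => 𝒟.act μ T ψ (𝒟.atV₀ g 1)) b := by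
  have hi : Integrable (fun p : G₀ × 𝒟.Gfin =>
      planeTest h lam g₀ b p.1 * T p.2 * ψ (𝒟.atV₀ p.1 p.2)) (haarG₀.prod μ) :=
    ((continuous_planeTest_mul g₀ lam hh hb hbc hT).mul hψ.continuous).integrable_of_hasCompactSupport
      (hasCompactSupport_planeTest_mul g₀ lam hh hbc hT).mul_right
  have hu : ∀ u, ∫ y, planeTest h lam g₀ b y * T u * ψ (𝒟.atV₀ y u) ∂haarG₀ =
      h0 h lam lam * ∫ p, T u * (planeWeight b p * ψ (𝒟.atV₀ (planePoint g₀ p) u)) := fun u => by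
    have e := integral_planeTest_mul hh lam g₀ hb hbc
      (f := fun y => ψ (𝒟.atV₀ y u)) (hψ.continuous.comp (continuous_id.prodMk continuous_const))
      (fun g k hk => hψ.apply_mul_K₀ g u hk)
      (isEigenfunction_of_laplacian (hψ.smooth u) (hψ.eigen_laplacian u))
    rw [pairing_eq] at e
    rw [integral_const_mul, mul_left_comm, ← e, ← integral_const_mul]
    exact integral_congr_ae (Eventually.of_forall fun y => by ring)
  have hc : Continuous (Function.uncurry fun (u : 𝒟.Gfin) (p : ℝ × ℝ) =>
      T u * (planeWeight b p * ψ (𝒟.atV₀ (planePoint g₀ p) u))) :=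
    (hT.1.continuous.comp continuous_fst).mul (((continuous_planeWeight hb).comp
      continuous_snd).mul (hψ.continuous.comp
        (((continuous_planePoint g₀).comp continuous_snd).prodMk continuous_fst)))
  have hcs : HasCompactSupport (Function.uncurry fun (u : 𝒟.Gfin) (p : ℝ × ℝ) =>
      T u * (planeWeight b p * ψ (𝒟.atV₀ (planePoint g₀ p) u))) := by
    refine HasCompactSupport.intro
      (hT.2.1.isCompact.prod (hasCompactSupport_planeWeight hbc).isCompact) fun x hx => ?_
    by_contra h0
    exact hx ⟨subset_tsupport _ (left_ne_zero_of_mul h0),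
      subset_tsupport _ (left_ne_zero_of_mul (right_ne_zero_of_mul h0))⟩
  rw [integral_prod_symm _ hi]
  simp only [hu]
  rw [integral_const_mul, integral_integral_swap_of_hasCompactSupport hc hcs, pairing_eq]
  congr 1
  refine integral_congr_ae (Eventually.of_forall fun p => ?_)
  simp only
  rw [act_atV₀, ← integral_const_mul]
  exact integral_congr_ae (Eventually.of_forall fun u => by ring)

include hh hb hbc in
-- The test function is a product and γ acts on each factor, so the correlation splits into T * T^*
-- at the finite places and I(λ, ·) at v₀.
theorem integral_planeTest_mul_translate (lam : ℝ) [μ.IsHaarMeasure] [SigmaFinite μ]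
    (γ : 𝒟.GF) :
    ∫ p, planeTest h lam g₀ b (𝒟.translate γ p).1 * T (𝒟.translate γ p).2 *
        conj (planeTest h lam g₀ b p.1 * T p.2) ∂(haarG₀.prod μ) =
      𝒟.hconv μ T (𝒟.adjoint T) (𝒟.toFin γ) * integralI h b lam (g₀⁻¹ * 𝒟.toG₀ γ * g₀) := by
  rw [hconv_adjoint, ← integral_planeTest_mul_conj hh lam g₀ hb hbc, mul_comm,
    ← integral_prod_mul
      (fun y => planeTest h lam g₀ b (𝒟.toG₀ γ * y) * conj (planeTest h lam g₀ b y))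
      fun u => T (𝒟.toFin γ * u) * conj (T u)]
  refine integral_congr_ae (Eventually.of_forall fun p => ?_)
  simp only [translate, map_mul]
  ring

include hh hbc hT in
-- A nonzero product forces γ into supp · supp⁻¹ in both factors, a compact set; discreteness of
-- 𝐆(F) leaves finitely many γ.
theorem exists_finset_planeTest_mul_translate [IsTotallyReal F] (lam : ℝ) :
    ∃ Δ : Finset 𝒟.GF, ∀ γ ∉ Δ, ∀ p : G₀ × 𝒟.Gfin,
      planeTest h lam g₀ b (𝒟.translate γ p).1 * T (𝒟.translate γ p).2 *
        conj (planeTest h lam g₀ b p.1 * T p.2) = 0 := by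
  have c1 := (hasCompactSupport_planeTest hh lam g₀ hbc).isCompact
  have c2 := hT.2.1.isCompact
  have hfin := 𝒟.finite_setOf_mem (c1.mul c1.inv) (c2.mul c2.inv)
  refine ⟨hfin.toFinset, fun γ hγ p => ?_⟩
  by_contra h0
  have h1 := left_ne_zero_of_mul h0
  have h2 := (map_ne_zero _).1 (right_ne_zero_of_mul h0)
  refine hγ (hfin.mem_toFinset.2 ⟨⟨_, subset_tsupport _ (left_ne_zero_of_mul h1), _,
    Set.inv_mem_inv.2 (subset_tsupport _ (left_ne_zero_of_mul h2)), ?_⟩, ⟨_, subset_tsupport _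
    (right_ne_zero_of_mul h1), _, Set.inv_mem_inv.2 (subset_tsupport _
    (right_ne_zero_of_mul h2)), ?_⟩⟩)
  · exact mul_inv_cancel_right _ _
  · exact mul_inv_cancel_right _ _

include hh hψ hb hbc hT in
/-- The amplification inequality, for a Hecke operator that is not zero. -/
theorem IsHeckeMaassForm.norm_pairing_sq_le [IsTotallyReal F] [μ.IsHaarMeasure]
    (h_nonneg : ∀ x, 0 ≤ h x) (h_zero : h 0 = 1) (hT0 : T ≠ 0) :
    (Summable fun γ : 𝒟.GF => ‖𝒟.hconv μ T (𝒟.adjoint T) (𝒟.toFin γ) *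
      integralI h b lam (g₀⁻¹ * 𝒟.toG₀ γ * g₀)‖) ∧
    ‖pairing g₀ (fun g => 𝒟.act μ T ψ (𝒟.atV₀ g 1)) b‖ ^ 2 ≤
      ∑' γ : 𝒟.GF, ‖𝒟.hconv μ T (𝒟.adjoint T) (𝒟.toFin γ) *
        integralI h b lam (g₀⁻¹ * 𝒟.toG₀ γ * g₀)‖ := by
  have : SigmaFinite μ := sigmaFinite_of_mem_heckeAlgebra hT hT0
  obtain ⟨s, hs, hs1⟩ := hψ.normalized
  obtain ⟨Δ, hΔ⟩ := exists_finset_planeTest_mul_translate hh hbc g₀ hT lam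
  have hcorr := fun γ : 𝒟.GF =>
    integral_planeTest_mul_translate (μ := μ) hh hb hbc g₀ (T := T) lam γ
  have hzero : ∀ γ ∉ Δ, ‖𝒟.hconv μ T (𝒟.adjoint T) (𝒟.toFin γ) *
      integralI h b lam (g₀⁻¹ * 𝒟.toG₀ γ * g₀)‖ = 0 := fun γ hγ => by
    rw [← hcorr γ]
    simp only [hΔ γ hγ, integral_zero, norm_zero]
  refine ⟨summable_of_ne_finset_zero hzero, ?_⟩
  rw [tsum_eq_sum hzero]
  have hD := hs.isDomain (finite_actsTrivially hT hT0)
  have hg := continuous_planeTest_mul g₀ lam hh hb hbc hT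
  have hgs := hasCompactSupport_planeTest_mul g₀ lam hh hbc hT
  have key := hD.norm_integral_sq_le hψ.continuous.measurable hg.measurable
    (fun γ p => hψ.apply_translate γ p) hs1
    ((hg.mul hψ.continuous).integrable_of_hasCompactSupport hgs.mul_right)
    (fun γ => ((hg.comp ((continuous_const.mul continuous_fst).prodMk
      (continuous_const.mul continuous_snd))).mul
        (Complex.continuous_conj.comp hg)).integrable_of_hasCompactSupport
          (hgs.comp_left (map_zero _)).mul_left) Δ hΔ
  simp only [hcorr] at key
  rw [hψ.integral_planeTest_mul_eq hh hb hbc g₀ hT, norm_mul, mul_pow] at key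
  refine le_trans (le_mul_of_one_le_left (sq_nonneg _) ?_) key
  exact one_le_pow₀ (one_le_norm_h0 h_nonneg h_zero lam)

end

end ArithmeticDatum

end

theorem mainTheorem4 {F E : Type*} [Field F] [NumberField F] [NumberField.IsTotallyReal F]
    [Field E] [NumberField E] [Algebra F E] (𝒟 : ArithmeticDatum F E)
    (μ : Measure 𝒟.Gfin) [μ.IsHaarMeasure] (hμ : μ (𝒟.Kf : Set 𝒟.Gfin) = 1)
    (h : ℝ → ℝ) (h_pw : HypThree.IsPaleyWiener h) (h_nonneg : ∀ x, 0 ≤ h x) (h_zero : h 0 = 1) :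
    ∃ C : ℝ, 0 < C ∧
      ∀ (lam : ℝ) (ψ : 𝒟.GA → ℂ), 𝒟.IsHeckeMaassForm μ ψ lam →
      ∀ b : ℝ × ℝ → ℂ, ContDiff ℝ ∞ b → HasCompactSupport b →
      ∀ (g₀ : HypThree.G₀) (T : 𝒟.Gfin → ℂ), T ∈ 𝒟.heckeAlgebra →
        (Summable fun γ : 𝒟.GF => ‖𝒟.hconv μ T (𝒟.adjoint T) (𝒟.toFin γ) *
          HypThree.integralI h b lam (g₀⁻¹ * 𝒟.toG₀ γ * g₀)‖) ∧
        ‖HypThree.pairing g₀ (fun g => 𝒟.act μ T ψ (𝒟.atV₀ g 1)) b‖ ^ 2 ≤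
          C * ∑' γ : 𝒟.GF, ‖𝒟.hconv μ T (𝒟.adjoint T) (𝒟.toFin γ) *
            HypThree.integralI h b lam (g₀⁻¹ * 𝒟.toG₀ γ * g₀)‖ := by
  refine ⟨1, one_pos, fun lam ψ hψ b hb hbc g₀ T hT => ?_⟩
  rw [one_mul]
  -- For T = 0 both sides vanish. The case is separate because a nonzero T is what supplies
  -- σ-finiteness of μ and finiteness of the group acting trivially.
  by_cases hT0 : T = 0
  · subst hT0
    simp [ArithmeticDatum.hconv, ArithmeticDatum.act, HypThree.pairing, summable_zero]
  · exact hψ.norm_pairing_sq_le h_pw hb.continuous hbc g₀ hT h_nonneg h_zero hT0
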